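/- Let $\mathbb F$ be a field. A tensor is a trilinear form $T=\sum_{i,j,l} a_{ijl}X_iY_jZ_l$ over $\mathbb F$ in three disjoint finite sets of variables; its rank $\mathbf R(T)$ is the least $r$ such that $T$ is a sum of $r$ products $\alpha(X)\beta(Y)\gamma(Z)$ of linear forms; $T^{\otimes r}$ is the $r$-fold Kronecker product of $T$ with itself; and $\mathrm{AR}(T)=\lim_{r\to\infty}\mathbf R(T^{\otimes r})^{1/r}$ is its asymptotic rank. For $k\ge 1$ let \[T_k=\sum_{\substack{S,T,U\in\binom{[3k]}{k}\\ S\cup T\cup U=[3k]}}X_SY_TZ_U .\] Balanced tripartitioning on a universe of size $3n$ is the following problem: given $\mathcal F_1,\mathcal F_2,\mathcal F_3\subseteq\binom{[3n]}{n}$ (each listed without repetitions), decide whether there are $S_i\in\mathcal F_i$ with $S_1\cup S_2\cup S_3=[3n]$. Theorem. For every field $\mathbb F$, every integer $k\ge 1$ and every $\varepsilon>0$ there is a randomized algorithm (on a random access machine with logarithmic cost and fair coin tosses) that solves balanced tripartitioning: it halts on every instance, never accepts an instance without such $S_1,S_2,S_3$, and accepts every instance that has them with probability at least $2/3$. For all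 sufficiently large $n$, its running time on every instance on a universe of size $3n$, whatever the coin tosses, is at most \[\left(\frac{(\mathrm{AR}(T_k)+\varepsilon)\cdot 27^k}{\binom{3k}{k}\binom{2k}{k}}\right)^{n/k},\] where $\mathrm{AR}(T_k)$ is taken over $\mathbb F$. -/

import Mathlib

open Filter Topology

/-! ### Tensors, tensor rank, asymptotic rank -/

section Tensors

variable {F : Type*} [Field F] {ι : Type*}

/-- The coefficient array `(a_{ijk})` of a trilinear form `∑ a_{ijk} X_i Y_j Z_k` in three disjoint
sets of variables indexed by `ι`. -/
abbrev Tensor (F ι : Type*) := ι → ι → ι → F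

/-- `T` is a sum of `r` products of a linear form in `X`, a linear form in `Y` and a linear form
in `Z` (the scalars of a linear combination are absorbed in the first form). -/
def HasRankDecomposition (T : Tensor F ι) (r : ℕ) : Prop :=
  ∃ a b c : Fin r → ι → F, ∀ i j k, T i j k = ∑ l, a l i * b l j * c l k

/-- The tensor rank of `T`. -/
noncomputable def tensorRank (T : Tensor F ι) : ℕ :=
  sInf {r | HasRankDecomposition T r}

/-- The `r`-fold Kronecker product of `T` with itself. -/
def kroneckerPow (T : Tensor F ι) (r : ℕ) : Tensor F (Fin r → ι) :=
  fun a b c => ∏ i, T (a i) (b i) (c i)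

/-- The asymptotic rank of `T`, the limit of `R(T^{⊗ r})^{1/r}`; the limit exists,
see `tendsto_asymptoticRank`. -/
noncomputable def asymptoticRank (T : Tensor F ι) : ℝ :=
  limUnder atTop (fun r : ℕ => (tensorRank (kroneckerPow T r) : ℝ) ^ (1 / (r : ℝ)))

theorem exists_hasRankDecomposition [Fintype ι] (T : Tensor F ι) :
    ∃ r, HasRankDecomposition T r := by
  classical
  let e := Fintype.equivFin (ι × ι)
  refine ⟨Fintype.card (ι × ι), fun l i => if i = (e.symm l).1 then 1 else 0,
    fun l j => if j = (e.symm l).2 then 1 else 0,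
    fun l m => T (e.symm l).1 (e.symm l).2 m, fun i j m => ?_⟩
  rw [Equiv.sum_comp e.symm (fun p : ι × ι =>
    (if i = p.1 then (1 : F) else 0) * (if j = p.2 then 1 else 0) * T p.1 p.2 m),
    Fintype.sum_prod_type]
  simp

theorem tensorRank_kroneckerPow_add [Fintype ι] (T : Tensor F ι) (r s : ℕ) :
    tensorRank (kroneckerPow T (r + s)) ≤
      tensorRank (kroneckerPow T r) * tensorRank (kroneckerPow T s) := by
  obtain ⟨a, b, c, h⟩ : HasRankDecomposition (kroneckerPow T r) (tensorRank (kroneckerPow T r)) :=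
    Nat.sInf_mem (exists_hasRankDecomposition _)
  obtain ⟨a', b', c', h'⟩ :
      HasRankDecomposition (kroneckerPow T s) (tensorRank (kroneckerPow T s)) :=
    Nat.sInf_mem (exists_hasRankDecomposition _)
  refine Nat.sInf_le ?_
  let e := (finProdFinEquiv (m := tensorRank (kroneckerPow T r))
    (n := tensorRank (kroneckerPow T s))).symm
  refine ⟨fun l i => a (e l).1 (fun x => i (Fin.castAdd s x)) *
      a' (e l).2 (fun x => i (Fin.natAdd r x)),
    fun l i => b (e l).1 (fun x => i (Fin.castAdd s x)) *
      b' (e l).2 (fun x => i (Fin.natAdd r x)),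
    fun l i => c (e l).1 (fun x => i (Fin.castAdd s x)) *
      c' (e l).2 (fun x => i (Fin.natAdd r x)), fun i j m => ?_⟩
  have h1 := h (fun x => i (Fin.castAdd s x)) (fun x => j (Fin.castAdd s x))
    (fun x => m (Fin.castAdd s x))
  have h2 := h' (fun x => i (Fin.natAdd r x)) (fun x => j (Fin.natAdd r x))
    (fun x => m (Fin.natAdd r x))
  have h3 : kroneckerPow T (r + s) i j m =
      kroneckerPow T r (fun x => i (Fin.castAdd s x)) (fun x => j (Fin.castAdd s x))
        (fun x => m (Fin.castAdd s x)) *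
      kroneckerPow T s (fun x => i (Fin.natAdd r x)) (fun x => j (Fin.natAdd r x))
        (fun x => m (Fin.natAdd r x)) := by
    simp only [kroneckerPow, Fin.prod_univ_add]
  rw [h3, h1, h2, Finset.sum_mul_sum, ← Fintype.sum_prod_type', ← Equiv.sum_comp e]
  refine Finset.sum_congr rfl fun l _ => ?_
  ring

/-- The limit that defines the asymptotic rank exists. -/
theorem tendsto_asymptoticRank [Fintype ι] (T : Tensor F ι) :
    Tendsto (fun r : ℕ => (tensorRank (kroneckerPow T r) : ℝ) ^ (1 / (r : ℝ))) atTop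
      (𝓝 (asymptoticRank T)) := by
  refine tendsto_nhds_limUnder ?_
  by_cases h0 : ∃ r, tensorRank (kroneckerPow T r) = 0
  · obtain ⟨r, hr⟩ := h0
    refine ⟨0, tendsto_const_nhds.congr' ?_⟩
    filter_upwards [eventually_ge_atTop (r + 1)] with s hs
    have h := tensorRank_kroneckerPow_add T r (s - r)
    rw [hr, zero_mul, Nat.le_zero, Nat.add_sub_cancel' (by omega)] at h
    have hs' : (s : ℝ) ≠ 0 := by
      have : s ≠ 0 := by omega
      exact_mod_cast this
    rw [h, Nat.cast_zero, Real.zero_rpow (by positivity)]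
  · push Not at h0
    have hpos : ∀ r, (0 : ℝ) < tensorRank (kroneckerPow T r) := fun r => by
      exact_mod_cast Nat.pos_of_ne_zero (h0 r)
    have hsub : Subadditive fun r : ℕ => Real.log (tensorRank (kroneckerPow T r)) := by
      intro r s
      rw [← Real.log_mul (hpos r).ne' (hpos s).ne']
      exact Real.log_le_log (hpos _) (by exact_mod_cast tensorRank_kroneckerPow_add T r s)
    have hlim := hsub.tendsto_lim ⟨0, by
      rintro _ ⟨r, rfl⟩
      exact div_nonneg (Real.log_natCast_nonneg _) (Nat.cast_nonneg _)⟩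
    refine ⟨_, ((Real.continuous_exp.tendsto _).comp hlim).congr fun r => ?_⟩
    rw [Function.comp_apply, Real.rpow_def_of_pos (hpos r), mul_one_div]

end Tensors

/-- The tensor `T_k = ∑ X_S Y_T Z_U`, the sum over all triples `S, T, U` of `k`-subsets of `[3k]`
with `S ∪ T ∪ U = [3k]`. -/
def tripartitionTensor (F : Type*) [Field F] (k : ℕ) :
    Tensor F {S : Finset (Fin (3 * k)) // S.card = k} :=
  fun S T U => if S.1 ∪ T.1 ∪ U.1 = Finset.univ then 1 else 0

/-! ### Randomized random access machines with logarithmic cost -/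

/-- Arithmetic operations on natural numbers; `sub` truncates at `0`, `div` and `mod` are
division with remainder (with `x div 0 = 0` and `x mod 0 = x`). -/
inductive RAMOp
  | add | sub | mul | div | mod

/-- The value of an arithmetic operation. -/
def RAMOp.eval : RAMOp → ℕ → ℕ → ℕ
  | add, x, y => x + y
  | sub, x, y => x - y
  | mul, x, y => x * y
  | div, x, y => x / y
  | mod, x, y => x % y

/-- Programs of a random access machine with registers and a memory, all of whose cells hold
natural numbers. The numbers `x y z` are names of registers. -/
inductive RAMProg
  /-- `x := c` -/
  | const (x c : ℕ)
  /-- `x := y o z` -/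
  | op (o : RAMOp) (x y z : ℕ)
  /-- `x := mem[y]` -/
  | load (x y : ℕ)
  /-- `mem[x] := y` -/
  | store (x y : ℕ)
  /-- `x :=` a fair random bit -/
  | flip (x : ℕ)
  /-- first `p`, then `q` -/
  | seq (p q : RAMProg)
  /-- if `x ≠ 0` then `p` else `q` -/
  | ite (x : ℕ) (p q : RAMProg)
  /-- while `x ≠ 0` do `p` -/
  | loop (x : ℕ) (p : RAMProg)

/-- A configuration: the contents of registers and memory, and the coin tosses not yet used. -/
structure RAMState where
  reg : ℕ → ℕ
  mem : ℕ → ℕ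
  coins : List Bool

/-- The configuration after writing `v` to register `x`. -/
def RAMState.setReg (s : RAMState) (x v : ℕ) : RAMState :=
  { s with reg := Function.update s.reg x v }

/-- The configuration after writing `v` to memory cell `a`. -/
def RAMState.setMem (s : RAMState) (a v : ℕ) : RAMState :=
  { s with mem := Function.update s.mem a v }

/-- `RAMExec p s s' t`: started in `s`, the program `p` halts in `s'` after time `t`.
Every step costs one plus the bit lengths of the numbers and addresses it handles, except that
arithmetic on numbers of `l` and `m` bits costs `(l + 1) * (m + 1)`. A run that needs more coin
tosses than there are does not halt. -/
inductive RAMExec : RAMProg → RAMState → RAMState → ℕ → Prop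
  | const (s : RAMState) (x c : ℕ) :
      RAMExec (.const x c) s (s.setReg x c) (1 + c.size)
  | op (s : RAMState) (o : RAMOp) (x y z : ℕ) :
      RAMExec (.op o x y z) s (s.setReg x (o.eval (s.reg y) (s.reg z)))
        (((s.reg y).size + 1) * ((s.reg z).size + 1))
  | load (s : RAMState) (x y : ℕ) :
      RAMExec (.load x y) s (s.setReg x (s.mem (s.reg y)))
        (1 + (s.reg y).size + (s.mem (s.reg y)).size)
  | store (s : RAMState) (x y : ℕ) :
      RAMExec (.store x y) s (s.setMem (s.reg x) (s.reg y))
        (1 + (s.reg x).size + (s.reg y).size)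
  | flip (s : RAMState) (x : ℕ) (b : Bool) (bs : List Bool) (h : s.coins = b :: bs) :
      RAMExec (.flip x) s { (s.setReg x b.toNat) with coins := bs } 1
  | seq {p q : RAMProg} {s s' s'' : RAMState} {t t' : ℕ}
      (hp : RAMExec p s s' t) (hq : RAMExec q s' s'' t') :
      RAMExec (.seq p q) s s'' (t + t')
  | ite_true {x : ℕ} {p q : RAMProg} {s s' : RAMState} {t : ℕ}
      (hx : s.reg x ≠ 0) (hp : RAMExec p s s' t) :
      RAMExec (.ite x p q) s s' (1 + (s.reg x).size + t)
  | ite_false {x : ℕ} {p q : RAMProg} {s s' : RAMState} {t : ℕ}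
      (hx : s.reg x = 0) (hq : RAMExec q s s' t) :
      RAMExec (.ite x p q) s s' (1 + (s.reg x).size + t)
  | loop_true {x : ℕ} {p : RAMProg} {s s' s'' : RAMState} {t t' : ℕ}
      (hx : s.reg x ≠ 0) (hp : RAMExec p s s' t) (hw : RAMExec (.loop x p) s' s'' t') :
      RAMExec (.loop x p) s s'' (1 + (s.reg x).size + t + t')
  | loop_false {x : ℕ} {p : RAMProg} {s : RAMState} (hx : s.reg x = 0) :
      RAMExec (.loop x p) s s (1 + (s.reg x).size)

/-- The start configuration: the input is in memory from address `0` on, everything else is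
`0`, and the coin tosses are `ω`. -/
def RAMState.start (input : List ℕ) {t : ℕ} (ω : Fin t → Bool) : RAMState where
  reg := fun _ => 0
  mem := fun a => input.getD a 0
  coins := List.ofFn ω

/-- With coin tosses `ω`, the program `P` halts on the input with a nonzero value in
register `0`. -/
def RAMAccepts (P : RAMProg) (input : List ℕ) {t : ℕ} (ω : Fin t → Bool) : Prop :=
  ∃ s' τ, RAMExec P (RAMState.start input ω) s' τ ∧ s'.reg 0 ≠ 0

/-- The probability that `P` accepts the input, for `t` independent fair coin tosses. -/
noncomputable def acceptProb (P : RAMProg) (input : List ℕ) (t : ℕ) : ℝ :=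
  (Nat.card {ω : Fin t → Bool // RAMAccepts P input ω} : ℝ) / 2 ^ t

/-- `P` is a randomized algorithm which on the given input decides whether `yes` holds, within
time `t`: it halts within time `t` whatever the coin tosses are (`t` of them suffice, as each
takes time `1`), it never accepts if `yes` is false, and it accepts with probability at least
`2/3` if `yes` is true. -/
structure DecidesWithin (P : RAMProg) (input : List ℕ) (yes : Prop) (t : ℕ) : Prop where
  halts : ∀ ω : Fin t → Bool, ∃ s' τ, RAMExec P (RAMState.start input ω) s' τ ∧ τ ≤ t
  sound : ¬ yes → acceptProb P input t = 0
  complete : yes → 2 / 3 ≤ acceptProb P input t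

/-! ### Balanced tripartitioning -/

/-- An instance of balanced tripartitioning on the universe `[3n]`: three families of `n`-subsets,
each listed in an arbitrary order without repetitions. -/
structure TripartitioningInstance (n : ℕ) where
  fam : Fin 3 → List (Finset (Fin (3 * n)))
  nodup : ∀ i, (fam i).Nodup
  card_eq : ∀ i, ∀ S ∈ fam i, S.card = n

namespace TripartitioningInstance

variable {n : ℕ}

/-- There are `S_i` in the three families with `S_1 ∪ S_2 ∪ S_3 = [3n]`. -/
def HasTripartition (I : TripartitioningInstance n) : Prop :=
  ∃ S₁ ∈ I.fam 0, ∃ S₂ ∈ I.fam 1, ∃ S₃ ∈ I.fam 2, S₁ ∪ S₂ ∪ S₃ = Finset.univ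

/-- A subset of `[3n]` as a `3n`-bit number. -/
def bitmask (S : Finset (Fin (3 * n))) : ℕ :=
  ∑ i ∈ S, 2 ^ (i : ℕ)

/-- The input of the algorithm: `n`, the sizes of the three families, and their members. -/
def encode (I : TripartitioningInstance n) : List ℕ :=
  [n, (I.fam 0).length, (I.fam 1).length, (I.fam 2).length] ++
    (I.fam 0 ++ I.fam 1 ++ I.fam 2).map bitmask

end TripartitioningInstance

/-! ### A small imperative language with arrays, compiled to random access machines -/

/-! Cut the universe into blocks of size `3k`. The `n/k`-fold Kronecker power of `T_k`, evaluated at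
the indicator vectors of three families, counts the solutions all of whose sets have exactly `k`
elements in every block. A rank decomposition of length `R` of a tensor allows its `m`-th power to
be evaluated in about `R^m` operations: Yates' algorithm applies the three coefficient matrices
coordinate by coordinate, and the products of the transformed vectors are added up
(`Gadget.form_yatesStep`).

A given solution need not respect the blocks, so the universe is permuted at random. Write `c =
binom(3k,k) binom(2k,k)`. There are at least `c^(n/k)` tripartitions that respect the blocks, each
is carried to the given solution by at least `n!^3` permutations, and `(3n)! ≤ 27^n n!^3`. So a
trial makes the solution visible with probability about `(c/27^k)^(n/k)`
(`Gadget.le_coinProb_shuffle`). The inverse of this many trials, each costing about `AR(T_k)^(n/k)`,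
gives the bound. The following points remain.

Field. The machine can compute in `ZMod p` but not in an arbitrary `F`. Since `T_k` has integer
coefficients, a rank decomposition is a solution of polynomial equations over the integers. A
solution in `F` yields one in a field that is finitely generated as a ring, hence finite over some
`ZMod p`. Descending to `ZMod p` costs a constant factor, which disappears on passing to a higher
power (`exists_hasRankDecomposition_zmod`). So a fixed power `T_k^{⊗r}` over `ZMod p` has rank at
most `(AR + ε/2)^r`; together with its index sets it forms a `Gadget`, with `K = k r`.

Cancellation. The number of visible solutions may vanish modulo `p`. Each set therefore gets a
random weight `0` or `1`: a trilinear form with a nonzero coefficient survives this with probability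
at least `1/8` (`coinProb.trilinear`). A nonzero value always certifies a solution, so the error is
one-sided.

Divisibility. If `K` does not divide `n`, each family receives its own dummy elements, which are
added to all of its sets.

Input. Reading the families takes time about `binom(3n,n) ≤ (27/4)^n`. This is no obstacle, because
the tensor is concise: its rank is at least the number of its `X`-variables, which forces the
claimed rate to be at least `27/4` per element (`le_of_hasRankDecomposition`, `Gadget.le_rate`).

Machine. The algorithm is written in a small language with bounded loops and compiled. The rules for
`Runs` prove correctness, a bound `w` for the bit lengths and a bound for the number of steps at
once; a step costs at most `(w+1)^2`. As `w` is polynomial in `n`, all overhead is polynomial and is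
absorbed by the remaining `ε/2`. -/

/-- The variables of the programs below. -/
inductive Var
  | res | dim | blocks | points | inputLen | numIdx | numRank | trials | countPow | total
  | powX | powE | off | powF | size | fam | loopPow | loopInput | loopTrial | loopBit
  | loopPos | loopBlock | loopIdx | loopGood | loopElt | loopOut
  | seed | coin | digit | tmp | acc | rest | mask | len | quo
  deriving DecidableEq

namespace Var

/-- The number of a variable. -/
def idx (v : Var) : ℕ := v.ctorIdx

theorem idx_injective : Function.Injective idx := by
  intro v v' h
  have := congrArg Var.ofNat h
  rwa [show Var.ofNat v.idx = v from Var.ofNat_ctorIdx v,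
    show Var.ofNat v'.idx = v' from Var.ofNat_ctorIdx v'] at this

end Var

/-- The arrays of the programs below. -/
inductive Arr
  | table | perm | blockMask | vec | vecNew | prod | pos | coef
  deriving DecidableEq

namespace Arr

/-- The number of an array. -/
def idx (a : Arr) : ℕ := a.ctorIdx

theorem idx_injective : Function.Injective idx := by
  intro v v' h
  have := congrArg Arr.ofNat h
  rwa [show Arr.ofNat v.idx = v from Arr.ofNat_ctorIdx v,
    show Arr.ofNat v'.idx = v' from Arr.ofNat_ctorIdx v'] at this

theorem idx_lt (a : Arr) : a.idx < 8 := by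
  cases a <;> decide

/-- The eight arrays share the memory by residues modulo `8`, so each is unbounded and a write to
one never disturbs another. -/
theorem addr_inj {a a' : Arr} {i i' : ℕ} :
    8 * i + a.idx = 8 * i' + a'.idx ↔ a = a' ∧ i = i' := by
  refine ⟨fun h => ?_, by rintro ⟨rfl, rfl⟩; rfl⟩
  have h1 := a.idx_lt
  have h2 := a'.idx_lt
  exact ⟨idx_injective (by omega), by omega⟩

end Arr

/-- The state of a program: variables, memory cells and unused coin tosses. -/
structure Store where
  var : Var → ℕ
  cell : ℕ → ℕ
  coins : List Bool

namespace Store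

/-- Entry `i` of the array `a`. -/
def arr (s : Store) (a : Arr) (i : ℕ) : ℕ := s.cell (8 * i + a.idx)

/-- Assignment to a variable. -/
def set (s : Store) (x : Var) (v : ℕ) : Store := { s with var := Function.update s.var x v }

/-- Assignment to an entry of an array. -/
def put (s : Store) (a : Arr) (i v : ℕ) : Store :=
  { s with cell := Function.update s.cell (8 * i + a.idx) v }

/-- Replacing the unused coin tosses. -/
def setCoins (s : Store) (l : List Bool) : Store := { s with coins := l }

variable (s : Store)

@[simp] theorem set_var (x y : Var) (v : ℕ) :
    (s.set x v).var y = if y = x then v else s.var y := by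
  simp [set, Function.update_apply]

@[simp] theorem set_cell (x : Var) (v : ℕ) : (s.set x v).cell = s.cell := rfl

@[simp] theorem set_arr (x : Var) (v : ℕ) : (s.set x v).arr = s.arr := rfl

@[simp] theorem set_coins (x : Var) (v : ℕ) : (s.set x v).coins = s.coins := rfl

@[simp] theorem put_var (a : Arr) (i v : ℕ) : (s.put a i v).var = s.var := rfl

@[simp] theorem put_coins (a : Arr) (i v : ℕ) : (s.put a i v).coins = s.coins := rfl

@[simp] theorem put_arr (a a' : Arr) (i i' v : ℕ) :
    (s.put a i v).arr a' i' = if a' = a ∧ i' = i then v else s.arr a' i' := by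
  simp [put, arr, Function.update_apply, Arr.addr_inj]

theorem put_cell (a : Arr) (i v c : ℕ) :
    (s.put a i v).cell c = if c = 8 * i + a.idx then v else s.cell c := by
  simp [put, Function.update_apply]

@[simp] theorem setCoins_var (l : List Bool) : (s.setCoins l).var = s.var := rfl

@[simp] theorem setCoins_cell (l : List Bool) : (s.setCoins l).cell = s.cell := rfl

@[simp] theorem setCoins_arr (l : List Bool) : (s.setCoins l).arr = s.arr := rfl

@[simp] theorem setCoins_coins (l : List Bool) : (s.setCoins l).coins = l := rfl

/-- All variables and memory cells hold numbers of at most `w` bits. -/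
def Bdd (w : ℕ) (s : Store) : Prop := (∀ x, s.var x < 2 ^ w) ∧ ∀ c, s.cell c < 2 ^ w

variable {s}

theorem Bdd.set {w v : ℕ} (h : s.Bdd w) (x : Var) (hv : v < 2 ^ w) : (s.set x v).Bdd w := by
  refine ⟨fun y => ?_, h.2⟩
  rw [set_var]
  split
  exacts [hv, h.1 y]

theorem Bdd.put {w v : ℕ} (h : s.Bdd w) (a : Arr) (i : ℕ) (hv : v < 2 ^ w) :
    (s.put a i v).Bdd w := by
  refine ⟨h.1, fun c => ?_⟩
  rw [put_cell]
  split
  exacts [hv, h.2 c]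

end Store

/-- The results of additions and multiplications need to be bounded; the other operations do not
enlarge numbers. -/
def RAMOp.Fits (w : ℕ) : RAMOp → ℕ → ℕ → Prop
  | add, x, y => x + y < 2 ^ w
  | mul, x, y => x * y < 2 ^ w
  | _, _, _ => True

theorem RAMOp.Fits.eval_lt {w x y : ℕ} {o : RAMOp} (h : o.Fits w x y) (hx : x < 2 ^ w) :
    o.eval x y < 2 ^ w := by
  cases o
  · exact h
  · exact (Nat.sub_le _ _).trans_lt hx
  · exact h
  · exact (Nat.div_le_self _ _).trans_lt hx
  · exact (Nat.mod_le _ _).trans_lt hx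

/-- Expressions: numerals, variables, memory cells, array entries and arithmetic. -/
inductive Expr
  | lit (c : ℕ)
  | var (x : Var)
  | cell (e : Expr)
  | get (a : Arr) (e : Expr)
  | bin (o : RAMOp) (e f : Expr)

namespace Expr

instance : Add Expr := ⟨.bin .add⟩
instance : Sub Expr := ⟨.bin .sub⟩
instance : Mul Expr := ⟨.bin .mul⟩
instance : Div Expr := ⟨.bin .div⟩
instance : Mod Expr := ⟨.bin .mod⟩

/-- The value of an expression. -/
def eval (s : Store) : Expr → ℕ
  | lit c => c
  | var x => s.var x
  | cell e => s.cell (e.eval s)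
  | get a e => s.arr a (e.eval s)
  | bin o e f => o.eval (e.eval s) (f.eval s)

/-- All numbers in the evaluation of an expression have at most `w` bits. -/
def Safe (w : ℕ) (s : Store) : Expr → Prop
  | lit c => c < 2 ^ w
  | var _ => True
  | cell e => e.Safe w s
  | get _ e => e.Safe w s ∧ 8 * e.eval s + 8 < 2 ^ w
  | bin o e f => e.Safe w s ∧ f.Safe w s ∧ o.Fits w (e.eval s) (f.eval s)

/-- The number of machine steps for an expression. -/
def cost : Expr → ℕ
  | lit _ => 1
  | var _ => 2
  | cell e => e.cost + 1
  | get _ e => e.cost + 5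
  | bin _ e f => e.cost + f.cost + 1

variable (s : Store) (w : ℕ) (e f : Expr) (a : Arr) (x : Var) (c : ℕ)

@[simp] theorem eval_lit : (lit c).eval s = c := rfl
@[simp] theorem eval_var : (var x).eval s = s.var x := rfl
@[simp] theorem eval_cell : (cell e).eval s = s.cell (e.eval s) := rfl
@[simp] theorem eval_get : (get a e).eval s = s.arr a (e.eval s) := rfl
@[simp] theorem eval_add : (e + f).eval s = e.eval s + f.eval s := rfl
@[simp] theorem eval_sub : (e - f).eval s = e.eval s - f.eval s := rfl
@[simp] theorem eval_mul : (e * f).eval s = e.eval s * f.eval s := rfl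
@[simp] theorem eval_div : (e / f).eval s = e.eval s / f.eval s := rfl
@[simp] theorem eval_mod : (e % f).eval s = e.eval s % f.eval s := rfl

@[simp] theorem safe_lit : (lit c).Safe w s ↔ c < 2 ^ w := Iff.rfl
@[simp] theorem safe_var : (var x).Safe w s ↔ True := Iff.rfl
@[simp] theorem safe_cell : (cell e).Safe w s ↔ e.Safe w s := Iff.rfl
@[simp] theorem safe_get : (get a e).Safe w s ↔ e.Safe w s ∧ 8 * e.eval s + 8 < 2 ^ w := Iff.rfl
@[simp] theorem safe_add :
    (e + f).Safe w s ↔ e.Safe w s ∧ f.Safe w s ∧ e.eval s + f.eval s < 2 ^ w := Iff.rfl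
@[simp] theorem safe_mul :
    (e * f).Safe w s ↔ e.Safe w s ∧ f.Safe w s ∧ e.eval s * f.eval s < 2 ^ w := Iff.rfl
@[simp] theorem safe_sub : (e - f).Safe w s ↔ e.Safe w s ∧ f.Safe w s :=
  ⟨fun h => ⟨h.1, h.2.1⟩, fun h => ⟨h.1, h.2, trivial⟩⟩
@[simp] theorem safe_div : (e / f).Safe w s ↔ e.Safe w s ∧ f.Safe w s :=
  ⟨fun h => ⟨h.1, h.2.1⟩, fun h => ⟨h.1, h.2, trivial⟩⟩
@[simp] theorem safe_mod : (e % f).Safe w s ↔ e.Safe w s ∧ f.Safe w s :=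
  ⟨fun h => ⟨h.1, h.2.1⟩, fun h => ⟨h.1, h.2, trivial⟩⟩

@[simp] theorem cost_lit : (lit c).cost = 1 := rfl
@[simp] theorem cost_var : (var x).cost = 2 := rfl
@[simp] theorem cost_cell : (cell e).cost = e.cost + 1 := rfl
@[simp] theorem cost_get : (get a e).cost = e.cost + 5 := rfl
@[simp] theorem cost_add : (e + f).cost = e.cost + f.cost + 1 := rfl
@[simp] theorem cost_sub : (e - f).cost = e.cost + f.cost + 1 := rfl
@[simp] theorem cost_mul : (e * f).cost = e.cost + f.cost + 1 := rfl
@[simp] theorem cost_div : (e / f).cost = e.cost + f.cost + 1 := rfl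
@[simp] theorem cost_mod : (e % f).cost = e.cost + f.cost + 1 := rfl

/-- Machine code that computes an expression into register `2 * d + 1`, changing only odd
registers from `2 * d + 1` on. -/
def compile : Expr → ℕ → RAMProg
  | lit c, d => .const (2 * d + 1) c
  | var x, d => .seq (.const (2 * d + 1) 0) (.op .add (2 * d + 1) (2 * x.idx) (2 * d + 1))
  | cell e, d => .seq (e.compile d) (.load (2 * d + 1) (2 * d + 1))
  | get a e, d => .seq (e.compile d) (.seq (.const (2 * (d + 1) + 1) 8)
      (.seq (.op .mul (2 * d + 1) (2 * (d + 1) + 1) (2 * d + 1))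
        (.seq (.const (2 * (d + 1) + 1) a.idx)
          (.seq (.op .add (2 * d + 1) (2 * d + 1) (2 * (d + 1) + 1))
            (.load (2 * d + 1) (2 * d + 1))))))
  | bin o e f, d => .seq (e.compile d) (.seq (f.compile (d + 1))
      (.op o (2 * d + 1) (2 * d + 1) (2 * (d + 1) + 1)))

end Expr

/-! ### Simulation of expressions by machine code -/

/-- A machine state represents a program state. -/
structure Represents (σ : RAMState) (s : Store) : Prop where
  var : ∀ x : Var, σ.reg (2 * x.idx) = s.var x
  mem : σ.mem = s.cell
  coins : σ.coins = s.coins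

namespace RAMExec

variable {p q : RAMProg} {s s' s'' : RAMState}

theorem const_le {w : ℕ} (s : RAMState) (x c : ℕ) (hc : c < 2 ^ w) :
    ∃ τ ≤ (w + 1) ^ 2, RAMExec (.const x c) s (s.setReg x c) τ :=
  ⟨_, by have := Nat.size_le.2 hc; nlinarith, .const s x c⟩

theorem op_le {w : ℕ} (s : RAMState) (o : RAMOp) (x y z : ℕ) (hy : s.reg y < 2 ^ w)
    (hz : s.reg z < 2 ^ w) :
    ∃ τ ≤ (w + 1) ^ 2,
      RAMExec (.op o x y z) s (s.setReg x (o.eval (s.reg y) (s.reg z))) τ :=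
  ⟨_, by
    have h1 := Nat.size_le.2 hy
    have h2 := Nat.size_le.2 hz
    rw [sq]
    gcongr, .op s o x y z⟩

theorem load_le {w : ℕ} (s : RAMState) (x y : ℕ) (hy : s.reg y < 2 ^ w)
    (hz : s.mem (s.reg y) < 2 ^ w) :
    ∃ τ ≤ (w + 1) ^ 2, RAMExec (.load x y) s (s.setReg x (s.mem (s.reg y))) τ :=
  ⟨_, by
    have h1 := Nat.size_le.2 hy
    have h2 := Nat.size_le.2 hz
    nlinarith, .load s x y⟩

theorem store_le {w : ℕ} (s : RAMState) (x y : ℕ) (hx : s.reg x < 2 ^ w)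
    (hy : s.reg y < 2 ^ w) :
    ∃ τ ≤ (w + 1) ^ 2, RAMExec (.store x y) s (s.setMem (s.reg x) (s.reg y)) τ :=
  ⟨_, by
    have h1 := Nat.size_le.2 hx
    have h2 := Nat.size_le.2 hy
    nlinarith, .store s x y⟩

/-- Runs of programs are deterministic. -/
theorem unique {p : RAMProg} {s s₁ s₂ : RAMState} {t₁ t₂ : ℕ} (h₁ : RAMExec p s s₁ t₁)
    (h₂ : RAMExec p s s₂ t₂) : s₁ = s₂ := by
  induction h₁ generalizing s₂ t₂ with
  | const | op | load | store => cases h₂; rfl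
  | flip s x b bs h =>
    cases h₂ with
    | flip _ _ b' bs' h' =>
      rw [h] at h'
      cases h'
      rfl
  | seq hp hq ihp ihq =>
    cases h₂ with
    | seq hp' hq' =>
      cases ihp hp'
      exact ihq hq'
  | ite_true hx hp ih =>
    cases h₂ with
    | ite_true _ hp' => exact ih hp'
    | ite_false hx' _ => exact absurd hx' hx
  | ite_false hx hp ih =>
    cases h₂ with
    | ite_true hx' _ => exact absurd hx hx'
    | ite_false _ hp' => exact ih hp'
  | loop_true hx hp hw ihp ihw =>
    cases h₂ with
    | loop_true _ hp' hw' =>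
      cases ihp hp'
      exact ihw hw'
    | loop_false hx' => exact absurd hx' hx
  | loop_false hx =>
    cases h₂ with
    | loop_true hx' _ _ => exact absurd hx hx'
    | loop_false _ => rfl

end RAMExec

/-- `RunsTo w c p σ σ'`: the machine code `p` leads from `σ` to `σ'` in time `c * (w + 1) ^ 2`. -/
def RunsTo (w c : ℕ) (p : RAMProg) (σ σ' : RAMState) : Prop :=
  ∃ τ ≤ c * (w + 1) ^ 2, RAMExec p σ σ' τ

namespace RunsTo

variable {w c c' : ℕ} {p q : RAMProg} {σ σ' σ'' : RAMState}

theorem seq (h : RunsTo w c p σ σ') (h' : RunsTo w c' q σ' σ'') :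
    RunsTo w (c + c') (.seq p q) σ σ'' := by
  obtain ⟨τ, hτ, h⟩ := h
  obtain ⟨τ', hτ', h'⟩ := h'
  exact ⟨τ + τ', by rw [add_mul]; gcongr, .seq h h'⟩

theorem const (σ : RAMState) (x c : ℕ) (hc : c < 2 ^ w) :
    RunsTo w 1 (.const x c) σ (σ.setReg x c) := by
  simpa [RunsTo] using RAMExec.const_le σ x c hc

theorem op (σ : RAMState) (o : RAMOp) (x y z : ℕ) (hy : σ.reg y < 2 ^ w)
    (hz : σ.reg z < 2 ^ w) :
    RunsTo w 1 (.op o x y z) σ (σ.setReg x (o.eval (σ.reg y) (σ.reg z))) := by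
  simpa [RunsTo] using RAMExec.op_le σ o x y z hy hz

theorem load (σ : RAMState) (x y : ℕ) (hy : σ.reg y < 2 ^ w) (hz : σ.mem (σ.reg y) < 2 ^ w) :
    RunsTo w 1 (.load x y) σ (σ.setReg x (σ.mem (σ.reg y))) := by
  simpa [RunsTo] using RAMExec.load_le σ x y hy hz

theorem store (σ : RAMState) (x y : ℕ) (hy : σ.reg x < 2 ^ w) (hz : σ.reg y < 2 ^ w) :
    RunsTo w 1 (.store x y) σ (σ.setMem (σ.reg x) (σ.reg y)) := by
  simpa [RunsTo] using RAMExec.store_le σ x y hy hz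

end RunsTo

@[simp] theorem RAMState.setReg_reg (σ : RAMState) (x v y : ℕ) :
    (σ.setReg x v).reg y = if y = x then v else σ.reg y := by
  simp [setReg, Function.update_apply]

@[simp] theorem RAMState.setReg_mem (σ : RAMState) (x v : ℕ) : (σ.setReg x v).mem = σ.mem := rfl

@[simp] theorem RAMState.setReg_coins (σ : RAMState) (x v : ℕ) :
    (σ.setReg x v).coins = σ.coins := rfl

theorem Expr.eval_lt {w : ℕ} {s : Store} (hs : s.Bdd w) {e : Expr} (h : e.Safe w s) :
    e.eval s < 2 ^ w := by
  induction e with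
  | lit c => exact h
  | var x => exact hs.1 x
  | cell e => exact hs.2 _
  | get a e => exact hs.2 _
  | bin o e f ihe ihf => exact h.2.2.eval_lt (ihe h.1)

/-- Even registers hold the variables and odd registers form an evaluation stack whose level is `d`.
The second operand of an operation is evaluated one level higher, so the first one survives in its
register. -/
theorem Expr.runsTo_compile {w : ℕ} {s : Store} (hs : s.Bdd w) (e : Expr) (h : e.Safe w s)
    (d : ℕ) (σ : RAMState) (hσ : Represents σ s) :
    ∃ σ', RunsTo w e.cost (e.compile d) σ σ' ∧ Represents σ' s ∧
      σ'.reg (2 * d + 1) = e.eval s ∧ ∀ i < d, σ'.reg (2 * i + 1) = σ.reg (2 * i + 1) := by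
  induction e generalizing d σ with
  | lit c =>
    refine ⟨_, .const σ _ c h, ⟨fun x => ?_, hσ.mem, hσ.coins⟩, by simp, fun i hi => ?_⟩
    · rw [RAMState.setReg_reg, if_neg (by omega), hσ.var]
    · rw [RAMState.setReg_reg, if_neg (by omega)]
  -- There is no instruction that copies a register; copying is addition of zero.
  | var x =>
    have hz : (0 : ℕ) < 2 ^ w := by positivity
    refine ⟨_, (RunsTo.const σ _ 0 hz).seq (.op _ .add _ _ _ ?_ ?_),
      ⟨fun x => ?_, hσ.mem, hσ.coins⟩, ?_, fun i hi => ?_⟩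
    · rw [RAMState.setReg_reg, if_neg (by omega), hσ.var]
      exact hs.1 x
    · simp
    · rw [RAMState.setReg_reg, if_neg (by omega), RAMState.setReg_reg, if_neg (by omega), hσ.var]
    · simp only [RAMState.setReg_reg, if_true, RAMOp.eval, eval]
      rw [if_neg (by omega), hσ.var, add_zero]
    · rw [RAMState.setReg_reg, if_neg (by omega), RAMState.setReg_reg, if_neg (by omega)]
  | cell e ih =>
    obtain ⟨σ₁, h1, h2, h3, h4⟩ := ih h d σ hσ
    refine ⟨_, h1.seq (.load σ₁ _ _ ?_ ?_), ⟨fun x => ?_, h2.mem, h2.coins⟩, ?_, fun i hi => ?_⟩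
    · rw [h3]
      exact eval_lt hs h
    · rw [h2.mem]
      exact hs.2 _
    · rw [RAMState.setReg_reg, if_neg (by omega), h2.var]
    · simp [h3, h2.mem]
    · rw [RAMState.setReg_reg, if_neg (by omega), h4 i hi]
  | get a e ih =>
    obtain ⟨σ₁, h1, h2, h3, h4⟩ := ih h.1 d σ hσ
    have h5 : 8 * e.eval s + 8 < 2 ^ w := h.2
    have ha := a.idx_lt
    refine ⟨_, h1.seq ((RunsTo.const σ₁ _ 8 (by omega)).seq ((RunsTo.op _ .mul _ _ _ ?_ ?_).seq
      ((RunsTo.const _ _ a.idx (by omega)).seq ((RunsTo.op _ .add _ _ _ ?_ ?_).seq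
      (RunsTo.load _ _ _ ?_ ?_))))), ⟨fun x => ?_, h2.mem, h2.coins⟩, ?_, fun i hi => ?_⟩
    · simp; omega
    · simp [h3]; omega
    · simp [h3, RAMOp.eval]; omega
    · simp; omega
    · simp [h3, RAMOp.eval]; omega
    · simp only [RAMState.setReg_mem, h2.mem]
      exact hs.2 _
    · have e1 : ¬ (2 * x.idx = 2 * d + 1) := by omega
      have e2 : ¬ (2 * x.idx = 2 * (d + 1) + 1) := by omega
      simp only [RAMState.setReg_reg, if_neg e1, if_neg e2, h2.var]
    · simp [h3, h2.mem, RAMOp.eval, eval, Store.arr]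
    · have e1 : ¬ (2 * i + 1 = 2 * d + 1) := by omega
      have e2 : ¬ (2 * i + 1 = 2 * (d + 1) + 1) := by omega
      simp only [RAMState.setReg_reg, if_neg e1, if_neg e2, h4 i hi]
  | bin o e f ihe ihf =>
    obtain ⟨σ₁, h1, h2, h3, h4⟩ := ihe h.1 d σ hσ
    obtain ⟨σ₂, g1, g2, g3, g4⟩ := ihf h.2.1 (d + 1) σ₁ h2
    have h5 := g4 d (by omega)
    refine ⟨σ₂.setReg (2 * d + 1) (o.eval (e.eval s) (f.eval s)), ?_,
      ⟨fun x => ?_, g2.mem, g2.coins⟩, ?_, fun i hi => ?_⟩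
    · have := h1.seq (g1.seq (.op σ₂ o (2 * d + 1) (2 * d + 1) (2 * (d + 1) + 1) ?_ ?_))
      · rw [h5, h3, g3, ← add_assoc] at this
        exact this
      · rw [h5, h3]
        exact eval_lt hs h.1
      · rw [g3]
        exact eval_lt hs h.2.1
    · rw [RAMState.setReg_reg, if_neg (by omega), g2.var]
    · simp [eval]
    · rw [RAMState.setReg_reg, if_neg (by omega), g4 i (by omega), h4 i hi]

/-! ### Commands and their program logic -/

/-- Commands: assignments, coin tosses, sequencing and loops whose number of rounds is computed in
advance; the loop variable runs downwards to zero. -/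
inductive Cmd
  | set (x : Var) (e : Expr)
  | put (a : Arr) (e f : Expr)
  | flip (x : Var)
  | seq (p q : Cmd)
  | loop (x : Var) (e : Expr) (p : Cmd)

namespace Cmd

/-- Machine code for a command; odd registers below `2 * d` are not changed. -/
def compile : Cmd → ℕ → RAMProg
  | set x e, d => .seq (e.compile d) (.seq (.const (2 * (d + 1) + 1) 0)
      (.op .add (2 * x.idx) (2 * d + 1) (2 * (d + 1) + 1)))
  | put a e f, d => .seq (e.compile d) (.seq (.const (2 * (d + 1) + 1) 8)
      (.seq (.op .mul (2 * d + 1) (2 * (d + 1) + 1) (2 * d + 1))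
        (.seq (.const (2 * (d + 1) + 1) a.idx)
          (.seq (.op .add (2 * d + 1) (2 * d + 1) (2 * (d + 1) + 1))
            (.seq (f.compile (d + 1)) (.store (2 * d + 1) (2 * (d + 1) + 1)))))))
  | flip x, _ => .flip (2 * x.idx)
  | seq p q, d => .seq (p.compile d) (q.compile d)
  | loop x e p, d => .seq (e.compile d) (.loop (2 * d + 1)
      (.seq (.const (2 * (d + 1) + 1) 1) (.seq (.op .sub (2 * d + 1) (2 * d + 1) (2 * (d + 1) + 1))
        (.seq (.const (2 * (d + 1) + 1) 0) (.seq (.op .add (2 * x.idx) (2 * d + 1) (2 * (d + 1) + 1))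
          (p.compile (d + 1)))))))

/-- An upper bound for the number of machine steps, if every loop with loop variable `x` has at
most `β x` rounds. -/
def cost (β : Var → ℕ) : Cmd → ℕ
  | set _ e => e.cost + 2
  | put _ e f => e.cost + f.cost + 5
  | flip _ => 1
  | seq p q => p.cost β + q.cost β
  | loop x e p => e.cost + 1 + β x * (p.cost β + 5)

end Cmd

/-- The command `p` leads from `s` to some state with property `Q`, all numbers having at most `w`
bits and every loop with loop variable `x` having at most `β x` rounds. -/
def Runs (w : ℕ) (β : Var → ℕ) (p : Cmd) (s : Store) (Q : Store → Prop) : Prop :=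
  s.Bdd w → ∀ d σ, Represents σ s → ∃ σ' s', RunsTo w (p.cost β) (p.compile d) σ σ' ∧
    Represents σ' s' ∧ s'.Bdd w ∧ (∀ i < d, σ'.reg (2 * i + 1) = σ.reg (2 * i + 1)) ∧ Q s'

namespace Runs

variable {w : ℕ} {β : Var → ℕ} {p q : Cmd} {s : Store} {Q Q' : Store → Prop}

theorem mono (h : Runs w β p s Q') (hQ : ∀ s', Q' s' → Q s') : Runs w β p s Q := by
  intro hs d σ hσ
  obtain ⟨σ', s', h1, h2, h3, h4, h5⟩ := h hs d σ hσ
  exact ⟨σ', s', h1, h2, h3, h4, hQ _ h5⟩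

theorem seq (h : Runs w β p s Q') (hq : ∀ s', Q' s' → Runs w β q s' Q) :
    Runs w β (.seq p q) s Q := by
  intro hs d σ hσ
  obtain ⟨σ', s', h1, h2, h3, h4, h5⟩ := h hs d σ hσ
  obtain ⟨σ'', s'', g1, g2, g3, g4, g5⟩ := hq s' h5 h3 d σ' h2
  exact ⟨σ'', s'', h1.seq g1, g2, g3, fun i hi => (g4 i hi).trans (h4 i hi), g5⟩

theorem set {x : Var} {e : Expr} (he : e.Safe w s) (hQ : Q (s.set x (e.eval s))) :
    Runs w β (.set x e) s Q := by
  intro hs d σ hσ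
  obtain ⟨σ₁, h1, h2, h3, h4⟩ := e.runsTo_compile hs he d σ hσ
  have h5 := Expr.eval_lt hs he
  have hz : (0 : ℕ) < 2 ^ w := by positivity
  have h6 := RunsTo.op (w := w) (σ₁.setReg (2 * (d + 1) + 1) 0) .add (2 * x.idx) (2 * d + 1)
    (2 * (d + 1) + 1) (by simpa [h3]) (by simp)
  refine ⟨(σ₁.setReg (2 * (d + 1) + 1) 0).setReg (2 * x.idx) (e.eval s), s.set x (e.eval s), ?_,
    ⟨fun y => ?_, h2.mem, h2.coins⟩, hs.set x h5, fun i hi => ?_, hQ⟩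
  · have h7 : RunsTo w 1 _ σ₁ _ := RunsTo.const σ₁ (2 * (d + 1) + 1) 0 hz
    rw [RAMState.setReg_reg, if_neg (by omega), h3, RAMState.setReg_reg, if_pos rfl] at h6
    exact h1.seq (h7.seq h6)
  · rw [RAMState.setReg_reg, RAMState.setReg_reg, if_neg (by omega : ¬ 2 * y.idx = 2 * (d + 1) + 1),
      Store.set_var, h2.var]
    simp [Var.idx_injective.eq_iff]
  · rw [RAMState.setReg_reg, RAMState.setReg_reg, if_neg (by omega), if_neg (by omega), h4 i hi]

theorem put {a : Arr} {e f : Expr} (he : e.Safe w s) (hf : f.Safe w s)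
    (ha : 8 * e.eval s + 8 < 2 ^ w) (hQ : Q (s.put a (e.eval s) (f.eval s))) :
    Runs w β (.put a e f) s Q := by
  intro hs d σ hσ
  obtain ⟨σ₁, h1, h2, h3, h4⟩ := e.runsTo_compile hs he d σ hσ
  have hlt := a.idx_lt
  have g1 : RunsTo w 1 _ σ₁ _ := RunsTo.const σ₁ (2 * (d + 1) + 1) 8 (by omega)
  have g2 := RunsTo.op (w := w) (σ₁.setReg (2 * (d + 1) + 1) 8) .mul (2 * d + 1) (2 * (d + 1) + 1)
    (2 * d + 1) (by simp; omega) (by simp [h3]; omega)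
  set σ₂ := (σ₁.setReg (2 * (d + 1) + 1) 8).setReg (2 * d + 1) _ with hσ₂
  have g3 : RunsTo w 1 _ σ₂ _ := RunsTo.const σ₂ (2 * (d + 1) + 1) a.idx (by omega)
  have g4 := RunsTo.op (w := w) (σ₂.setReg (2 * (d + 1) + 1) a.idx) .add (2 * d + 1) (2 * d + 1)
    (2 * (d + 1) + 1) (by simp [hσ₂, h3, RAMOp.eval]; omega) (by simp; omega)
  set σ₃ := (σ₂.setReg (2 * (d + 1) + 1) a.idx).setReg (2 * d + 1) _ with hσ₃
  have hr : σ₃.reg (2 * d + 1) = 8 * e.eval s + a.idx := by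
    simp [hσ₃, hσ₂, RAMOp.eval, h3]
  have hrep : Represents σ₃ s := by
    refine ⟨fun y => ?_, h2.mem, h2.coins⟩
    have e1 : ¬ (2 * y.idx = 2 * d + 1) := by omega
    have e2 : ¬ (2 * y.idx = 2 * (d + 1) + 1) := by omega
    simp only [hσ₃, hσ₂, RAMState.setReg_reg, if_neg e1, if_neg e2, h2.var]
  obtain ⟨σ₄, k1, k2, k3, k4⟩ := f.runsTo_compile hs hf (d + 1) σ₃ hrep
  have hr' := k4 d (by omega)
  have k5 := RunsTo.store (w := w) σ₄ (2 * d + 1) (2 * (d + 1) + 1) (by rw [hr', hr]; omega)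
    (by rw [k3]; exact Expr.eval_lt hs hf)
  refine ⟨σ₄.setMem (8 * e.eval s + a.idx) (f.eval s), s.put a (e.eval s) (f.eval s), ?_, ?_,
    hs.put a (e.eval s) (Expr.eval_lt hs hf), fun i hi => ?_, hQ⟩
  · rw [hr', hr, k3] at k5
    have := h1.seq (g1.seq (g2.seq (g3.seq (g4.seq (k1.seq k5)))))
    convert this using 1
    · simp only [Cmd.cost]
      ring
    · rfl
  · exact ⟨k2.var, by simp [RAMState.setMem, Store.put, k2.mem], k2.coins⟩
  · have e1 : ¬ (2 * i + 1 = 2 * d + 1) := by omega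
    have e2 : ¬ (2 * i + 1 = 2 * (d + 1) + 1) := by omega
    change σ₄.reg _ = _
    rw [k4 i (by omega)]
    simp only [hσ₃, hσ₂, RAMState.setReg_reg, if_neg e1, if_neg e2, h4 i hi]

theorem flip {x : Var} {b : Bool} {l : List Bool} (hl : s.coins = b :: l) (hw : 1 ≤ w)
    (hQ : Q ((s.set x b.toNat).setCoins l)) : Runs w β (.flip x) s Q := by
  intro hs d σ hσ
  have hb : b.toNat < 2 ^ w := by
    have : 2 ^ 1 ≤ 2 ^ w := Nat.pow_le_pow_right (by norm_num) hw
    have := b.toNat_le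
    omega
  refine ⟨_, (s.set x b.toNat).setCoins l, ⟨1, ?_, .flip σ (2 * x.idx) b l (hσ.coins.trans hl)⟩,
    ?_, hs.set x hb,
    fun i hi => ?_, hQ⟩
  · simp only [Cmd.cost]
    nlinarith
  · refine ⟨fun y => ?_, hσ.mem, rfl⟩
    simp [hσ.var, Var.idx_injective.eq_iff]
  · rw [RAMState.setReg_reg, if_neg (by omega)]

/-- The counter lives in the odd register of level `d`, which the body, compiled at level `d + 1`,
preserves; the variable `x` is only a copy of it. The counter is decremented before the body runs,
so the invariant is indexed by the number of remaining rounds, and the round that has to establish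
`Inv i` sees the value `i` in `x`. -/
theorem loop {x : Var} {e : Expr} {n : ℕ} (Inv : ℕ → Store → Prop) (he : e.Safe w s)
    (hn : e.eval s = n) (hβ : n ≤ β x) (h0 : Inv n s)
    (step : ∀ i < n, ∀ s, Inv (i + 1) s → Runs w β p (s.set x i) (Inv i))
    (hQ : ∀ s, Inv 0 s → Q s) : Runs w β (.loop x e p) s Q := by
  intro hs d σ hσ
  obtain ⟨σ₁, h1, h2, h3, h4⟩ := e.runsTo_compile hs he d σ hσ
  have hnw : n < 2 ^ w := hn ▸ Expr.eval_lt hs he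
  rw [hn] at h3
  suffices H : ∀ m ≤ n, ∀ σ s, s.Bdd w → Represents σ s → σ.reg (2 * d + 1) = m → Inv m s →
      ∃ σ' s', RunsTo w (1 + m * (p.cost β + 5)) (.loop (2 * d + 1)
        (.seq (.const (2 * (d + 1) + 1) 1)
        (.seq (.op .sub (2 * d + 1) (2 * d + 1) (2 * (d + 1) + 1))
        (.seq (.const (2 * (d + 1) + 1) 0) (.seq (.op .add (2 * x.idx) (2 * d + 1) (2 * (d + 1) + 1))
          (p.compile (d + 1))))))) σ σ' ∧ Represents σ' s' ∧ s'.Bdd w ∧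
        (∀ i < d, σ'.reg (2 * i + 1) = σ.reg (2 * i + 1)) ∧ Inv 0 s' by
    obtain ⟨σ', s', g1, g2, g3, g4, g5⟩ := H n le_rfl σ₁ s hs h2 h3 h0
    refine ⟨σ', s', ?_, g2, g3, fun i hi => (g4 i hi).trans (h4 i hi), hQ _ g5⟩
    obtain ⟨τ, hτ, h⟩ := h1.seq g1
    refine ⟨τ, hτ.trans ?_, h⟩
    rw [← add_assoc]
    simp only [Cmd.cost]
    gcongr
  intro m
  induction m with
  | zero =>
    intro _ σ s hs hσ hr hI
    exact ⟨σ, s, ⟨_, by rw [hr, Nat.size_zero]; nlinarith [Nat.zero_le w], .loop_false hr⟩, hσ, hs, fun _ _ => rfl, hI⟩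
  | succ m ih =>
    intro hm σ s hs hσ hr hI
    have hz : (0 : ℕ) < 2 ^ w := by positivity
    have hmw : m < 2 ^ w := by omega
    have hw1 : 1 < 2 ^ w := by omega
    have f1 : RunsTo w 1 _ σ _ := RunsTo.const σ (2 * (d + 1) + 1) 1 (by omega)
    have f2 := RunsTo.op (w := w) (σ.setReg (2 * (d + 1) + 1) 1) .sub (2 * d + 1) (2 * d + 1)
      (2 * (d + 1) + 1) (by simp [hr]; omega) (by simpa using hw1)
    set σ₂ := (σ.setReg (2 * (d + 1) + 1) 1).setReg (2 * d + 1) _ with hσ₂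
    have hr2 : σ₂.reg (2 * d + 1) = m := by simp [hσ₂, RAMOp.eval, hr]
    have f3 : RunsTo w 1 _ σ₂ _ := RunsTo.const σ₂ (2 * (d + 1) + 1) 0 hz
    have f4 := RunsTo.op (w := w) (σ₂.setReg (2 * (d + 1) + 1) 0) .add (2 * x.idx) (2 * d + 1)
      (2 * (d + 1) + 1) (by simpa [hr2]) (by simp)
    set σ₃ := (σ₂.setReg (2 * (d + 1) + 1) 0).setReg (2 * x.idx) _ with hσ₃
    have hr3 : ∀ i < d, σ₃.reg (2 * i + 1) = σ.reg (2 * i + 1) := by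
      intro i hi
      have e1 : ¬ (2 * i + 1 = 2 * d + 1) := by omega
      have e2 : ¬ (2 * i + 1 = 2 * (d + 1) + 1) := by omega
      have e3 : ¬ (2 * i + 1 = 2 * x.idx) := by omega
      simp only [hσ₃, hσ₂, RAMState.setReg_reg, if_neg e1, if_neg e2, if_neg e3]
    have hr3' : σ₃.reg (2 * d + 1) = m := by
      have e3 : ¬ (2 * d + 1 = 2 * x.idx) := by omega
      have e2 : ¬ (2 * d + 1 = 2 * (d + 1) + 1) := by omega
      simp only [hσ₃, RAMState.setReg_reg, if_neg e3, if_neg e2, hr2]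
    have hrep : Represents σ₃ (s.set x m) := by
      refine ⟨fun y => ?_, hσ.mem, hσ.coins⟩
      have e1 : ¬ (2 * y.idx = 2 * d + 1) := by omega
      have e2 : ¬ (2 * y.idx = 2 * (d + 1) + 1) := by omega
      have e3 : ¬ (2 * d + 1 = 2 * (d + 1) + 1) := by omega
      rw [hσ₃, RAMState.setReg_reg, Store.set_var]
      simp only [RAMOp.eval, RAMState.setReg_reg, if_neg e3, if_true, hr2, add_zero, if_neg e2,
        Var.idx_injective.eq_iff, mul_eq_mul_left_iff, OfNat.ofNat_ne_zero, or_false]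
      split
      · rfl
      · simp only [hσ₂, RAMState.setReg_reg, if_neg e1, if_neg e2, hσ.var]
    obtain ⟨σ₄, s₄, g1, g2, g3, g4, g5⟩ := step m hm s hI (hs.set x hmw) (d + 1) σ₃ hrep
    obtain ⟨σ₅, s₅, k1, k2, k3, k4, k5⟩ := ih (by omega) σ₄ s₄ g3 g2
      ((g4 d (by omega)).trans hr3') g5
    refine ⟨σ₅, s₅, ?_, k2, k3, fun i hi => ?_, k5⟩
    · obtain ⟨τ, hτ, h⟩ := f1.seq (f2.seq (f3.seq (f4.seq g1)))
      obtain ⟨τ', hτ', h'⟩ := k1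
      refine ⟨_, ?_, .loop_true (by omega) h h'⟩
      have : (σ.reg (2 * d + 1)).size ≤ w := Nat.size_le.2 (by omega)
      have : 1 + w ≤ (w + 1) ^ 2 := by nlinarith
      -- The `5` per round: one step for the test of the counter, two for its decrement and two for
      -- the copy into `x`.
      have e : (1 + (m + 1) * (p.cost β + 5)) * (w + 1) ^ 2 = (w + 1) ^ 2 +
        (1 + (1 + (1 + (1 + p.cost β)))) * (w + 1) ^ 2 +
        (1 + m * (p.cost β + 5)) * (w + 1) ^ 2 := by ring
      omega
    · rw [k4 i hi, g4 i (by omega), hr3 i hi]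

end Runs

/-! ### The algorithm -/

/-- Data on which the algorithm is based: `N` subsets of `[3 * K]` of size `K`, given by the
functions that list their elements, and a rank decomposition modulo `p` of length `R` of the tensor
of those triples of these subsets that cover `[3 * K]`; there are at least `G` such triples. -/
structure Gadget where
  (K N R G p : ℕ)
  pos : ℕ → ℕ → ℕ
  coef : ℕ → ℕ → ℕ → ℕ
  prime : p.Prime
  K_pos : 1 ≤ K
  N_pos : 1 ≤ N
  G_pos : 1 ≤ G
  N_le_R : N ≤ R
  pos_lt : ∀ a i, pos a i < 3 * K
  pos_injOn : ∀ a, Set.InjOn (pos a) (Finset.range K)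
  image_injOn : Set.InjOn (fun a => (Finset.range K).image (pos a)) (Finset.range N)
  coef_lt : ∀ f l a, coef f l a < p
  rank : ∀ a < N, ∀ b < N, ∀ c < N,
    ∑ l ∈ Finset.range R, (coef 0 l a : ZMod p) * coef 1 l b * coef 2 l c =
      if (Finset.range K).image (pos a) ∪ (Finset.range K).image (pos b) ∪
        (Finset.range K).image (pos c) = Finset.range (3 * K) then 1 else 0
  G_le_card : G ≤ ((Finset.range N ×ˢ Finset.range N ×ˢ Finset.range N).filter fun t =>
    (Finset.range K).image (pos t.1) ∪ (Finset.range K).image (pos t.2.1) ∪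
      (Finset.range K).image (pos t.2.2) = Finset.range (3 * K)).card
  G_le : G ≤ N * 4 ^ K

/-- The permutation of `{0, …, i - 1}` with number `u` in the factorial number system. -/
def shuffle : ℕ → ℕ → Equiv.Perm ℕ
  | 0, _ => 1
  | i + 1, u => Equiv.swap i (u % (i + 1)) * shuffle i (u / (i + 1))

/-- The number with the given binary digits, the most significant digit first. -/
def ofBits : List Bool → ℕ
  | [] => 0
  | b :: l => b.toNat * 2 ^ l.length + ofBits l

/-- The `i`-th digit from the right. -/
def weight (l : List Bool) (i : ℕ) : ℕ := (l.getD (l.length - 1 - i) false).toNat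

namespace Gadget

variable (g : Gadget)

/-- The bit mask of the image under `σ` of the `a`-th subset of block `j`. -/
def blockVal (σ : Equiv.Perm ℕ) (j a : ℕ) : ℕ :=
  ∑ t ∈ Finset.range g.K, 2 ^ σ (3 * g.K * j + g.pos a t)

/-- The bit mask of the image under `σ` of the set that is given by the digits of `i` to base `N`,
one subset for each of `m` blocks. -/
def maskOf (σ : Equiv.Perm ℕ) (m i : ℕ) : ℕ :=
  ∑ t ∈ Finset.range m, g.blockVal σ (m - 1 - t) (i / g.N ^ t % g.N)

/-- One round of Yates' algorithm: the last coordinate is transformed and moved to the front. -/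
def yatesStep (f P : ℕ) (v : ℕ → ZMod g.p) (i : ℕ) : ZMod g.p :=
  ∑ a ∈ Finset.range g.N, (g.coef f (i / P) a : ZMod g.p) * v (i % P * g.N + a)

/-- The first rounds of Yates' algorithm. -/
def yatesIter (f m : ℕ) (v : ℕ → ZMod g.p) : ℕ → ℕ → ZMod g.p
  | 0 => v
  | k + 1 => g.yatesStep f (g.R ^ k * g.N ^ (m - 1 - k)) (yatesIter f m v k)

/-- The start vector: coin tosses on the sets of a family. -/
def startVec (m u : ℕ) (D : ℕ → ℕ) (l : List Bool) (i : ℕ) : ℕ :=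
  weight l i * D (g.maskOf (shuffle (3 * g.K * m) u) m i)

/-- The result of a trial. -/
def trialVal (m u : ℕ) (D : ℕ → ℕ → ℕ) (l : ℕ → List Bool) : ZMod g.p :=
  ∑ i ∈ Finset.range (g.R ^ m), ∏ f ∈ Finset.range 3,
    g.yatesIter f m (fun j => (g.startVec m u (D f) (l f) j : ZMod g.p)) m i

section Program

open Expr (var lit get cell)

/-- Draws a random number of `points ^ 2` bits. -/
def drawSeed : Cmd :=
  .seq (.set .seed (lit 0)) <| .loop .loopBit (var .points * var .points) <|
    .seq (.flip .coin) <| .set .seed (lit 2 * var .seed + var .coin)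

/-- Initializes the permutation. -/
def initPerm : Cmd :=
  .seq (.set .powF (var .powX)) <| .loop .loopPos (var .points) <|
    .seq (.set .powF (var .powF / lit 2)) <| .put .perm (var .loopPos) (var .powF)

/-- Permutes the array `perm`. -/
def permute : Cmd :=
  .loop .loopPos (var .points) <|
    .seq (.set .digit (var .seed % (var .loopPos + lit 1))) <|
    .seq (.set .seed (var .seed / (var .loopPos + lit 1))) <|
    .seq (.set .tmp (get .perm (var .loopPos))) <|
    .seq (.put .perm (var .loopPos) (get .perm (var .digit))) <|
    .put .perm (var .digit) (var .tmp)

/-- Computes the bit masks of the subsets of the blocks. -/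
def blockMasks : Cmd :=
  .loop .loopBlock (var .blocks) <| .loop .loopGood (lit g.N) <|
    .seq (.set .acc (lit 0)) <|
    .seq (.loop .loopElt (lit g.K) <| .set .acc (var .acc + get .perm (lit (3 * g.K) *
      var .loopBlock + get .pos (var .loopGood * lit g.K + var .loopElt)))) <|
    .put .blockMask (var .loopBlock * lit g.N + var .loopGood) (var .acc)

/-- Computes the bit mask with number `loopIdx`. -/
def computeMask : Cmd :=
  .seq (.set .rest (var .loopIdx)) <| .seq (.set .mask (lit 0)) <|
    .loop .loopBlock (var .blocks) <|
    .seq (.set .mask (var .mask +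
      get .blockMask (var .loopBlock * lit g.N + var .rest % lit g.N))) <|
    .set .rest (var .rest / lit g.N)

/-- Fills in the start vector of family `fam`. -/
def fill : Cmd :=
  .loop .loopIdx (var .numIdx) <| .seq g.computeMask <| .seq (.flip .coin) <|
    .put .vec (var .loopIdx)
      (var .coin * get .table (var .inputLen + lit 3 * var .mask + var .fam))

/-- One round of Yates' algorithm. -/
def yatesRound : Cmd :=
  .seq (.set .quo (var .len / lit g.N)) <|
  .seq (.loop .loopOut (lit g.R * var .quo) <| .seq (.set .acc (lit 0)) <|
    .seq (.loop .loopGood (lit g.N) <| .set .acc ((var .acc +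
      get .coef ((var .fam * lit g.R + var .loopOut / var .quo) * lit g.N + var .loopGood) *
      get .vec (var .loopOut % var .quo * lit g.N + var .loopGood)) % lit g.p)) <|
    .put .vecNew (var .loopOut) (var .acc)) <|
  .seq (.loop .loopOut (lit g.R * var .quo) <|
    .put .vec (var .loopOut) (get .vecNew (var .loopOut))) <|
  .set .len (lit g.R * var .quo)

/-- Yates' algorithm. -/
def yates : Cmd :=
  .seq (.set .len (var .numIdx)) <| .loop .loopBlock (var .blocks) g.yatesRound

/-- Multiplies the products by the transformed vector. -/
def accumulate : Cmd :=
  .loop .loopOut (var .numRank) <| .put .prod (var .loopOut)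
    (get .prod (var .loopOut) * get .vec (var .loopOut) % lit g.p)

/-- A trial. -/
def trial : Cmd :=
  .seq drawSeed <| .seq initPerm <| .seq permute <| .seq g.blockMasks <|
  .seq (.loop .loopOut (var .numRank) (.put .prod (var .loopOut) (lit 1))) <|
  .seq (.loop .fam (lit 3) <| .seq g.fill <| .seq g.yates g.accumulate) <|
  .seq (.set .acc (lit 0)) <|
  .seq (.loop .loopOut (var .numRank) <|
    .set .acc ((var .acc + get .prod (var .loopOut)) % lit g.p)) <|
  .set .res (var .res + var .acc)

/-- Writes a table into an array. -/
def writeTable (a : Arr) (t : ℕ → ℕ) : ℕ → Cmd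
  | 0 => .set .tmp (lit 0)
  | i + 1 => .seq (writeTable a t i) (.put a (lit i) (lit (t i)))

/-- Computes a power of `b`. -/
def power (x : Var) (b : ℕ) (e : Expr) : Cmd :=
  .seq (.set x (lit 1)) <| .loop .loopPow e <| .set x (var x * lit b)

/-- Computes the parameters of the instance. -/
def params : Cmd :=
  .seq (.set .dim (cell (lit 0))) <|
  .seq (.set .blocks ((var .dim + lit (g.K - 1)) / lit g.K)) <|
  .seq (.set .points (lit (3 * g.K) * var .blocks)) <|
  .seq (.set .inputLen (lit 4 + cell (lit 1) + cell (lit 2) + cell (lit 3))) <|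
  .seq (power .numIdx g.N (var .blocks)) <|
  .seq (power .numRank g.R (var .blocks)) <|
  .seq (power .countPow g.G (var .blocks)) <|
  .seq (power .total (27 ^ g.K) (var .blocks)) <|
  .seq (power .powX 2 (var .points)) <|
  .seq (power .powE 2 (lit g.K * var .blocks - var .dim)) <|
  .set .trials (lit 32 * (var .total / var .countPow + lit 1))

/-- Reads the families. -/
def readInput : Cmd :=
  .seq (.set .off (var .inputLen)) <| .seq (.set .powF (var .powX)) <|
  .loop .fam (lit 3) <| .seq (.set .powF (var .powF / var .powE)) <|
    .seq (.set .size (cell (var .fam + lit 1))) <|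
    .seq (.set .off (var .off - var .size)) <|
    .loop .loopInput (var .size) <| .put .table (var .inputLen +
      lit 3 * (cell (var .off + var .loopInput) + (var .powE - lit 1) * var .powF) + var .fam)
      (lit 1)

/-- The table of the elements of the subsets. -/
def posTable (i : ℕ) : ℕ := g.pos (i / g.K) (i % g.K)

/-- The table of the coefficients of the rank decomposition. -/
def coefTable (i : ℕ) : ℕ := g.coef (i / g.N / g.R) (i / g.N % g.R) (i % g.N)

/-- The whole algorithm. -/
def algorithm : Cmd :=
  .seq g.params <| .seq readInput <|
  .seq (writeTable .pos g.posTable (g.N * g.K)) <|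
  .seq (writeTable .coef g.coefTable (3 * g.R * g.N)) <|
  .loop .loopTrial (var .trials) g.trial

end Program

end Gadget

/-! ### Correctness of the parts of a trial -/

/-- The states agree outside the variables in `V` and the arrays in `A`. -/
def Frame (V : List Var) (A : List Arr) (s s' : Store) : Prop :=
  (∀ v, v ∉ V → s'.var v = s.var v) ∧ ∀ a, a ∉ A → s'.arr a = s.arr a

namespace Frame

variable {V V' : List Var} {A A' : List Arr} {s s' s'' : Store}

theorem refl : Frame V A s s := ⟨fun _ _ => rfl, fun _ _ => rfl⟩

theorem trans (h : Frame V A s s') (h' : Frame V A s' s'') : Frame V A s s'' :=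
  ⟨fun v hv => (h'.1 v hv).trans (h.1 v hv), fun a ha => (h'.2 a ha).trans (h.2 a ha)⟩

theorem mono (h : Frame V' A' s s') (hV : V' ⊆ V) (hA : A' ⊆ A) : Frame V A s s' :=
  ⟨fun v hv => h.1 v fun h => hv (hV h), fun a ha => h.2 a fun h => ha (hA h)⟩

theorem set (h : Frame V A s s') {v : Var} {e : ℕ} (hv : v ∈ V) : Frame V A s (s'.set v e) :=
  ⟨fun y hy => by
    rw [Store.set_var, if_neg (by rintro rfl; exact hy hv), h.1 y hy], h.2⟩

theorem put (h : Frame V A s s') {a : Arr} {i e : ℕ} (ha : a ∈ A) : Frame V A s (s'.put a i e) :=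
  ⟨h.1, fun a' ha' => by
    ext i'
    rw [Store.put_arr, if_neg (by rintro ⟨rfl, _⟩; exact ha' ha), h.2 a' ha']⟩

theorem setCoins (h : Frame V A s s') {l : List Bool} : Frame V A s (s'.setCoins l) := h

end Frame

namespace Gadget

variable (g : Gadget)

/-- The numbers that occur in a trial have at most `w` bits, and the loop bounds are large
enough. -/
structure Fits (m L M w : ℕ) (β : Var → ℕ) : Prop where
  seed : 3 * g.K * m * (3 * g.K * m) ≤ w
  table : 8 * (L + 3 * (m * g.K * 2 ^ (3 * g.K * m)) + 3) + 8 < 2 ^ w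
  points : 8 * (3 * g.K * m) + 8 < 2 ^ w
  blockMask : 8 * (m * g.N) + 8 < 2 ^ w
  block : g.K * 2 ^ (3 * g.K * m) < 2 ^ w
  vec : 8 * g.R ^ m + 8 < 2 ^ w
  coef : 8 * (3 * g.R * g.N) + 8 < 2 ^ w
  pos : 8 * (g.N * g.K) + 8 < 2 ^ w
  mod : g.p + g.p * g.p < 2 ^ w
  res : M * g.p < 2 ^ w
  elt : 3 * g.K < 2 ^ w
  loopBit : 3 * g.K * m * (3 * g.K * m) ≤ β .loopBit
  loopPos : 3 * g.K * m ≤ β .loopPos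
  loopBlock : m ≤ β .loopBlock
  loopGood : g.N ≤ β .loopGood
  loopElt : g.K ≤ β .loopElt
  loopIdx : g.N ^ m ≤ β .loopIdx
  loopOut : g.R ^ m ≤ β .loopOut
  fam : 3 ≤ β .fam

variable {g} {m L M w : ℕ} {β : Var → ℕ}

theorem Fits.lt (hg : g.Fits m L M w β) : 31 < 2 ^ w := by
  have := hg.table
  omega

theorem Fits.one_le (hg : g.Fits m L M w β) : 1 ≤ w := by
  have := hg.lt
  by_contra h
  have : w = 0 := by omega
  simp [this] at *

theorem runs_drawSeed (hg : g.Fits m L M w β) {s : Store} {l l' : List Bool}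
    (hl : l.length = 3 * g.K * m * (3 * g.K * m)) (hc : s.coins = l ++ l')
    (hx : s.var .points = 3 * g.K * m) :
    Runs w β drawSeed s fun s' => Frame [.seed, .loopBit, .coin] [] s s' ∧ s'.coins = l' ∧
      s'.var .seed = ofBits l := by
  have hw := hg.lt
  have hw1 := hg.one_le
  have hw2 : 2 ^ l.length ≤ 2 ^ w := Nat.pow_le_pow_right (by norm_num) (hl ▸ hg.seed)
  refine Runs.seq (Q' := fun s' => s' = s.set .seed 0) (.set (by simp) rfl) ?_
  rintro _ rfl
  -- The first toss is the most significant digit. The part read so far, shifted by the number of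
  -- outstanding tosses, plus the value of these tosses is constant.
  refine Runs.loop (n := l.length)
    (fun i s' => Frame [.seed, .loopBit, .coin] [] s s' ∧ ∃ l₁, l₁.length = i ∧
      s'.coins = l₁ ++ l' ∧ s'.var .seed * 2 ^ i + ofBits l₁ = ofBits l ∧
      s'.var .seed < 2 ^ (l.length - i)) ?_ ?_ (hl ▸ hg.loopBit) ?_ ?_ ?_
  · simp [hx, ← hl]
    exact lt_of_lt_of_le Nat.lt_two_pow_self hw2
  · simp [hx, hl]
  · exact ⟨Frame.refl.set (by decide), l, rfl, hc, by simp, by simp⟩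
  · rintro i hi s' ⟨hF, l₁, h1, h2, h3, h4⟩
    obtain ⟨b, l₂, rfl⟩ := List.exists_cons_of_length_eq_add_one h1
    have hb := b.toNat_le
    have h5 : 2 ^ (l.length - i) = 2 * 2 ^ (l.length - (i + 1)) := by
      rw [← pow_succ']
      congr 1
      omega
    have h6 : 2 ^ (l.length - i) ≤ 2 ^ l.length := Nat.pow_le_pow_right (by norm_num) (by omega)
    simp only [List.length_cons, Nat.add_right_cancel_iff] at h1
    refine Runs.seq (.flip (l := l₂ ++ l') (Q := fun s'' => s'' =
      (((s'.set .loopBit i).set .coin b.toNat).setCoins (l₂ ++ l'))) h2 hw1 rfl) ?_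
    rintro _ rfl
    refine .set (by simp; omega) ⟨?_, l₂, h1, rfl, ?_, ?_⟩
    · exact (((hF.set (by decide)).set (by decide)).setCoins).set (by decide)
    · rw [← h3]
      simp [ofBits, h1]
      ring
    · simp
      omega
  · rintro s' ⟨hF, l₁, h1, h2, h3, h4⟩
    obtain rfl := List.eq_nil_of_length_eq_zero h1
    exact ⟨hF, h2, by simpa [ofBits] using h3⟩

/-- The entries are powers of two rather than exponents. The bit mask of a permuted set is then a
plain sum of entries, without any exponentiation. -/
theorem runs_initPerm (hg : g.Fits m L M w β) {s : Store}
    (hx : s.var .points = 3 * g.K * m) (hp : s.var .powX = 2 ^ (3 * g.K * m)) :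
    Runs w β initPerm s fun s' => Frame [.powF, .loopPos] [.perm] s s' ∧ s'.coins = s.coins ∧
      ∀ i < 3 * g.K * m, s'.arr .perm i = 2 ^ i := by
  have hw := hg.points
  have hw' := hg.lt
  refine Runs.seq (Q' := fun s' => s' = s.set .powF (2 ^ (3 * g.K * m))) (.set (by simp)
    (by simp [hp])) ?_
  rintro _ rfl
  refine Runs.loop (n := 3 * g.K * m)
    (fun i s' => Frame [.powF, .loopPos] [.perm] s s' ∧ s'.coins = s.coins ∧
      s'.var .powF = 2 ^ i ∧ ∀ j < 3 * g.K * m, i ≤ j → s'.arr .perm j = 2 ^ j) ?_ ?_ hg.loopPos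
      ?_ ?_ ?_
  · simp
  · simp [hx]
  · exact ⟨Frame.refl.set (by decide), rfl, by simp, fun j h1 h2 => by omega⟩
  · rintro i hi s' ⟨hF, h1, h2, h3⟩
    refine Runs.seq (Q' := fun s'' => s'' = (s'.set .loopPos i).set .powF (2 ^ i)) (.set
      (by simp; omega) (by simp [h2, pow_succ])) ?_
    rintro _ rfl
    refine .put (by simp) (by simp) (by simp; omega) ⟨?_, h1, by simp, fun j hj hij => ?_⟩
    · exact ((hF.set (by decide)).set (by decide)).put (by decide)
    · simp only [Store.put_arr, Expr.eval_var, Store.set_var, Store.set_arr, if_true, true_and]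
      by_cases h : j = i
      · simp [h]
      · simp [h, h3 j hj (by omega)]
  · rintro s' ⟨hF, h1, h2, h3⟩
    exact ⟨hF, h1, fun i hi => h3 i hi (Nat.zero_le _)⟩

end Gadget

theorem mul_add_inj_of_lt {N j j' a a' : ℕ} (ha : a < N) (ha' : a' < N)
    (h : j * N + a = j' * N + a') : j = j' ∧ a = a' := by
  have hN : 0 < N := by omega
  have h1 := congrArg (· / N) h
  simp only [mul_comm _ N, Nat.mul_add_div hN, Nat.div_eq_of_lt ha, Nat.div_eq_of_lt ha',
    add_zero] at h1
  subst h1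
  exact ⟨rfl, by omega⟩

theorem mul_add_lt_mul {N m j a : ℕ} (hj : j < m) (ha : a < N) : j * N + a < m * N := by
  calc j * N + a < (j + 1) * N := by rw [add_mul]; omega
    _ ≤ m * N := Nat.mul_le_mul_right _ hj

theorem shuffle_apply_of_le {i : ℕ} (u : ℕ) {j : ℕ} (hj : i ≤ j) : shuffle i u j = j := by
  induction i generalizing u with
  | zero => rfl
  | succ i ih =>
    have : u % (i + 1) < i + 1 := Nat.mod_lt _ (by omega)
    rw [shuffle, Equiv.Perm.mul_apply, ih _ (by omega),
      Equiv.swap_apply_of_ne_of_ne (by omega) (by omega)]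

theorem shuffle_lt {i : ℕ} (u : ℕ) {j : ℕ} (hj : j < i) : shuffle i u j < i := by
  by_contra h
  have := shuffle_apply_of_le u (not_lt.1 h)
  have := (shuffle i u).injective this
  omega

namespace Gadget

variable {g : Gadget} {m L M w : ℕ} {β : Var → ℕ}

/-- Exchanging two entries multiplies the stored permutation `ρ` on the right by a transposition.
This peels off the outermost factor of `shuffle (i + 1)`, so `ρ` times the shuffle still encoded in
the seed is invariant. -/
theorem runs_permute (hg : g.Fits m L M w β) {s : Store} {x u : ℕ} (hxm : x = 3 * g.K * m)
    (hx : s.var .points = x) (hu : s.var .seed = u)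
    (hp : ∀ i < x, s.arr .perm i = 2 ^ i) :
    Runs w β permute s fun s' => Frame [.seed, .loopPos, .digit, .tmp] [.perm] s s' ∧
      s'.coins = s.coins ∧ ∀ i < x, s'.arr .perm i = 2 ^ shuffle x u i := by
  have hw := hg.points
  have hw' := hg.lt
  have hw1 := hg.one_le
  rw [← hxm] at hw
  refine Runs.loop (n := x)
    (fun i s' => Frame [.seed, .loopPos, .digit, .tmp] [.perm] s s' ∧ s'.coins = s.coins ∧
      ∃ ρ : Equiv.Perm ℕ, ρ * shuffle i (s'.var .seed) = shuffle x u ∧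
        ∀ j < x, s'.arr .perm j = 2 ^ ρ j) ?_ ?_ (hxm ▸ hg.loopPos) ?_ ?_ ?_
  · simp
  · simp [hx]
  · exact ⟨Frame.refl, rfl, 1, by simp [hu], by simpa using hp⟩
  · rintro i hi s' ⟨hF, h1, ρ, h2, h3⟩
    set v := s'.var .seed with hv
    have hd : v % (i + 1) < i + 1 := Nat.mod_lt _ (by omega)
    refine Runs.seq (Q' := fun s'' => s'' = (s'.set .loopPos i).set .digit (v % (i + 1)))
      (.set (by simp; omega) (by simp [hv])) ?_
    rintro _ rfl
    refine Runs.seq (Q' := fun s'' => s'' = ((s'.set .loopPos i).set .digit (v % (i + 1))).set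
      .seed (v / (i + 1))) (.set (by simp; omega) (by simp [hv])) ?_
    rintro _ rfl
    refine Runs.seq (Q' := fun s'' => s'' = (((s'.set .loopPos i).set .digit (v % (i + 1))).set
      .seed (v / (i + 1))).set .tmp (2 ^ ρ i)) (.set (by simp; omega) (by simp [h3 i hi])) ?_
    rintro _ rfl
    refine Runs.seq (Q' := fun s'' => s'' = ((((s'.set .loopPos i).set .digit (v % (i + 1))).set
      .seed (v / (i + 1))).set .tmp (2 ^ ρ i)).put .perm i (2 ^ ρ (v % (i + 1))))
      (.put (by simp) (by simp; omega) (by simp; omega)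
        (by simp [h3 (v % (i + 1)) (by omega)])) ?_
    rintro _ rfl
    refine .put (by simp) (by simp) (by simp; omega) ⟨?_, h1, ρ * Equiv.swap i (v % (i + 1)), ?_,
      fun j hj => ?_⟩
    · exact (((((hF.set (by decide)).set (by decide)).set (by decide)).set (by decide)).put
        (by decide)).put (by decide)
    · rw [← h2, shuffle]
      simp [mul_assoc]
    · simp only [Store.put_arr, Expr.eval_var, Store.set_var, Store.set_arr, Store.put_var,
        true_and, Equiv.Perm.mul_apply, if_true, reduceCtorEq, if_false]
      by_cases h : j = v % (i + 1)
      · rw [if_pos h, h, Equiv.swap_apply_right]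
      · rw [if_neg h]
        by_cases h' : j = i
        · rw [if_pos h', h', Equiv.swap_apply_left]
        · rw [if_neg h', Equiv.swap_apply_of_ne_of_ne h' h, h3 j hj]
  · rintro s' ⟨hF, h1, ρ, h2, h3⟩
    refine ⟨hF, h1, ?_⟩
    rw [← h2]
    simpa [shuffle] using h3

theorem blockVal_le {σ : Equiv.Perm ℕ} (hσ : ∀ i < 3 * g.K * m, σ i < 3 * g.K * m) {j : ℕ}
    (hj : j < m) (a : ℕ) : g.blockVal σ j a ≤ g.K * 2 ^ (3 * g.K * m) := by
  refine (Finset.sum_le_card_nsmul _ _ (2 ^ (3 * g.K * m)) fun t _ => ?_).trans (by simp)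
  refine Nat.pow_le_pow_right (by norm_num) (hσ _ ?_).le
  have := mul_add_lt_mul hj (g.pos_lt a t)
  linarith [mul_comm j (3 * g.K), mul_comm m (3 * g.K)]

theorem runs_blockMasks (hg : g.Fits m L M w β) {s : Store} {σ : Equiv.Perm ℕ}
    (hσ : ∀ i < 3 * g.K * m, σ i < 3 * g.K * m) (hm : s.var .blocks = m)
    (hp : ∀ i < 3 * g.K * m, s.arr .perm i = 2 ^ σ i)
    (hpos : ∀ a < g.N, ∀ i < g.K, s.arr .pos (a * g.K + i) = g.pos a i) :
    Runs w β g.blockMasks s fun s' =>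
      Frame [.loopBlock, .loopGood, .loopElt, .acc] [.blockMask] s s' ∧ s'.coins = s.coins ∧
      ∀ j < m, ∀ a < g.N, s'.arr .blockMask (j * g.N + a) = g.blockVal σ j a := by
  have hw' := hg.lt
  have w1 := hg.points
  have w2 := hg.blockMask
  have w3 := hg.block
  have w4 := hg.pos
  have w5 := hg.elt
  have w6 := hg.coef
  have hK := g.K_pos
  have hN := g.N_pos
  have hR := g.N_le_R
  have hNw : g.N < 2 ^ w := by nlinarith
  refine Runs.loop (n := m) (fun k s' =>
      Frame [.loopBlock, .loopGood, .loopElt, .acc] [.blockMask] s s' ∧ s'.coins = s.coins ∧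
      ∀ j < m, k ≤ j → ∀ a < g.N, s'.arr .blockMask (j * g.N + a) = g.blockVal σ j a)
    (by simp) (by simp [hm]) hg.loopBlock ⟨Frame.refl, rfl, by omega⟩ ?_
    fun s' h => ⟨h.1, h.2.1, fun j hj => h.2.2 j hj (Nat.zero_le _)⟩
  rintro k hk s₁ ⟨hF, h1, h2⟩
  refine Runs.loop (n := g.N) (fun b s' =>
      Frame [.loopBlock, .loopGood, .loopElt, .acc] [.blockMask] s s' ∧ s'.coins = s.coins ∧
      s'.var .loopBlock = k ∧
      (∀ j < m, k + 1 ≤ j → ∀ a < g.N, s'.arr .blockMask (j * g.N + a) = g.blockVal σ j a) ∧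
      ∀ a < g.N, b ≤ a → s'.arr .blockMask (k * g.N + a) = g.blockVal σ k a)
    (by simpa) (by simp) hg.loopGood
    ⟨hF.set (by decide), h1, by simp, by simpa using h2, by omega⟩ ?_ ?_
  · rintro b hb s₂ ⟨hF₂, h1, h2, h3, h4⟩
    refine Runs.seq (Q' := fun s'' => s'' = (s₂.set .loopGood b).set .acc 0) (.set (by simp) rfl) ?_
    rintro _ rfl
    refine Runs.seq (Q' := fun s' =>
      Frame [.loopElt, .acc] [] ((s₂.set .loopGood b).set .acc 0) s' ∧ s'.coins = s₂.coins ∧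
        s'.var .acc = g.blockVal σ k b) ?_ ?_
    · refine Runs.loop (n := g.K) (fun i s' =>
          Frame [.loopElt, .acc] [] ((s₂.set .loopGood b).set .acc 0) s' ∧ s'.coins = s₂.coins ∧
          s'.var .acc = ∑ t ∈ Finset.Ico i g.K, 2 ^ σ (3 * g.K * k + g.pos b t))
        (by simp; omega) (by simp) hg.loopElt ⟨Frame.refl, rfl, by simp⟩ ?_ ?_
      · rintro i hi s₃ ⟨hF₃, f1, f2⟩
        have e1 : s₃.var .loopBlock = k := by rw [hF₃.1 _ (by decide)]; simpa using h2
        have e2 : s₃.var .loopGood = b := by rw [hF₃.1 _ (by decide)]; simp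
        have e3 : s₃.arr .pos (b * g.K + i) = g.pos b i := by
          rw [hF₃.2 _ (by decide), Store.set_arr, Store.set_arr, hF₂.2 _ (by decide),
            hpos b hb i hi]
        have hq := g.pos_lt b i
        have e4 : 3 * g.K * k + g.pos b i < 3 * g.K * m := by
          have := mul_add_lt_mul hk hq
          linarith [mul_comm k (3 * g.K), mul_comm m (3 * g.K)]
        have e5 : s₃.arr .perm (3 * g.K * k + g.pos b i) = 2 ^ σ (3 * g.K * k + g.pos b i) := by
          rw [hF₃.2 _ (by decide), Store.set_arr, Store.set_arr, hF₂.2 _ (by decide), hp _ e4]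
        have e6 : b * g.K + i < g.N * g.K := mul_add_lt_mul hb hi
        have e7 : ∑ t ∈ Finset.Ico i g.K, 2 ^ σ (3 * g.K * k + g.pos b t) ≤
            g.blockVal σ k b := by
          rw [blockVal, Finset.range_eq_Ico]
          exact Finset.sum_le_sum_of_subset (Finset.Ico_subset_Ico_left (Nat.zero_le _))
        have e8 := blockVal_le hσ hk b
        rw [Finset.sum_eq_sum_Ico_succ_bot hi, ← f2] at e7
        refine .set ?_ ⟨(hF₃.set (by decide)).set (by decide), f1, ?_⟩
        · simp [e1, e2, e3, e5]
          have : b * g.K ≤ b * g.K + i := by omega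
          have : 3 * g.K * k ≤ 3 * g.K * k + g.pos b i := by omega
          omega
        · simp [e1, e2, e3, e5, f2, Finset.sum_eq_sum_Ico_succ_bot hi]
          ring
      · rintro s' ⟨f1, f2, f3⟩
        exact ⟨f1, f2, by rw [f3, blockVal, Finset.range_eq_Ico]⟩
    · rintro s' ⟨f1, f2, f3⟩
      have e1 : s'.var .loopBlock = k := by rw [f1.1 _ (by decide)]; simpa using h2
      have e2 : s'.var .loopGood = b := by rw [f1.1 _ (by decide)]; simp
      have e6 : k * g.N + b < m * g.N := mul_add_lt_mul hk hb
      have e7 : k * g.N ≤ k * g.N + b := by omega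
      have hF' : Frame [.loopBlock, .loopGood, .loopElt, .acc] [.blockMask] s s' :=
        ((hF₂.set (by decide)).set (by decide)).trans (f1.mono (by decide) (by decide))
      refine .put (by simp [e1, e2]; omega) (by simp) (by simp [e1, e2]; omega)
        ⟨hF'.put (by decide), f2.trans h1, e1, fun j hj hkj a ha => ?_, fun a ha hba => ?_⟩
      · simp only [Store.put_arr, Expr.eval_add, Expr.eval_mul, Expr.eval_var, Expr.eval_lit, e1,
          e2, true_and]
        rw [if_neg, f1.2 _ (by decide), ← h3 j hj hkj a ha]
        · rfl
        · intro h
          have := mul_add_inj_of_lt ha hb h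
          omega
      · simp only [Store.put_arr, Expr.eval_add, Expr.eval_mul, Expr.eval_var, Expr.eval_lit, e1,
          e2, true_and, Nat.add_left_cancel_iff]
        split_ifs with h
        · rw [f3, h]
        · rw [f1.2 _ (by decide), ← h4 a ha (by omega)]
          rfl
  · rintro s' ⟨hF', f1, f2, f3, f4⟩
    refine ⟨hF', f1, fun j hj hkj a ha => ?_⟩
    rcases hkj.eq_or_lt with rfl | h
    · exact f4 a ha (Nat.zero_le _)
    · exact f3 j hj h a ha

theorem maskOf_le {σ : Equiv.Perm ℕ} (hσ : ∀ i < 3 * g.K * m, σ i < 3 * g.K * m) {k : ℕ}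
    (hk : k ≤ m) (i : ℕ) :
    ∑ t ∈ Finset.range k, g.blockVal σ (m - 1 - t) (i / g.N ^ t % g.N) ≤
      m * g.K * 2 ^ (3 * g.K * m) := by
  refine (Finset.sum_le_card_nsmul _ _ (g.K * 2 ^ (3 * g.K * m)) fun t ht => ?_).trans ?_
  · have := Finset.mem_range.1 ht
    exact blockVal_le hσ (by omega) _
  · simp only [Finset.card_range, smul_eq_mul, mul_assoc]
    gcongr

/-- Digits are split off from the low end while the block counter runs downwards; so digit `t`
belongs to block `m - 1 - t`. -/
theorem runs_computeMask (hg : g.Fits m L M w β) {s : Store} {σ : Equiv.Perm ℕ} {i : ℕ}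
    (hσ : ∀ i < 3 * g.K * m, σ i < 3 * g.K * m) (hm : s.var .blocks = m)
    (hi : s.var .loopIdx = i)
    (hb : ∀ j < m, ∀ a < g.N, s.arr .blockMask (j * g.N + a) = g.blockVal σ j a) :
    Runs w β g.computeMask s fun s' => Frame [.rest, .mask, .loopBlock] [] s s' ∧
      s'.coins = s.coins ∧ s'.var .mask = g.maskOf σ m i := by
  have hw' := hg.lt
  have w2 := hg.blockMask
  have w3 := hg.table
  have hN := g.N_pos
  have hNw : g.N < 2 ^ w := by
    have := hg.coef
    have := g.N_le_R
    nlinarith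
  refine Runs.seq (Q' := fun s'' => s'' = s.set .rest i) (.set (by simp) (by simp [hi])) ?_
  rintro _ rfl
  refine Runs.seq (Q' := fun s'' => s'' = (s.set .rest i).set .mask 0) (.set (by simp) rfl) ?_
  rintro _ rfl
  refine Runs.loop (n := m) (fun k s' => Frame [.rest, .mask, .loopBlock] [] s s' ∧
      s'.coins = s.coins ∧ s'.var .rest = i / g.N ^ (m - k) ∧ s'.var .mask =
        ∑ t ∈ Finset.range (m - k), g.blockVal σ (m - 1 - t) (i / g.N ^ t % g.N))
    (by simp) (by simp [hm]) hg.loopBlock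
    ⟨(Frame.refl.set (by decide)).set (by decide), rfl, by simp, by simp⟩ ?_
    fun s' h => ⟨h.1, h.2.1, by simpa [maskOf] using h.2.2.2⟩
  rintro k hk s₁ ⟨hF, h1, h2, h3⟩
  have hmod : s₁.var .rest % g.N < g.N := Nat.mod_lt _ hN
  have e1 : k * g.N + s₁.var .rest % g.N < m * g.N := mul_add_lt_mul hk hmod
  have e0 : k * g.N ≤ k * g.N + s₁.var .rest % g.N := by omega
  have e2 : s₁.arr .blockMask (k * g.N + s₁.var .rest % g.N) =
      g.blockVal σ k (s₁.var .rest % g.N) := by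
    rw [hF.2 _ (by decide), hb k hk _ hmod]
  have e3 : ∑ t ∈ Finset.range (m - k), g.blockVal σ (m - 1 - t) (i / g.N ^ t % g.N) =
      s₁.var .mask + g.blockVal σ k (s₁.var .rest % g.N) := by
    rw [show m - k = m - (k + 1) + 1 by omega, Finset.sum_range_succ, h3, h2,
      show m - 1 - (m - (k + 1)) = k by omega]
  have e4 := maskOf_le (g := g) hσ (Nat.sub_le m k) i
  rw [e3] at e4
  refine Runs.seq (Q' := fun s'' => s'' = (s₁.set .loopBlock k).set .mask
    (s₁.var .mask + g.blockVal σ k (s₁.var .rest % g.N))) (.set ?_ (by simp [e2])) ?_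
  · simp [e2]
    omega
  rintro _ rfl
  refine .set (by simpa) ⟨((hF.set (by decide)).set (by decide)).set (by decide), h1, ?_, ?_⟩
  · simp [h2, Nat.div_div_eq_div_mul, ← pow_succ, show m - k = m - (k + 1) + 1 by omega]
  · simp [e3]

/-- The indices are visited in decreasing order, so the first toss goes to the last index. This is
why `weight` counts positions from the right. -/
theorem runs_fill (hg : g.Fits m L M w β) {s : Store} {σ : Equiv.Perm ℕ} {l l' : List Bool}
    {D : ℕ → ℕ} {f : ℕ} (hf : f < 3) (hD : ∀ y, D y ≤ 1)
    (hσ : ∀ i < 3 * g.K * m, σ i < 3 * g.K * m) (hm : s.var .blocks = m)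
    (hn : s.var .numIdx = g.N ^ m) (hL : s.var .inputLen = L) (hfam : s.var .fam = f)
    (hl : l.length = g.N ^ m) (hc : s.coins = l ++ l')
    (hb : ∀ j < m, ∀ a < g.N, s.arr .blockMask (j * g.N + a) = g.blockVal σ j a)
    (ht : ∀ y, s.arr .table (L + 3 * y + f) = D y) :
    Runs w β g.fill s fun s' =>
      Frame [.loopIdx, .rest, .mask, .loopBlock, .coin] [.vec] s s' ∧ s'.coins = l' ∧
      ∀ i < g.N ^ m, s'.arr .vec i = weight l i * D (g.maskOf σ m i) := by
  have hw' := hg.lt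
  have w3 := hg.table
  have w4 := hg.vec
  have hNR : g.N ^ m ≤ g.R ^ m := Nat.pow_le_pow_left g.N_le_R m
  have hw1 := hg.one_le
  refine Runs.loop (n := g.N ^ m) (fun i s' =>
      Frame [.loopIdx, .rest, .mask, .loopBlock, .coin] [.vec] s s' ∧
      s'.coins = l.drop (g.N ^ m - i) ++ l' ∧
      ∀ j < g.N ^ m, i ≤ j → s'.arr .vec j = weight l j * D (g.maskOf σ m j))
    (by simp) (by simp [hn]) hg.loopIdx ⟨Frame.refl, by simp [hc], by omega⟩ ?_
    fun s' h => ⟨h.1, by simp [h.2.1, hl], fun i hi => h.2.2 i hi (Nat.zero_le _)⟩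
  rintro i hi s₁ ⟨hF, h1, h2⟩
  refine Runs.seq (Q' := fun s' => Frame [.rest, .mask, .loopBlock] [] (s₁.set .loopIdx i) s' ∧
      s'.coins = s₁.coins ∧ s'.var .mask = g.maskOf σ m i)
    (runs_computeMask hg hσ ?_ (by simp) fun j hj a ha => ?_) ?_
  · rw [Store.set_var, if_neg (by decide), hF.1 _ (by decide), hm]
  · rw [Store.set_arr, hF.2 _ (by decide), hb j hj a ha]
  rintro s₂ ⟨hF₂, f1, f2⟩
  have hF' : Frame [.loopIdx, .rest, .mask, .loopBlock, .coin] [.vec] s s₂ :=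
    (hF.set (by decide)).trans (hF₂.mono (by decide) (by decide))
  have e1 : l.drop (g.N ^ m - (i + 1)) =
      l.getD (g.N ^ m - (i + 1)) false :: l.drop (g.N ^ m - i) := by
    have hlt : g.N ^ m - (i + 1) < l.length := by omega
    rw [List.drop_eq_getElem_cons hlt, List.getD_eq_getElem _ _ hlt]
    congr 2
    omega
  have e2 : weight l i = (l.getD (g.N ^ m - (i + 1)) false).toNat := by
    rw [weight, hl, Nat.sub_sub, add_comm 1 i]
  set b := l.getD (g.N ^ m - (i + 1)) false
  refine Runs.seq (Q' := fun s'' => s'' =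
    ((s₂.set .coin b.toNat).setCoins (l.drop (g.N ^ m - i) ++ l')))
    (.flip (by rw [f1, h1, e1]; rfl) hw1 rfl) ?_
  rintro _ rfl
  have e3 : s₂.var .inputLen = L := by rw [hF'.1 _ (by decide), hL]
  have e4 : s₂.var .fam = f := by rw [hF'.1 _ (by decide), hfam]
  have e5 : s₂.var .loopIdx = i := by rw [hF₂.1 _ (by decide)]; simp
  have e6 : s₂.arr .table (L + 3 * g.maskOf σ m i + f) = D (g.maskOf σ m i) := by
    rw [hF'.2 _ (by decide), ht]
  have e7 := maskOf_le (g := g) hσ le_rfl i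
  rw [← maskOf] at e7
  have e8 : b.toNat * D (g.maskOf σ m i) ≤ 1 * 1 := Nat.mul_le_mul b.toNat_le (hD _)
  refine .put (by simp) ?_ (by simp [e5]; omega)
    ⟨((hF'.set (by decide)).setCoins).put (by decide), rfl, fun j hj hij => ?_⟩
  · simp [e3, e4, f2, e6]
    omega
  · simp only [Store.put_arr, Expr.eval_var, true_and, Store.setCoins_var, Store.set_var,
      reduceCtorEq, if_false, e5, Expr.eval_mul, Expr.eval_get, Expr.eval_add, Expr.eval_lit,
      e3, e4, f2, if_true, Store.setCoins_arr, Store.set_arr, e6]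
    split_ifs with h
    · rw [h, e2]
    · rw [hF₂.2 _ (by decide), Store.set_arr, h2 j hj (by omega)]

end Gadget

namespace Gadget

variable {g : Gadget} {m L M w : ℕ} {β : Var → ℕ}

/-- The first `n` entries of an array are numbers less than `p` that represent `v`. -/
def Holds (g : Gadget) (s : Store) (a : Arr) (n : ℕ) (v : ℕ → ZMod g.p) : Prop :=
  ∀ i < n, s.arr a i < g.p ∧ (s.arr a i : ZMod g.p) = v i

/-- Every input entry enters `R` output entries, so the transform cannot be done in place; it goes
to a second array and is copied back. -/
theorem runs_yatesRound (hg : g.Fits m L M w β) {s : Store} {f P : ℕ} (hf : f < 3)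
    {v : ℕ → ZMod g.p} (hlen : s.var .len = P * g.N) (hfam : s.var .fam = f)
    (hPN : P * g.N ≤ g.R ^ m) (hRP : g.R * P ≤ g.R ^ m)
    (hcoef : ∀ f < 3, ∀ l < g.R, ∀ a < g.N,
      s.arr .coef ((f * g.R + l) * g.N + a) = g.coef f l a)
    (hv : g.Holds s .vec (P * g.N) v) :
    Runs w β g.yatesRound s fun s' =>
      Frame [.quo, .loopOut, .acc, .loopGood, .len] [.vec, .vecNew] s s' ∧ s'.coins = s.coins ∧
      s'.var .len = g.R * P ∧ g.Holds s' .vec (g.R * P) (g.yatesStep f P v) := by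
  have hw' := hg.lt
  have hw1 := hg.one_le
  have w1 := hg.vec
  have w2 := hg.coef
  have w3 := hg.mod
  have hN := g.N_pos
  have hR := g.N_le_R
  have hp := g.prime.pos
  have hNw : g.N < 2 ^ w := by nlinarith
  have hRw : g.R < 2 ^ w := by nlinarith
  refine Runs.seq (Q' := fun s' => s' = s.set .quo P) (.set (by simp; omega) ?_) ?_
  · simp [hlen, Nat.mul_div_cancel _ hN]
  rintro _ rfl
  refine Runs.seq (Q' := fun s' =>
      Frame [.quo, .loopOut, .acc, .loopGood, .len] [.vec, .vecNew] s s' ∧ s'.coins = s.coins ∧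
      s'.var .quo = P ∧ g.Holds s' .vecNew (g.R * P) (g.yatesStep f P v)) ?_ ?_
  · refine Runs.loop (n := g.R * P) (fun i s' =>
        Frame [.loopOut, .acc, .loopGood] [.vecNew] (s.set .quo P) s' ∧ s'.coins = s.coins ∧
        ∀ j < g.R * P, i ≤ j → s'.arr .vecNew j < g.p ∧
          (s'.arr .vecNew j : ZMod g.p) = g.yatesStep f P v j)
      (by simp; omega) (by simp) (hRP.trans hg.loopOut) ⟨Frame.refl, rfl, by omega⟩ ?_ ?_
    · rintro i hi s₁ ⟨hF, h1, h2⟩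
      have hP : 0 < P := Nat.pos_of_ne_zero (by rintro rfl; simp at hi)
      refine Runs.seq (Q' := fun s'' => s'' = (s₁.set .loopOut i).set .acc 0) (.set (by simp) rfl) ?_
      rintro _ rfl
      refine Runs.seq (Q' := fun s' => Frame [.acc, .loopGood] [] (s₁.set .loopOut i) s' ∧
          s'.coins = s.coins ∧ s'.var .acc < g.p ∧
          (s'.var .acc : ZMod g.p) = g.yatesStep f P v i) ?_ ?_
      · refine Runs.loop (n := g.N) (fun a s' => Frame [.acc, .loopGood] [] (s₁.set .loopOut i) s' ∧
            s'.coins = s.coins ∧ s'.var .acc < g.p ∧ (s'.var .acc : ZMod g.p) =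
              ∑ b ∈ Finset.Ico a g.N, (g.coef f (i / P) b : ZMod g.p) * v (i % P * g.N + b))
          (by simpa) (by simp) hg.loopGood
          ⟨Frame.refl.set (by decide), h1, by simpa using hp, by simp⟩ ?_ ?_
        · rintro a ha s₂ ⟨hF₂, f1, f2, f3⟩
          have hdiv : i / P < g.R := Nat.div_lt_of_lt_mul (by rwa [mul_comm] at hi)
          have hmod : i % P * g.N + a < P * g.N := mul_add_lt_mul (Nat.mod_lt _ hP) ha
          have e1 : s₂.var .loopOut = i := by rw [hF₂.1 _ (by decide)]; simp
          have e2 : s₂.var .quo = P := by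
            rw [hF₂.1 _ (by decide), Store.set_var, if_neg (by decide), hF.1 _ (by decide)]
            simp
          have e3 : s₂.var .fam = f := by
            rw [hF₂.1 _ (by decide), Store.set_var, if_neg (by decide), hF.1 _ (by decide)]
            simpa using hfam
          have e4 : s₂.arr .coef ((f * g.R + i / P) * g.N + a) = g.coef f (i / P) a := by
            rw [hF₂.2 _ (by decide), Store.set_arr, hF.2 _ (by decide), Store.set_arr,
              hcoef f hf _ hdiv a ha]
          have e5 : s₂.arr .vec (i % P * g.N + a) = s.arr .vec (i % P * g.N + a) := by
            rw [hF₂.2 _ (by decide), Store.set_arr, hF.2 _ (by decide), Store.set_arr]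
          obtain ⟨v1, v2⟩ := hv _ hmod
          have k1 : f * g.R + i / P < 3 * g.R := mul_add_lt_mul hf hdiv
          have k2 : (f * g.R + i / P) * g.N + a < 3 * g.R * g.N := mul_add_lt_mul k1 ha
          have k3 : f * g.R + i / P ≤ (f * g.R + i / P) * g.N := Nat.le_mul_of_pos_right _ hN
          have k5 : 3 * g.R ≤ 3 * g.R * g.N := Nat.le_mul_of_pos_right _ hN
          have k6 : f * g.R ≤ f * g.R + i / P := Nat.le_add_right _ _
          have k7 : i % P * g.N ≤ i % P * g.N + a := Nat.le_add_right _ _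
          have k4 : g.coef f (i / P) a * s.arr .vec (i % P * g.N + a) ≤ g.p * g.p :=
            Nat.mul_le_mul (g.coef_lt _ _ _).le v1.le
          refine .set ?_ ⟨(hF₂.set (by decide)).set (by decide), f1, ?_, ?_⟩
          · simp only [Expr.safe_mod, Expr.safe_add, Expr.safe_var, Expr.safe_mul, Expr.safe_get,
              Expr.safe_lit, Expr.safe_div, Expr.eval_var, Expr.eval_mul, Expr.eval_add,
              Expr.eval_lit, Expr.eval_div, Expr.eval_mod, Expr.eval_get, Store.set_var,
              Store.set_arr, reduceCtorEq, if_false, if_true, e1, e2, e3, e4, e5, true_and, and_true]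
            omega
          · simpa using Nat.mod_lt _ hp
          · simp [e1, e2, e3, e4, e5, f3, v2, Finset.sum_eq_sum_Ico_succ_bot ha]
            ring
        · rintro s' ⟨hF', f1, f2, f3⟩
          exact ⟨hF', f1, f2, by rw [f3, yatesStep, Finset.range_eq_Ico]⟩
      · rintro s' ⟨hF', f1, f2, f3⟩
        have e1 : s'.var .loopOut = i := by rw [hF'.1 _ (by decide)]; simp
        refine .put (by simp) (by simp) (by simp [e1]; omega) ⟨?_, f1, fun j hj hij => ?_⟩
        · exact ((hF.set (by decide)).trans (hF'.mono (by decide) (by decide))).put (by decide)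
        · simp only [Store.put_arr, Expr.eval_var, e1, true_and]
          split_ifs with h
          · rw [h]
            exact ⟨f2, f3⟩
          · rw [hF'.2 _ (by decide)]
            exact h2 j hj (by omega)
    · rintro s' ⟨hF, h1, h2⟩
      refine ⟨(Frame.refl.set (by decide)).trans (hF.mono (by decide) (by decide)), h1, ?_,
        fun j hj => h2 j hj (Nat.zero_le _)⟩
      rw [hF.1 _ (by decide)]
      simp
  rintro s₁ ⟨hF, h1, h2, h3⟩
  refine Runs.seq (Q' := fun s' =>
      Frame [.quo, .loopOut, .acc, .loopGood, .len] [.vec, .vecNew] s s' ∧ s'.coins = s.coins ∧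
      s'.var .quo = P ∧ g.Holds s' .vec (g.R * P) (g.yatesStep f P v)) ?_ ?_
  · refine Runs.loop (n := g.R * P) (fun i s' => Frame [.loopOut] [.vec] s₁ s' ∧
        s'.coins = s.coins ∧ ∀ j < g.R * P, i ≤ j → s'.arr .vec j = s₁.arr .vecNew j)
      (by simp [h2]; omega) (by simp [h2]) (hRP.trans hg.loopOut) ⟨Frame.refl, h1, by omega⟩ ?_ ?_
    · rintro i hi s₂ ⟨hF₂, f1, f2⟩
      refine .put (by simp) (by simp; omega) (by simp; omega)
        ⟨(hF₂.set (by decide)).put (by decide), f1, fun j hj hij => ?_⟩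
      simp only [Store.put_arr, Expr.eval_var, Store.set_var, if_true, true_and, Expr.eval_get,
        Store.set_arr]
      split_ifs with h
      · rw [h, hF₂.2 _ (by decide)]
      · exact f2 j hj (by omega)
    · rintro s' ⟨hF', f1, f2⟩
      refine ⟨hF.trans (hF'.mono (by decide) (by decide)), f1, ?_, fun j hj => ?_⟩
      · rw [hF'.1 _ (by decide), h2]
      · rw [f2 j hj (Nat.zero_le _)]
        exact h3 j hj
  · rintro s₂ ⟨hF₂, f1, f2, f3⟩
    exact .set (by simp [f2]; omega) ⟨hF₂.set (by decide), f1, by simp [f2], f3⟩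

theorem runs_yates (hg : g.Fits m L M w β) {s : Store} {f : ℕ} (hf : f < 3)
    {v : ℕ → ZMod g.p} (hfam : s.var .fam = f) (hm : s.var .blocks = m)
    (hn : s.var .numIdx = g.N ^ m)
    (hcoef : ∀ f < 3, ∀ l < g.R, ∀ a < g.N,
      s.arr .coef ((f * g.R + l) * g.N + a) = g.coef f l a)
    (hv : g.Holds s .vec (g.N ^ m) v) :
    Runs w β g.yates s fun s' =>
      Frame [.quo, .loopOut, .acc, .loopGood, .len, .loopBlock] [.vec, .vecNew] s s' ∧
      s'.coins = s.coins ∧ g.Holds s' .vec (g.R ^ m) (g.yatesIter f m v m) := by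
  refine Runs.seq (Q' := fun s' => s' = s.set .len (g.N ^ m)) (.set (by simp) (by simp [hn])) ?_
  rintro _ rfl
  -- With `k` rounds to go, the `m - k` leading coordinates have been transformed and range over `R`
  -- values, while the `k` trailing ones still range over `N` values.
  refine Runs.loop (n := m) (fun k s' =>
      Frame [.quo, .loopOut, .acc, .loopGood, .len, .loopBlock] [.vec, .vecNew] s s' ∧
      s'.coins = s.coins ∧ s'.var .len = g.R ^ (m - k) * g.N ^ k ∧
      g.Holds s' .vec (g.R ^ (m - k) * g.N ^ k) (g.yatesIter f m v (m - k)))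
    (by simp) (by simp [hm]) hg.loopBlock
    ⟨Frame.refl.set (by decide), rfl, by simp,
      by simp only [Nat.sub_self, pow_zero, one_mul, yatesIter]; exact hv⟩ ?_ ?_
  · rintro k hk s₁ ⟨hF, h1, h2, h3⟩
    have e1 : g.R ^ (m - (k + 1)) * g.N ^ (k + 1) = g.R ^ (m - (k + 1)) * g.N ^ k * g.N := by
      rw [pow_succ, mul_assoc]
    have e2 : g.R ^ (m - k) * g.N ^ k = g.R * (g.R ^ (m - (k + 1)) * g.N ^ k) := by
      rw [show m - k = m - (k + 1) + 1 by omega, pow_succ]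
      ring
    have e3 : g.R * (g.R ^ (m - (k + 1)) * g.N ^ k) ≤ g.R ^ m := by
      rw [← e2]
      calc g.R ^ (m - k) * g.N ^ k ≤ g.R ^ (m - k) * g.R ^ k := by
            gcongr
            exact g.N_le_R
        _ = g.R ^ m := by rw [← pow_add]; congr 1; omega
    have e4 : g.R ^ (m - (k + 1)) * g.N ^ k * g.N ≤ g.R ^ m := by
      refine le_trans ?_ e3
      rw [mul_comm]
      exact Nat.mul_le_mul_right _ g.N_le_R
    rw [e1] at h2 h3
    refine (runs_yatesRound hg hf (s := s₁.set .loopBlock k) (by simpa using h2)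
      (by rw [Store.set_var, if_neg (by decide), hF.1 _ (by decide), hfam]) e4 e3
      (by rw [Store.set_arr, hF.2 _ (by decide)]; exact hcoef) h3).mono ?_
    rintro s' ⟨hF', f1, f2, f3⟩
    refine ⟨(hF.set (by decide)).trans (hF'.mono (by decide) (by decide)), f1.trans h1,
      by rw [f2, e2], ?_⟩
    rw [e2, show m - k = m - (k + 1) + 1 by omega]
    rw [yatesIter, show m - 1 - (m - (k + 1)) = k by omega]
    exact f3
  · rintro s' ⟨hF, h1, h2, h3⟩
    exact ⟨hF, h1, by simpa using h3⟩

theorem runs_accumulate (hg : g.Fits m L M w β) {s : Store} {v v' : ℕ → ZMod g.p}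
    (hn : s.var .numRank = g.R ^ m) (hv : g.Holds s .prod (g.R ^ m) v)
    (hv' : g.Holds s .vec (g.R ^ m) v') :
    Runs w β g.accumulate s fun s' => Frame [.loopOut] [.prod] s s' ∧ s'.coins = s.coins ∧
      g.Holds s' .prod (g.R ^ m) fun i => v i * v' i := by
  have w1 := hg.vec
  have w3 := hg.mod
  -- The products are updated in place, so the invariant also has to record that the entries below
  -- `k` are still the old ones.
  refine Runs.loop (n := g.R ^ m) (fun k s' => Frame [.loopOut] [.prod] s s' ∧
      s'.coins = s.coins ∧ (∀ i < k, s'.arr .prod i = s.arr .prod i) ∧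
      ∀ i < g.R ^ m, k ≤ i → s'.arr .prod i < g.p ∧ (s'.arr .prod i : ZMod g.p) = v i * v' i)
    (by simp) (by simp [hn]) hg.loopOut ⟨Frame.refl, rfl, fun _ _ => rfl, by omega⟩ ?_
    fun s' h => ⟨h.1, h.2.1, fun i hi => h.2.2.2 i hi (Nat.zero_le _)⟩
  rintro k hk s₁ ⟨hF, h1, h2, h3⟩
  have e1 := h2 k (by omega)
  have e2 : s₁.arr .vec k = s.arr .vec k := by rw [hF.2 _ (by decide)]
  obtain ⟨a1, a2⟩ := hv k hk
  obtain ⟨b1, b2⟩ := hv' k hk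
  have e3 : s.arr .prod k * s.arr .vec k ≤ g.p * g.p := Nat.mul_le_mul a1.le b1.le
  refine .put (by simp) (by simp [e1, e2]; omega) (by simp; omega)
    ⟨(hF.set (by decide)).put (by decide), h1, fun i hi => ?_, fun i hi hki => ?_⟩
  · rw [Store.put_arr, if_neg (by simp; omega)]
    exact h2 i (by omega)
  · simp only [Store.put_arr, Expr.eval_var, Store.set_var, if_true, true_and, Expr.eval_get,
      Store.set_arr, Expr.eval_mod, Expr.eval_mul, Expr.eval_lit, e1, e2]
    split_ifs with h
    · refine ⟨Nat.mod_lt _ g.prime.pos, ?_⟩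
      simp [a2, b2, h]
    · exact h3 i hi (by omega)

/-- The data that the trials use but do not change. -/
structure Ready (g : Gadget) (m L : ℕ) (D : ℕ → ℕ → ℕ) (s : Store) : Prop where
  blocks : s.var .blocks = m
  points : s.var .points = 3 * g.K * m
  inputLen : s.var .inputLen = L
  numIdx : s.var .numIdx = g.N ^ m
  numRank : s.var .numRank = g.R ^ m
  powX : s.var .powX = 2 ^ (3 * g.K * m)
  table : ∀ f < 3, ∀ y, s.arr .table (L + 3 * y + f) = D f y
  pos : ∀ a < g.N, ∀ i < g.K, s.arr .pos (a * g.K + i) = g.pos a i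
  coef : ∀ f < 3, ∀ l < g.R, ∀ a < g.N, s.arr .coef ((f * g.R + l) * g.N + a) = g.coef f l a

/-- The variables that are changed in a trial. -/
def trialVars : List Var :=
  [.seed, .loopBit, .coin, .powF, .loopPos, .digit, .tmp, .loopBlock, .loopGood, .loopElt, .acc,
    .loopOut, .fam, .loopIdx, .rest, .mask, .quo, .len, .res, .loopTrial]

/-- The arrays that are changed in a trial. -/
def trialArrs : List Arr := [.perm, .blockMask, .vec, .vecNew, .prod]

theorem Ready.frame {D : ℕ → ℕ → ℕ} {s s' : Store} (h : g.Ready m L D s)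
    (hF : Frame trialVars trialArrs s s') : g.Ready m L D s' where
  blocks := by rw [hF.1 _ (by decide), h.blocks]
  points := by rw [hF.1 _ (by decide), h.points]
  inputLen := by rw [hF.1 _ (by decide), h.inputLen]
  numIdx := by rw [hF.1 _ (by decide), h.numIdx]
  numRank := by rw [hF.1 _ (by decide), h.numRank]
  powX := by rw [hF.1 _ (by decide), h.powX]
  table := by rw [hF.2 _ (by decide)]; exact h.table
  pos := by rw [hF.2 _ (by decide)]; exact h.pos
  coef := by rw [hF.2 _ (by decide)]; exact h.coef

/-- The coin tosses of the first `k` families, the last one first. -/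
def famCoins (l : ℕ → List Bool) (l' : List Bool) : ℕ → List Bool
  | 0 => l'
  | k + 1 => l k ++ famCoins l l' k

theorem runs_trial (hg : g.Fits m L M w β) {s : Store} {D : ℕ → ℕ → ℕ} (hD : ∀ f y, D f y ≤ 1)
    (hs : g.Ready m L D s) {lu l' : List Bool} {l : ℕ → List Bool}
    (hlu : lu.length = 3 * g.K * m * (3 * g.K * m)) (hl : ∀ f < 3, (l f).length = g.N ^ m)
    (hc : s.coins = lu ++ famCoins l l' 3) (hres : s.var .res + g.p < 2 ^ w) :
    Runs w β g.trial s fun s' => Frame trialVars trialArrs s s' ∧ s'.coins = l' ∧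
      ∃ v < g.p, s'.var .res = s.var .res + v ∧ (v : ZMod g.p) = g.trialVal m (ofBits lu) D l := by
  have hw' := hg.lt
  have hw1 := hg.one_le
  have w1 := hg.vec
  have w3 := hg.mod
  have hpp : g.p ≤ g.p * g.p := Nat.le_mul_of_pos_right _ g.prime.pos
  set σ := shuffle (3 * g.K * m) (ofBits lu) with hσ
  have hσx : ∀ i < 3 * g.K * m, σ i < 3 * g.K * m := fun i hi => shuffle_lt _ hi
  refine (runs_drawSeed hg hlu hc hs.points).seq ?_
  rintro s₁ ⟨hF₁, hc₁, hseed⟩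
  refine (runs_initPerm hg (by rw [hF₁.1 _ (by decide), hs.points])
    (by rw [hF₁.1 _ (by decide), hs.powX])).seq ?_
  rintro s₂ ⟨hF₂, hc₂, hp₂⟩
  refine (runs_permute hg rfl (u := ofBits lu)
    (by rw [hF₂.1 _ (by decide), hF₁.1 _ (by decide), hs.points])
    (by rw [hF₂.1 _ (by decide), hseed]) hp₂).seq ?_
  rintro s₃ ⟨hF₃, hc₃, hp₃⟩
  have hr₃ : s₃.var .res = s.var .res := by
    rw [hF₃.1 _ (by decide), hF₂.1 _ (by decide), hF₁.1 _ (by decide)]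
  replace hF₃ : Frame trialVars trialArrs s s₃ :=
    (hF₁.mono (by decide) (by decide)).trans ((hF₂.mono (by decide) (by decide)).trans
      (hF₃.mono (by decide) (by decide)))
  have r₃ := hs.frame hF₃
  refine (runs_blockMasks hg hσx r₃.blocks hp₃ r₃.pos).seq ?_
  rintro s₄ ⟨hF₄, hc₄, hb₄⟩
  have hr₄ : s₄.var .res = s.var .res := by rw [hF₄.1 _ (by decide), hr₃]
  replace hF₄ : Frame trialVars trialArrs s s₄ := hF₃.trans (hF₄.mono (by decide) (by decide))
  have r₄ := hs.frame hF₄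
  refine Runs.seq (Q' := fun s' => Frame [.loopOut] [.prod] s₄ s' ∧
      s'.coins = famCoins l l' 3 ∧ g.Holds s' .prod (g.R ^ m) fun _ => 1) ?_ ?_
  · refine Runs.loop (n := g.R ^ m) (fun k s' => Frame [.loopOut] [.prod] s₄ s' ∧
        s'.coins = famCoins l l' 3 ∧ ∀ i < g.R ^ m, k ≤ i → s'.arr .prod i = 1)
      (by simp) (by simp [r₄.numRank]) hg.loopOut
      ⟨Frame.refl, by rw [hc₄, hc₃, hc₂, hc₁], by omega⟩ ?_ ?_
    · rintro k hk s' ⟨hF, h1, h2⟩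
      refine .put (by simp) (by simp; omega) (by simp; omega)
        ⟨(hF.set (by decide)).put (by decide), h1, fun i hi hki => ?_⟩
      simp only [Store.put_arr, Expr.eval_var, Store.set_var, if_true, true_and, Expr.eval_lit,
        Store.set_arr]
      split_ifs with h
      · rfl
      · exact h2 i hi (by omega)
    · rintro s' ⟨hF, h1, h2⟩
      refine ⟨hF, h1, fun i hi => ?_⟩
      rw [h2 i hi (Nat.zero_le _)]
      exact ⟨g.prime.one_lt, by simp⟩
  rintro s₅ ⟨hF₅, hc₅, hv₅⟩
  set Y : ℕ → ℕ → ZMod g.p := fun f i =>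
    g.yatesIter f m (fun j => (g.startVec m (ofBits lu) (D f) (l f) j : ZMod g.p)) m i with hY
  refine Runs.seq (Q' := fun s' => Frame trialVars trialArrs s s' ∧
      s'.var .res = s.var .res ∧ s'.coins = l' ∧
      g.Holds s' .prod (g.R ^ m) fun i => ∏ f ∈ Finset.range 3, Y f i) ?_ ?_
  · have hres₅ : s₅.var .res = s.var .res := by
      rw [hF₅.1 _ (by decide), hr₄]
    -- The block masks and `res` may change during a trial and are thus not covered by the frame;
    -- that this loop leaves them alone is carried along separately. The families come in the order
    -- `2, 1, 0`, which fixes the order of their coin tosses.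
    refine Runs.loop (n := 3) (fun k s' => Frame trialVars trialArrs s s' ∧
        s'.arr .blockMask = s₄.arr .blockMask ∧
        s'.var .res = s.var .res ∧ s'.coins = famCoins l l' k ∧
        g.Holds s' .prod (g.R ^ m) fun i => ∏ f ∈ Finset.Ico k 3, Y f i)
      (by simp; omega) (by simp) hg.fam
      ⟨hF₄.trans (hF₅.mono (by decide) (by decide)), by rw [hF₅.2 _ (by decide)], hres₅, hc₅,
        by simpa using hv₅⟩ ?_ ?_
    · rintro f hf s₆ ⟨hF₆, hB₆, hr₆, hc₆, hv₆⟩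
      have r₆ := hs.frame (hF₆.set (v := .fam) (e := f) (by decide))
      refine (runs_fill hg hf (hD f) hσx r₆.blocks r₆.numIdx r₆.inputLen (by simp) (hl f hf)
        hc₆ (by rw [Store.set_arr, hB₆]; exact hb₄) (r₆.table f hf)).seq ?_
      rintro s₇ ⟨hF₇, hc₇, hv₇⟩
      have hF₇' := (hF₆.set (v := .fam) (e := f) (by decide)).trans
        (hF₇.mono (by decide) (by decide))
      have r₇ := hs.frame hF₇'
      have e7 : s₇.var .fam = f := by rw [hF₇.1 _ (by decide)]; simp
      have hv₇' : g.Holds s₇ .vec (g.N ^ m)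
          fun j => (g.startVec m (ofBits lu) (D f) (l f) j : ZMod g.p) := by
        intro i hi
        rw [hv₇ i hi]
        refine ⟨lt_of_le_of_lt ?_ g.prime.one_lt, rfl⟩
        exact Nat.mul_le_mul (Bool.toNat_le _) (hD _ _)
      refine (runs_yates hg hf e7 r₇.blocks r₇.numIdx r₇.coef hv₇').seq ?_
      rintro s₈ ⟨hF₈, hc₈, hv₈⟩
      have hF₈' := hF₇'.trans (hF₈.mono (by decide) (by decide))
      have e8 : s₈.arr .prod = s₆.arr .prod := by
        rw [hF₈.2 _ (by decide), hF₇.2 _ (by decide), Store.set_arr]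
      refine (runs_accumulate hg (hs.frame hF₈').numRank
        (v := fun i => ∏ f ∈ Finset.Ico (f + 1) 3, Y f i)
        (by unfold Holds; rw [e8]; exact hv₆) hv₈).mono ?_
      rintro s₉ ⟨hF₉, hc₉, hv₉⟩
      refine ⟨hF₈'.trans (hF₉.mono (by decide) (by decide)), ?_, ?_, ?_, ?_⟩
      · rw [hF₉.2 _ (by decide), hF₈.2 _ (by decide), hF₇.2 _ (by decide), Store.set_arr, hB₆]
      · rw [hF₉.1 _ (by decide), hF₈.1 _ (by decide), hF₇.1 _ (by decide), Store.set_var,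
          if_neg (by decide), hr₆]
      · rw [hc₉, hc₈, hc₇]
      · have e9 : (fun i => ∏ f ∈ Finset.Ico f 3, Y f i) =
            fun i => (∏ f ∈ Finset.Ico (f + 1) 3, Y f i) * Y f i := by
          ext i
          rw [Finset.prod_eq_prod_Ico_succ_bot hf, mul_comm]
        rw [e9]
        exact hv₉
    · rintro s' ⟨hF, h1, h2, h3, h4⟩
      exact ⟨hF, h2, h3, by rw [Finset.range_eq_Ico]; exact h4⟩
  rintro s₆ ⟨hF₆, hr₆, hc₆, hv₆⟩
  refine Runs.seq (Q' := fun s' => s' = s₆.set .acc 0) (.set (by simp) rfl) ?_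
  rintro _ rfl
  refine Runs.seq (Q' := fun s' => Frame trialVars trialArrs s s' ∧
      s'.var .res = s.var .res ∧ s'.coins = l' ∧ s'.var .acc < g.p ∧
      (s'.var .acc : ZMod g.p) = g.trialVal m (ofBits lu) D l) ?_ ?_
  · refine Runs.loop (n := g.R ^ m) (fun k s' => Frame [.loopOut, .acc] [] s₆ s' ∧
        s'.coins = l' ∧ s'.var .acc < g.p ∧ (s'.var .acc : ZMod g.p) =
          ∑ i ∈ Finset.Ico k (g.R ^ m), ∏ f ∈ Finset.range 3, Y f i)
      (by simp) (by simp [(hs.frame hF₆).numRank]) hg.loopOut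
      ⟨Frame.refl.set (by decide), hc₆, by simpa using g.prime.pos, by simp⟩ ?_ ?_
    · rintro k hk s' ⟨hF, h1, h2, h3⟩
      obtain ⟨a1, a2⟩ := hv₆ k hk
      have e1 : s'.arr .prod k = s₆.arr .prod k := by rw [hF.2 _ (by decide)]
      refine .set (by simp [e1]; omega) ⟨(hF.set (by decide)).set (by decide), h1, ?_, ?_⟩
      · simpa using Nat.mod_lt _ g.prime.pos
      · simp [e1, a2, h3, Finset.sum_eq_sum_Ico_succ_bot hk]
        ring
    · rintro s' ⟨hF, h1, h2, h3⟩
      refine ⟨hF₆.trans (hF.mono (by decide) (by decide)), ?_, h1, h2, ?_⟩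
      · rw [hF.1 _ (by decide), hr₆]
      · rw [h3, trialVal, ← Finset.range_eq_Ico]
  · rintro s₇ ⟨hF₇, hr₇, hc₇, ha₇, hv₇⟩
    exact .set (by simp [hr₇]; omega) ⟨hF₇.set (by decide), hc₇, s₇.var .acc, ha₇,
      by simp [hr₇], hv₇⟩

end Gadget

/-! ### Set-up before the trials, and the whole program -/

namespace Gadget

variable {g : Gadget} {m L M w : ℕ} {β : Var → ℕ}

theorem runs_writeTable {a : Arr} {t : ℕ → ℕ} {n : ℕ} {s : Store}
    (hn : 8 * n + 8 < 2 ^ w) (ht : ∀ i < n, t i < 2 ^ w) :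
    Runs w β (writeTable a t n) s fun s' => Frame [.tmp] [a] s s' ∧ s'.coins = s.coins ∧
      ∀ i < n, s'.arr a i = t i := by
  induction n with
  | zero => exact .set (by simp) ⟨Frame.refl.set (by decide), rfl, by omega⟩
  | succ n ih =>
    refine (ih (by omega) fun i hi => ht i (by omega)).seq ?_
    rintro s' ⟨hF, h1, h2⟩
    refine .put (by simp; omega) (by simpa using ht n (by omega)) (by simp; omega)
      ⟨hF.put (by simp), h1, fun i hi => ?_⟩
    simp only [Store.put_arr, Expr.eval_lit, true_and]
    split_ifs with h
    · rw [h]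
    · exact h2 i (by omega)

theorem runs_power {x : Var} (hx : x ≠ .loopPow) {b k : ℕ} {e : Expr} {s : Store} (hb : 1 ≤ b)
    (hw : 0 < w) (he : e.Safe w (s.set x 1)) (hk : e.eval (s.set x 1) = k) (hβ : k ≤ β .loopPow)
    (hbk : b ^ k < 2 ^ w) (hbw : b < 2 ^ w) :
    Runs w β (power x b e) s fun s' => (∀ v, v ≠ x → v ≠ .loopPow → s'.var v = s.var v) ∧
      s'.cell = s.cell ∧ s'.coins = s.coins ∧ s'.var x = b ^ k := by
  refine Runs.seq (Q' := fun s' => s' = s.set x 1) (.set (by simp; omega) rfl) ?_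
  rintro _ rfl
  refine Runs.loop (n := k) (fun i s' => (∀ v, v ≠ x → v ≠ .loopPow → s'.var v = s.var v) ∧
      s'.cell = s.cell ∧ s'.coins = s.coins ∧ s'.var x = b ^ (k - i)) he hk hβ
    ⟨fun v h1 h2 => by simp [h1], rfl, rfl, by simp⟩ ?_
    fun s' h => ⟨h.1, h.2.1, h.2.2.1, by simpa using h.2.2.2⟩
  rintro i hi s' ⟨h1, h2, h3, h4⟩
  have e1 : b ^ (k - (i + 1)) * b = b ^ (k - i) := by
    rw [← pow_succ]
    congr 1
    omega
  have e2 : b ^ (k - i) ≤ b ^ k := Nat.pow_le_pow_right hb (by omega)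
  refine .set (by simp [hx, h4, e1]; omega) ⟨fun v h5 h6 => ?_, h2, h3, ?_⟩
  · simp [h5, h6, h1]
  · simp [hx, h4, e1]

/-- The numbers that occur before the trials have at most `w` bits, and the loop bounds are large
enough. -/
structure FitsSetup (g : Gadget) (n m L w : ℕ) (β : Var → ℕ) : Prop where
  dim : n + g.K + 3 * g.K * m + L < 2 ^ w
  table : 8 * (L + 3 * 2 ^ (3 * g.K * m) + 3) + 8 < 2 ^ w
  countPow : g.G ^ m < 2 ^ w
  total : (27 ^ g.K) ^ m < 2 ^ w
  G : g.G < 2 ^ w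
  base : 27 ^ g.K < 2 ^ w
  trials : 32 * ((27 ^ g.K) ^ m / g.G ^ m + 1) < 2 ^ w
  loopPow : 3 * g.K * m ≤ β .loopPow

/-- The memory contains an instance with families that are given by lists of bit masks. -/
structure IsInput (n L : ℕ) (F : ℕ → List ℕ) (c : ℕ → ℕ) : Prop where
  dim : c 0 = n
  size : ∀ f < 3, c (f + 1) = (F f).length
  len : L = 4 + (F 0).length + (F 1).length + (F 2).length
  entry : ∀ f < 3, ∀ i < (F f).length,
    c (4 + ∑ f' ∈ Finset.range f, (F f').length + i) = (F f).getD i 0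
  zero : ∀ i, L ≤ i → c i = 0
  lt : ∀ f < 3, ∀ b ∈ F f, b < 2 ^ (3 * n)

/-- The state after the computation of the parameters. -/
structure HasParams (g : Gadget) (n m L : ℕ) (s : Store) : Prop where
  blocks : s.var .blocks = m
  points : s.var .points = 3 * g.K * m
  inputLen : s.var .inputLen = L
  numIdx : s.var .numIdx = g.N ^ m
  numRank : s.var .numRank = g.R ^ m
  powX : s.var .powX = 2 ^ (3 * g.K * m)
  powE : s.var .powE = 2 ^ (g.K * m - n)
  trials : s.var .trials = 32 * ((27 ^ g.K) ^ m / g.G ^ m + 1)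

theorem runs_params (hg : g.Fits m L M w β) {n : ℕ} (hm : m = (n + (g.K - 1)) / g.K)
    (hg' : g.FitsSetup n m L w β) {F : ℕ → List ℕ} {s : Store} (hs : IsInput n L F s.cell) :
    Runs w β g.params s fun s' => g.HasParams n m L s' ∧ s'.cell = s.cell ∧ s'.coins = s.coins ∧
      s'.var .res = s.var .res := by
  have hw' := hg.lt
  have hw1 := hg.one_le
  have w1 := hg'.dim
  have w2 := hg.vec
  have w3 := hg.coef
  have w4 := hg'.loopPow
  have w5 := hg'.table
  have w6 := hg'.trials
  have hK := g.K_pos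
  have hN := g.N_pos
  have hNR := g.N_le_R
  have hNw : g.N < 2 ^ w := by nlinarith
  have hRw : g.R < 2 ^ w := by nlinarith
  have hNm : g.N ^ m ≤ g.R ^ m := Nat.pow_le_pow_left hNR m
  have hx : g.K * m ≤ 3 * g.K * m := Nat.mul_le_mul_right m (by omega)
  have hx' : m ≤ g.K * m := Nat.le_mul_of_pos_left _ hK
  have hKw := hg.elt
  have s0 : s.cell 1 = (F 0).length := hs.size 0 (by norm_num)
  have s1 : s.cell 2 = (F 1).length := hs.size 1 (by norm_num)
  have s2 : s.cell 3 = (F 2).length := hs.size 2 (by norm_num)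
  have hL := hs.len
  refine Runs.seq (Q' := fun s' => s' = s.set .dim n) (.set (by simp) (by simp [hs.dim])) ?_
  rintro _ rfl
  refine Runs.seq (Q' := fun s' => s' = (s.set .dim n).set .blocks m)
    (.set (by simp; omega) (by simp [hm])) ?_
  rintro _ rfl
  refine Runs.seq (Q' := fun s' => s' = ((s.set .dim n).set .blocks m).set .points (3 * g.K * m))
    (.set (by simp; omega) (by simp)) ?_
  rintro _ rfl
  refine Runs.seq (Q' := fun s' => s' = (((s.set .dim n).set .blocks m).set .points
    (3 * g.K * m)).set .inputLen L)
    (.set (by simp [s0, s1, s2]; omega) (by simp [s0, s1, s2, hL])) ?_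
  rintro s₀ h₀
  have a1 : s₀.var .dim = n := by simp [h₀]
  have a2 : s₀.var .blocks = m := by simp [h₀]
  have a3 : s₀.var .points = 3 * g.K * m := by simp [h₀]
  have a4 : s₀.var .inputLen = L := by simp [h₀]
  have a5 : s₀.cell = s.cell := by simp [h₀]
  have a6 : s₀.coins = s.coins := by simp [h₀]
  have a7 : s₀.var .res = s.var .res := by simp [h₀]
  clear h₀
  refine (runs_power (by decide) hN hw1 (by simp) (k := m) (by simp [a2]) (by omega) (by omega)
    hNw).seq ?_
  rintro s₁ ⟨b1, b2, b3, b4⟩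
  refine (runs_power (by decide) (hN.trans hNR) hw1 (by simp) (k := m) (by simp [b1, a2])
    (by omega) (by omega) hRw).seq ?_
  rintro s₂ ⟨c1, c2, c3, c4⟩
  refine (runs_power (by decide) g.G_pos hw1 (by simp) (k := m) (by simp [c1, b1, a2])
    (by omega) hg'.countPow hg'.G).seq ?_
  rintro s₃ ⟨d1, d2, d3, d4⟩
  refine (runs_power (by decide) (Nat.one_le_pow _ _ (by norm_num)) hw1 (by simp) (k := m)
    (by simp [d1, c1, b1, a2]) (by omega) hg'.total hg'.base).seq ?_
  rintro s₄ ⟨e1, e2, e3, e4⟩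
  refine (runs_power (by decide) (by norm_num) hw1 (by simp) (k := 3 * g.K * m)
    (by simp [e1, d1, c1, b1, a3]) (by omega) (by omega) (by omega)).seq ?_
  rintro s₅ ⟨f1, f2, f3, f4⟩
  have hE : 2 ^ (g.K * m - n) ≤ 2 ^ (3 * g.K * m) := Nat.pow_le_pow_right (by norm_num) (by omega)
  refine (runs_power (by decide) (by norm_num) hw1
    (by simp [f1, e1, d1, c1, b1, a2]; omega) (k := g.K * m - n)
    (by simp [f1, e1, d1, c1, b1, a2, a1]) (by omega) (by omega) (by omega)).seq ?_
  rintro s₆ ⟨g1, g2, g3, g4⟩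
  have h1 : s₆.var .total = (27 ^ g.K) ^ m := by
    rw [g1 _ (by decide) (by decide), f1 _ (by decide) (by decide), e4]
  have h2 : s₆.var .countPow = g.G ^ m := by
    rw [g1 _ (by decide) (by decide), f1 _ (by decide) (by decide),
      e1 _ (by decide) (by decide), d4]
  refine .set (by simp [h1, h2]; omega) ⟨⟨?_, ?_, ?_, ?_, ?_, ?_, ?_, ?_⟩, ?_, ?_, ?_⟩
  · simp [g1, f1, e1, d1, c1, b1, a2]
  · simp [g1, f1, e1, d1, c1, b1, a3]
  · simp [g1, f1, e1, d1, c1, b1, a4]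
  · simp [g1, f1, e1, d1, c1, b4]
  · simp [g1, f1, e1, d1, c4]
  · simp [g1, f4]
  · simp [g4]
  · simp [h1, h2]
  · simp [g2, f2, e2, d2, c2, b2, a5]
  · simp [g3, f3, e3, d3, c3, b3, a6]
  · simp [g1, f1, e1, d1, c1, b1, a7]

/-- The bit mask of the dummy elements of family `f`. -/
def padMask (n e f : ℕ) : ℕ := (2 ^ e - 1) * 2 ^ (3 * n + f * e)

/-- The indicator function of the bit masks in the families, dummy elements included. -/
def tableOf (n e : ℕ) (F : ℕ → List ℕ) (f y : ℕ) : ℕ :=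
  if ∃ b ∈ F f, y = b + padMask n e f then 1 else 0

theorem tableOf_le (n e : ℕ) (F : ℕ → List ℕ) (f y : ℕ) : tableOf n e F f y ≤ 1 := by
  unfold tableOf
  split <;> simp

theorem add_padMask_lt {n e f b : ℕ} (hb : b < 2 ^ (3 * n)) :
    b + padMask n e f < 2 ^ (3 * n + (f + 1) * e) := by
  have h1 : 2 ^ (3 * n + (f + 1) * e) = 2 ^ e * 2 ^ (3 * n + f * e) := by
    rw [← pow_add]
    congr 1
    ring
  have h2 : 2 ^ (3 * n) ≤ 2 ^ (3 * n + f * e) := Nat.pow_le_pow_right (by norm_num) (by omega)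
  have h3 : 1 * 2 ^ (3 * n + f * e) ≤ 2 ^ e * 2 ^ (3 * n + f * e) :=
    Nat.mul_le_mul_right _ Nat.one_le_two_pow
  rw [padMask, Nat.sub_mul, h1]
  omega

/-- The table starts at index `L`, hence at address `8 * L`, which lies beyond the input; so it can
be filled while the input is still being read. The three families are interleaved modulo `3`. -/
theorem runs_readFamily {n e f off X : ℕ} {F : List ℕ} {s : Store}
    (hw : 8 * (L + 3 * 2 ^ X + 3) + 8 < 2 ^ w) (hX : 3 * n + (f + 1) * e ≤ X)
    (hf : f < 3) (hβ : F.length ≤ β .loopInput) (c1 : s.var .size = F.length)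
    (c2 : s.var .off = off) (c3 : s.var .fam = f) (c4 : s.var .powF = 2 ^ (3 * n + f * e))
    (c8 : s.var .powE = 2 ^ e) (c9 : s.var .inputLen = L) (hoff : off + F.length ≤ L)
    (hentry : ∀ i < F.length, s.cell (off + i) = F.getD i 0)
    (hlt : ∀ b ∈ F, b < 2 ^ (3 * n))
    (h0 : ∀ y, s.arr .table (L + 3 * y + f) = 0) :
    Runs w β (.loop .loopInput (.var .size) (.put .table (.var .inputLen +
      .lit 3 * (.cell (.var .off + .var .loopInput) + (.var .powE - .lit 1) * .var .powF) +
        .var .fam) (.lit 1))) s fun s' => Frame [.loopInput] [.table] s s' ∧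
      s'.coins = s.coins ∧ (∀ c < L, s'.cell c = s.cell c) ∧
      ∀ f' < 3, ∀ y, s'.arr .table (L + 3 * y + f') =
        if f' = f then if ∃ b ∈ F, y = b + padMask n e f then 1 else 0
        else s.arr .table (L + 3 * y + f') := by
  have hX' : 2 ^ (3 * n + (f + 1) * e) ≤ 2 ^ X := Nat.pow_le_pow_right (by norm_num) hX
  have hw1 : w ≠ 0 := by
    rintro rfl
    simp at hw
  refine Runs.loop (n := F.length) (fun i s' => Frame [.loopInput] [.table] s s' ∧
      s'.coins = s.coins ∧ (∀ c < L, s'.cell c = s.cell c) ∧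
      ∀ f' < 3, ∀ y, s'.arr .table (L + 3 * y + f') =
        if f' = f then
          if ∃ j < F.length, i ≤ j ∧ y = F.getD j 0 + padMask n e f then 1 else 0
        else s.arr .table (L + 3 * y + f'))
    (by simp) (by simp [c1]) hβ ?_ ?_ ?_
  · refine ⟨Frame.refl, rfl, fun _ _ => rfl, fun f' hf' y => ?_⟩
    split_ifs with q1 q2
    · obtain ⟨j, hj, hj', _⟩ := q2
      omega
    · rw [q1, h0]
    · rfl
  · rintro i hi s₃ ⟨hF₃, d1, d2, d3⟩
    have k1 : s₃.var .off = off := by rw [hF₃.1 _ (by decide), c2]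
    have k2 : s₃.var .fam = f := by rw [hF₃.1 _ (by decide), c3]
    have k3 : s₃.var .powF = 2 ^ (3 * n + f * e) := by rw [hF₃.1 _ (by decide), c4]
    have k4 : s₃.var .powE = 2 ^ e := by rw [hF₃.1 _ (by decide), c8]
    have k5 : s₃.var .inputLen = L := by rw [hF₃.1 _ (by decide), c9]
    have k6 : s₃.cell (off + i) = F.getD i 0 := by rw [d2 _ (by omega), hentry i hi]
    have k7 : F.getD i 0 < 2 ^ (3 * n) := by
      rw [List.getD_eq_getElem _ _ hi]
      exact hlt _ (List.getElem_mem hi)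
    have k8 := add_padMask_lt (e := e) (f := f) k7
    have k10 : (2 ^ e - 1) * 2 ^ (3 * n + f * e) = padMask n e f := rfl
    refine .put ?_ (by simpa using hw1) ?_
      ⟨(hF₃.set (by decide)).put (by decide), d1, fun c hc => ?_, fun f' hf' y => ?_⟩
    · simp only [Expr.safe_add, Expr.safe_mul, Expr.safe_var, Expr.safe_lit, Expr.safe_cell,
        Expr.safe_sub, Expr.eval_add, Expr.eval_mul, Expr.eval_lit, Expr.eval_var,
        Expr.eval_cell, Expr.eval_sub, Store.set_var, Store.set_cell, reduceCtorEq, if_false,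
        if_true, k1, k2, k3, k4, k5, k6, k10, true_and]
      generalize padMask n e f = q at *
      generalize F.getD i 0 = q' at *
      omega
    · simp only [Expr.eval_add, Expr.eval_mul, Expr.eval_lit, Expr.eval_var,
        Expr.eval_cell, Expr.eval_sub, Store.set_var, Store.set_cell, reduceCtorEq, if_false,
        if_true, k1, k2, k3, k4, k5, k6, k10]
      omega
    · rw [Store.put_cell, if_neg]
      · exact d2 c hc
      · simp only [Expr.eval_add, Expr.eval_var, Store.set_var, reduceCtorEq, if_false, k5]
        omega
    · simp only [Store.put_arr, Expr.eval_add, Expr.eval_mul, Expr.eval_lit, Expr.eval_var,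
        Expr.eval_cell, Expr.eval_sub, Store.set_var, Store.set_cell, reduceCtorEq, if_false,
        if_true, k1, k2, k3, k4, k5, k6, k10, true_and, Store.set_arr, d3 f' hf' y]
      by_cases hff : f' = f
      · subst hff
        simp only [if_true]
        by_cases hy : y = F.getD i 0 + padMask n e f'
        · rw [if_pos (by omega), if_pos ⟨i, hi, le_rfl, hy⟩]
        · rw [if_neg (by omega)]
          refine if_congr ⟨?_, ?_⟩ rfl rfl
          · rintro ⟨j, hj, hij, hj'⟩
            exact ⟨j, hj, by omega, hj'⟩
          · rintro ⟨j, hj, hij, hj'⟩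
            rcases hij.eq_or_lt with rfl | h
            · exact absurd hj' hy
            · exact ⟨j, hj, h, hj'⟩
      · rw [if_neg (by omega), if_neg hff, if_neg hff]
  · rintro s' ⟨hF₃, d1, d2, d3⟩
    refine ⟨hF₃, d1, d2, fun f' hf' y => ?_⟩
    rw [d3 f' hf' y]
    refine if_congr Iff.rfl (if_congr ⟨?_, ?_⟩ rfl rfl) rfl
    · rintro ⟨j, hj, -, hj'⟩
      refine ⟨_, List.getElem_mem hj, ?_⟩
      rwa [List.getD_eq_getElem _ _ hj] at hj'
    · rintro ⟨b, hb, hb'⟩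
      obtain ⟨j, hj, rfl⟩ := List.getElem_of_mem hb
      exact ⟨j, hj, Nat.zero_le _, by rwa [List.getD_eq_getElem _ _ hj]⟩

theorem runs_readInput (hg : g.Fits m L M w β) {n e : ℕ} (he : e = g.K * m - n) (hn : n ≤ g.K * m)
    (hg' : g.FitsSetup n m L w β) {F : ℕ → List ℕ} {s : Store} (hs : IsInput n L F s.cell)
    (hp : g.HasParams n m L s) (hβ : ∀ f < 3, (F f).length ≤ β .loopInput) :
    Runs w β readInput s fun s' => g.HasParams n m L s' ∧ s'.coins = s.coins ∧
      s'.var .res = s.var .res ∧ ∀ f < 3, ∀ y, s'.arr .table (L + 3 * y + f) = tableOf n e F f y := by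
  have hw' := hg.lt
  have hw1 := hg.one_le
  have w1 := hg'.dim
  have w5 := hg'.table
  have hL := hs.len
  have hx : 3 * g.K * m = 3 * n + 3 * e := by
    rw [he, mul_assoc]
    omega
  refine Runs.seq (Q' := fun s' => s' = s.set .off L) (.set (by simp) (by simp [hp.inputLen])) ?_
  rintro _ rfl
  refine Runs.seq (Q' := fun s' => s' = (s.set .off L).set .powF (2 ^ (3 * g.K * m)))
    (.set (by simp) (by simp [hp.powX])) ?_
  rintro _ rfl
  have hoff : L = 4 + ∑ f' ∈ Finset.range 3, (F f').length := by
    simp [Finset.sum_range_succ, hL, add_assoc]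
  -- The families are read from the last to the first: `off` moves back from the end of the input,
  -- and `powF` comes down from `2 ^ (3 * n + 3 * e)`, losing the dummy elements of one family in
  -- each round.
  refine Runs.loop (n := 3) (fun k s' => Frame [.off, .powF, .fam, .size, .loopInput] [.table] s s' ∧
      s'.coins = s.coins ∧ (∀ c < L, s'.cell c = s.cell c) ∧ s'.var .powF = 2 ^ (3 * n + k * e) ∧
      s'.var .off = 4 + ∑ f' ∈ Finset.range k, (F f').length ∧
      ∀ f < 3, ∀ y, s'.arr .table (L + 3 * y + f) = if k ≤ f then tableOf n e F f y else 0)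
    (by simp; omega) (by simp) hg.fam ?_ ?_ ?_
  · refine ⟨(Frame.refl.set (by decide)).set (by decide), rfl, fun _ _ => rfl, by simp [hx],
      by simpa using hoff, fun f hf y => ?_⟩
    rw [if_neg (by omega)]
    -- The table needs no initialization, as the memory behind the input is zero.
    exact hs.zero _ (by omega)
  · rintro f hf s₁ ⟨hF, h1, h2, h3, h4, h5⟩
    have hpw : 2 ^ (3 * n + (f + 1) * e) / 2 ^ e = 2 ^ (3 * n + f * e) := by
      rw [Nat.pow_div (by nlinarith) (by norm_num)]
      congr 1
      rw [add_mul]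
      omega
    have hE : s₁.var .powE = 2 ^ e := by rw [hF.1 _ (by decide), hp.powE, he]
    have hLv : s₁.var .inputLen = L := by rw [hF.1 _ (by decide), hp.inputLen]
    refine Runs.seq (Q' := fun s' => s' = (s₁.set .fam f).set .powF (2 ^ (3 * n + f * e)))
      (.set (by simp) (by simp [hE, h3, hpw])) ?_
    rintro _ rfl
    have hsz : s₁.cell (f + 1) = (F f).length := by rw [h2 _ (by omega), hs.size f hf]
    have hflen : ∑ f' ∈ Finset.range (f + 1), (F f').length ≤
        ∑ f' ∈ Finset.range 3, (F f').length :=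
      Finset.sum_le_sum_of_subset (Finset.range_subset_range.2 hf)
    rw [Finset.sum_range_succ] at hflen
    refine Runs.seq (Q' := fun s' => s' = ((s₁.set .fam f).set .powF (2 ^ (3 * n + f * e))).set
      .size (F f).length) (.set (by simp; omega) (by simp [hsz])) ?_
    rintro _ rfl
    refine Runs.seq (Q' := fun s' => s' = (((s₁.set .fam f).set .powF (2 ^ (3 * n + f * e))).set
      .size (F f).length).set .off (4 + ∑ f' ∈ Finset.range f, (F f').length))
      (.set (by simp) ?_) ?_
    · simp [h4, Finset.sum_range_succ, ← add_assoc]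
    rintro s₂ hs₂
    have hF₂ : Frame [.off, .powF, .fam, .size, .loopInput] [.table] s s₂ := by
      rw [hs₂]
      exact (((hF.set (by decide)).set (by decide)).set (by decide)).set (by decide)
    have c1 : s₂.var .size = (F f).length := by simp [hs₂]
    have c2 : s₂.var .off = 4 + ∑ f' ∈ Finset.range f, (F f').length := by simp [hs₂]
    have c3 : s₂.var .fam = f := by simp [hs₂]
    have c4 : s₂.var .powF = 2 ^ (3 * n + f * e) := by simp [hs₂]
    have c5 : s₂.cell = s₁.cell := by simp [hs₂]
    have c6 : s₂.coins = s₁.coins := by simp [hs₂]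
    have c7 : s₂.arr = s₁.arr := by simp [hs₂]
    have c8 : s₂.var .powE = 2 ^ e := by simp [hs₂, hE]
    have c9 : s₂.var .inputLen = L := by simp [hs₂, hLv]
    clear hs₂
    refine (runs_readFamily hg'.table (by rw [hx]; nlinarith) hf (hβ f hf) c1 c2 c3 c4 c8 c9
      (by omega) (fun i hi => ?_) (hs.lt f hf) fun y => ?_).mono ?_
    · rw [c5, h2 _ (by omega), hs.entry f hf i hi]
    · rw [c7, h5 f hf, if_neg (by omega)]
    · rintro s' ⟨hF₃, d1, d2, d3⟩
      refine ⟨hF₂.trans (hF₃.mono (by decide) (by decide)), by rw [d1, c6, h1],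
        fun c hc => by rw [d2 c hc, c5, h2 c hc], ?_, ?_, fun f' hf' y => ?_⟩
      · rw [hF₃.1 _ (by decide), c4]
      · rw [hF₃.1 _ (by decide), c2]
      · rw [d3 f' hf' y, c7, h5 f' hf']
        by_cases hff : f' = f
        · rw [if_pos hff, if_pos hff.ge, tableOf, hff]
        · rw [if_neg hff]
          refine if_congr ?_ rfl rfl
          omega
  · rintro s' ⟨hF, h1, h2, h3, h4, h5⟩
    refine ⟨⟨?_, ?_, ?_, ?_, ?_, ?_, ?_, ?_⟩, h1, ?_, fun f hf y => by simpa using h5 f hf y⟩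
    · rw [hF.1 _ (by decide), hp.blocks]
    · rw [hF.1 _ (by decide), hp.points]
    · rw [hF.1 _ (by decide), hp.inputLen]
    · rw [hF.1 _ (by decide), hp.numIdx]
    · rw [hF.1 _ (by decide), hp.numRank]
    · rw [hF.1 _ (by decide), hp.powX]
    · rw [hF.1 _ (by decide), hp.powE]
    · rw [hF.1 _ (by decide), hp.trials]
    · rw [hF.1 _ (by decide)]

/-- The number of coin tosses in a trial. -/
def trialCoins (g : Gadget) (m : ℕ) : ℕ := 3 * g.K * m * (3 * g.K * m) + 3 * g.N ^ m

/-- The result of a trial that uses the coin tosses at the beginning of a list. -/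
def trialOf (g : Gadget) (m : ℕ) (D : ℕ → ℕ → ℕ) (c : List Bool) : ZMod g.p :=
  g.trialVal m (ofBits (c.take (3 * g.K * m * (3 * g.K * m)))) D fun f =>
    (c.drop (3 * g.K * m * (3 * g.K * m) + (2 - f) * g.N ^ m)).take (g.N ^ m)

/-- The results are added as natural numbers below `p`, without reduction, so different trials
cannot cancel each other. -/
theorem runs_trials (hg : g.Fits m L M w β) {D : ℕ → ℕ → ℕ} (hD : ∀ f y, D f y ≤ 1) {s : Store}
    (hs : g.Ready m L D s) (hM : s.var .trials = M) (hβ : M ≤ β .loopTrial)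
    (hc : M * g.trialCoins m ≤ s.coins.length) (hres : s.var .res = 0) :
    Runs w β (.loop .loopTrial (.var .trials) g.trial) s fun s' =>
      (s'.var .res ≠ 0 ↔ ∃ t < M, g.trialOf m D (s.coins.drop (t * g.trialCoins m)) ≠ 0) := by
  refine Runs.loop (n := M) (fun k s' => g.Ready m L D s' ∧
      s'.coins = s.coins.drop ((M - k) * g.trialCoins m) ∧ s'.var .res ≤ (M - k) * g.p ∧
      (s'.var .res ≠ 0 ↔ ∃ t < M - k, g.trialOf m D (s.coins.drop (t * g.trialCoins m)) ≠ 0))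
    (by simp) (by simp [hM]) hβ ⟨hs, by simp, by simp [hres], by simp [hres]⟩ ?_
    fun s' h => by simpa using h.2.2.2
  rintro k hk s' ⟨h1, h2, h3, h4⟩
  set b := 3 * g.K * m * (3 * g.K * m) with hb
  set A := g.N ^ m with hA
  have htc : g.trialCoins m = b + 3 * A := rfl
  have hMk : M - k = M - (k + 1) + 1 := by omega
  have hlen : g.trialCoins m ≤ s'.coins.length := by
    rw [h2, List.length_drop]
    have : (M - k) * g.trialCoins m ≤ M * g.trialCoins m := Nat.mul_le_mul_right _ (by omega)
    rw [hMk, add_mul] at this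
    omega
  have hMp : (M - (k + 1)) * g.p + g.p ≤ M * g.p := by
    have : (M - (k + 1) + 1) * g.p ≤ M * g.p := Nat.mul_le_mul_right _ (by omega)
    rwa [add_mul, one_mul] at this
  have hres' := hg.res
  set c := s'.coins with hc'
  refine (runs_trial hg hD (s := s'.set .loopTrial k) (lu := c.take b)
    (l := fun f => (c.drop (b + (2 - f) * A)).take A) (l' := c.drop (g.trialCoins m))
    (h1.frame (Frame.refl.set (by decide))) (by simp; omega) (fun f hf => ?_) ?_
    (by simp; omega)).mono ?_
  · simp only [List.length_take, List.length_drop]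
    have : (2 - f) * A ≤ 2 * A := Nat.mul_le_mul_right _ (by omega)
    omega
  · simp only [Store.set_coins, ← hc', famCoins, htc]
    have e1 : ∀ i, c.drop i = (c.drop i).take A ++ c.drop (i + A) := fun i => by
      rw [← List.drop_drop, List.take_append_drop]
    conv_lhs => rw [← List.take_append_drop b c, e1 b, e1 (b + A), e1 (b + A + A)]
    simp only [Nat.sub_self, zero_mul, add_zero, show 2 - 1 = 1 from rfl, one_mul, Nat.sub_zero]
    rw [show b + A + A = b + 2 * A by ring, show b + 2 * A + A = b + 3 * A by ring]
  · rintro s'' ⟨hF, f1, v, hv, f2, f3⟩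
    refine ⟨h1.frame ((Frame.refl.set (by decide)).trans hF), ?_, ?_, ?_⟩
    · rw [f1, h2, List.drop_drop, hMk, add_mul, one_mul]
    · rw [f2, hMk, add_mul, one_mul]
      simp
      omega
    · have e1 : v ≠ 0 ↔ g.trialOf m D (s.coins.drop ((M - (k + 1)) * g.trialCoins m)) ≠ 0 := by
        rw [trialOf, ← h2, ← f3, Ne, Ne, ZMod.natCast_eq_zero_iff]
        exact not_congr ⟨by rintro rfl; simp, fun h => Nat.eq_zero_of_dvd_of_lt h hv⟩
      rw [f2, hMk]
      simp only [Store.set_var, reduceCtorEq, if_false, Ne, Nat.add_eq_zero_iff, not_and_or]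
      rw [← Ne, ← Ne, h4, e1]
      constructor
      · rintro (⟨t, ht, ht'⟩ | h)
        · exact ⟨t, by omega, ht'⟩
        · exact ⟨_, Nat.lt_succ_self _, h⟩
      · rintro ⟨t, ht, ht'⟩
        rcases (Nat.lt_succ_iff.1 ht).lt_or_eq with h | rfl
        · exact Or.inl ⟨t, h, ht'⟩
        · exact Or.inr ht'

/-- The constant tables may overwrite the input. This does no harm, since by then the families are
stored in the array `table`, which is not touched again. -/
theorem runs_algorithm {n : ℕ} (hm : m = (n + (g.K - 1)) / g.K)
    (hM : M = 32 * ((27 ^ g.K) ^ m / g.G ^ m + 1))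
    (hg : g.Fits m L M w β) (hg' : g.FitsSetup n m L w β) {F : ℕ → List ℕ} {s : Store}
    (hs : IsInput n L F s.cell) (hβ : ∀ f < 3, (F f).length ≤ β .loopInput)
    (hβ' : M ≤ β .loopTrial) (hc : M * g.trialCoins m ≤ s.coins.length) (hres : s.var .res = 0) :
    Runs w β g.algorithm s fun s' => (s'.var .res ≠ 0 ↔ ∃ t < M,
      g.trialOf m (tableOf n (g.K * m - n) F) (s.coins.drop (t * g.trialCoins m)) ≠ 0) := by
  have hK := g.K_pos
  have hN := g.N_pos
  have w1 := hg.mod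
  have w2 := hg.elt
  have hn : n ≤ g.K * m := by
    have h1 := Nat.div_add_mod (n + (g.K - 1)) g.K
    have h2 := Nat.mod_lt (n + (g.K - 1)) hK
    rw [← hm] at h1
    omega
  refine (runs_params hg hm hg' hs).seq ?_
  rintro s₁ ⟨h1, h2, h3, h4⟩
  refine (runs_readInput hg rfl hn hg' (by rw [h2]; exact hs) h1 hβ).seq ?_
  rintro s₂ ⟨p1, p2, p3, p4⟩
  refine (runs_writeTable hg.pos fun i _ => ?_).seq ?_
  · exact (g.pos_lt _ _).trans w2
  rintro s₃ ⟨q1, q2, q3⟩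
  refine (runs_writeTable hg.coef fun i _ => ?_).seq ?_
  · exact (g.coef_lt _ _ _).trans (by omega)
  rintro s₄ ⟨r1, r2, r3⟩
  have hv : ∀ v : Var, v ≠ .tmp → s₄.var v = s₂.var v := fun v hv => by
    rw [r1.1 _ (by simpa using hv), q1.1 _ (by simpa using hv)]
  have hready : g.Ready m L (tableOf n (g.K * m - n) F) s₄ := by
    refine ⟨?_, ?_, ?_, ?_, ?_, ?_, ?_, ?_, ?_⟩
    · rw [hv _ (by decide), p1.blocks]
    · rw [hv _ (by decide), p1.points]
    · rw [hv _ (by decide), p1.inputLen]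
    · rw [hv _ (by decide), p1.numIdx]
    · rw [hv _ (by decide), p1.numRank]
    · rw [hv _ (by decide), p1.powX]
    · rw [r1.2 _ (by decide), q1.2 _ (by decide)]
      exact p4
    · intro a ha i hi
      rw [r1.2 _ (by decide), q3 _ (mul_add_lt_mul ha hi), posTable]
      congr 1
      · rw [mul_comm, Nat.mul_add_div hK, Nat.div_eq_of_lt hi, add_zero]
      · rw [mul_comm, Nat.mul_add_mod, Nat.mod_eq_of_lt hi]
    · intro f hf l hl a ha
      rw [r3 _ (mul_add_lt_mul (mul_add_lt_mul hf hl) ha), coefTable]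
      have e1 : ((f * g.R + l) * g.N + a) / g.N = f * g.R + l := by
        rw [mul_comm, Nat.mul_add_div hN, Nat.div_eq_of_lt ha, add_zero]
      have e2 : ((f * g.R + l) * g.N + a) % g.N = a := by
        rw [mul_comm, Nat.mul_add_mod, Nat.mod_eq_of_lt ha]
      rw [e1, e2]
      congr 1
      · rw [mul_comm, Nat.mul_add_div (by omega), Nat.div_eq_of_lt hl, add_zero]
      · rw [mul_comm, Nat.mul_add_mod, Nat.mod_eq_of_lt hl]
  have hcoins : s₄.coins = s.coins := by rw [r2, q2, p2, h3]
  have := runs_trials hg (tableOf_le n _ F) hready (by rw [hv _ (by decide), p1.trials, hM]) hβ'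
    (by rwa [hcoins]) (by rw [hv _ (by decide), p3, h4, hres])
  rwa [hcoins] at this

end Gadget

/-! ### Correctness of Yates' algorithm -/

theorem Finset.sum_range_mul_eq {A : Type*} [AddCommMonoid A] (m n : ℕ) (f : ℕ → A) :
    ∑ i ∈ Finset.range (m * n), f i =
      ∑ a ∈ Finset.range m, ∑ b ∈ Finset.range n, f (a * n + b) := by
  induction m with
  | zero => simp
  | succ m ih => rw [add_mul, one_mul, Finset.sum_range_add, ih, Finset.sum_range_succ]

namespace Gadget

variable (g : Gadget)

/-- The tensor with the given rank decomposition. -/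
def tensor (a b c : ℕ) : ZMod g.p :=
  ∑ l ∈ Finset.range g.R, (g.coef 0 l a : ZMod g.p) * g.coef 1 l b * g.coef 2 l c

/-- The Kronecker power of the tensor, the indices being written to base `N`. -/
def tensorPow (h a b c : ℕ) : ZMod g.p :=
  ∏ t ∈ Finset.range h, g.tensor (a / g.N ^ t % g.N) (b / g.N ^ t % g.N) (c / g.N ^ t % g.N)

/-- The sum of `Q` copies, on disjoint sets of variables, of the `h`-th Kronecker power. -/
def form (h Q : ℕ) (v : ℕ → ℕ → ZMod g.p) : ZMod g.p :=
  ∑ q ∈ Finset.range Q, ∑ a ∈ Finset.range (g.N ^ h), ∑ b ∈ Finset.range (g.N ^ h),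
    ∑ c ∈ Finset.range (g.N ^ h), g.tensorPow h a b c *
      (v 0 (q * g.N ^ h + a) * v 1 (q * g.N ^ h + b) * v 2 (q * g.N ^ h + c))

variable {g}

theorem tensorPow_succ {h a b c a' b' c' : ℕ} (ha : a' < g.N) (hb : b' < g.N) (hc : c' < g.N) :
    g.tensorPow (h + 1) (a * g.N + a') (b * g.N + b') (c * g.N + c') =
      g.tensorPow h a b c * g.tensor a' b' c' := by
  have e1 : ∀ x x' : ℕ, x' < g.N → (x * g.N + x') % g.N = x' := fun x x' hx => by
    rw [mul_comm, Nat.mul_add_mod, Nat.mod_eq_of_lt hx]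
  have e2 : ∀ x x' t : ℕ, x' < g.N → (x * g.N + x') / g.N ^ (t + 1) = x / g.N ^ t :=
    fun x x' t hx => by
      rw [pow_succ', ← Nat.div_div_eq_div_mul, mul_comm, Nat.mul_add_div (by omega),
        Nat.div_eq_of_lt hx, add_zero]
  rw [tensorPow, Finset.prod_range_succ', tensorPow]
  simp only [pow_zero, Nat.div_one, e1 _ _ ha, e1 _ _ hb, e1 _ _ hc, e2 _ _ _ ha, e2 _ _ _ hb,
    e2 _ _ _ hc]

/-- In the last coordinate the tensor is replaced by its rank decomposition, which turns it into `R`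
products of one linear form per family. The step of Yates' algorithm evaluates these linear forms,
and the summation index of the decomposition joins the index of the copies. The value of the form
does not change. -/
theorem form_yatesStep (h Q : ℕ) (v : ℕ → ℕ → ZMod g.p) :
    g.form h (g.R * Q) (fun f => g.yatesStep f (Q * g.N ^ h) (v f)) = g.form (h + 1) Q v := by
  have hN := g.N_pos
  rw [form, Finset.sum_range_mul_eq, Finset.sum_comm, form]
  refine Finset.sum_congr rfl fun q hq => ?_
  rw [Finset.mem_range] at hq
  have step : ∀ l < g.R, ∀ a < g.N ^ h, ∀ f, g.yatesStep f (Q * g.N ^ h) (v f)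
      ((l * Q + q) * g.N ^ h + a) = ∑ s ∈ Finset.range g.N, (g.coef f l s : ZMod g.p) *
        v f ((q * g.N ^ h + a) * g.N + s) := by
    intro l _ a ha f
    have h1 : q * g.N ^ h + a < Q * g.N ^ h := mul_add_lt_mul hq ha
    have h2 : (l * Q + q) * g.N ^ h + a = Q * g.N ^ h * l + (q * g.N ^ h + a) := by ring
    rw [yatesStep, h2, Nat.mul_add_div (by omega), Nat.div_eq_of_lt h1, add_zero,
      Nat.mul_add_mod, Nat.mod_eq_of_lt h1]
  -- The decomposition in a single coordinate: summing the products of the three transformed values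
  -- over `l` contracts the tensor with the three vectors.
  have inner : ∀ x y z : ℕ, ∑ l ∈ Finset.range g.R,
      (∑ s ∈ Finset.range g.N, (g.coef 0 l s : ZMod g.p) * v 0 (x * g.N + s)) *
      (∑ s ∈ Finset.range g.N, (g.coef 1 l s : ZMod g.p) * v 1 (y * g.N + s)) *
      (∑ s ∈ Finset.range g.N, (g.coef 2 l s : ZMod g.p) * v 2 (z * g.N + s)) =
      ∑ s ∈ Finset.range g.N, ∑ t ∈ Finset.range g.N, ∑ u ∈ Finset.range g.N,
        g.tensor s t u * (v 0 (x * g.N + s) * v 1 (y * g.N + t) * v 2 (z * g.N + u)) := by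
    intro x y z
    have expand : ∀ A B C : ℕ → ZMod g.p, (∑ s ∈ Finset.range g.N, A s) *
        (∑ s ∈ Finset.range g.N, B s) * (∑ s ∈ Finset.range g.N, C s) =
        ∑ s ∈ Finset.range g.N, ∑ t ∈ Finset.range g.N, ∑ u ∈ Finset.range g.N,
          A s * B t * C u := by
      intro A B C
      rw [Finset.sum_mul_sum, Finset.sum_mul]
      refine Finset.sum_congr rfl fun s _ => ?_
      rw [Finset.sum_mul]
      exact Finset.sum_congr rfl fun t _ => Finset.mul_sum _ _ _
    simp only [expand]
    rw [Finset.sum_comm]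
    refine Finset.sum_congr rfl fun s _ => ?_
    rw [Finset.sum_comm]
    refine Finset.sum_congr rfl fun t _ => ?_
    rw [Finset.sum_comm]
    refine Finset.sum_congr rfl fun u _ => ?_
    rw [tensor, Finset.sum_mul]
    refine Finset.sum_congr rfl fun l _ => ?_
    ring
  calc ∑ l ∈ Finset.range g.R, ∑ a ∈ Finset.range (g.N ^ h), ∑ b ∈ Finset.range (g.N ^ h),
        ∑ c ∈ Finset.range (g.N ^ h), g.tensorPow h a b c *
          (g.yatesStep 0 (Q * g.N ^ h) (v 0) ((l * Q + q) * g.N ^ h + a) *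
            g.yatesStep 1 (Q * g.N ^ h) (v 1) ((l * Q + q) * g.N ^ h + b) *
            g.yatesStep 2 (Q * g.N ^ h) (v 2) ((l * Q + q) * g.N ^ h + c))
      = ∑ a ∈ Finset.range (g.N ^ h), ∑ b ∈ Finset.range (g.N ^ h), ∑ c ∈ Finset.range (g.N ^ h),
          g.tensorPow h a b c * ∑ s ∈ Finset.range g.N, ∑ t ∈ Finset.range g.N,
            ∑ u ∈ Finset.range g.N, g.tensor s t u * (v 0 ((q * g.N ^ h + a) * g.N + s) *
              v 1 ((q * g.N ^ h + b) * g.N + t) * v 2 ((q * g.N ^ h + c) * g.N + u)) := by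
        rw [Finset.sum_comm]
        refine Finset.sum_congr rfl fun a ha => ?_
        rw [Finset.sum_comm]
        refine Finset.sum_congr rfl fun b hb => ?_
        rw [Finset.sum_comm]
        refine Finset.sum_congr rfl fun c hc => ?_
        rw [← Finset.mul_sum, ← inner]
        congr 1
        refine Finset.sum_congr rfl fun l hl => ?_
        rw [Finset.mem_range] at ha hb hc hl
        rw [step l hl a ha, step l hl b hb, step l hl c hc]
    _ = ∑ a ∈ Finset.range (g.N ^ h), ∑ b ∈ Finset.range (g.N ^ h), ∑ c ∈ Finset.range (g.N ^ h),
          ∑ s ∈ Finset.range g.N, ∑ t ∈ Finset.range g.N, ∑ u ∈ Finset.range g.N,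
            g.tensorPow (h + 1) (a * g.N + s) (b * g.N + t) (c * g.N + u) *
              (v 0 (q * g.N ^ (h + 1) + (a * g.N + s)) * v 1 (q * g.N ^ (h + 1) + (b * g.N + t)) *
                v 2 (q * g.N ^ (h + 1) + (c * g.N + u))) := by
        refine Finset.sum_congr rfl fun a _ => Finset.sum_congr rfl fun b _ =>
          Finset.sum_congr rfl fun c _ => ?_
        simp only [Finset.mul_sum]
        refine Finset.sum_congr rfl fun s hs => Finset.sum_congr rfl fun t ht =>
          Finset.sum_congr rfl fun u hu => ?_
        rw [Finset.mem_range] at hs ht hu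
        have e : ∀ x s, q * g.N ^ (h + 1) + (x * g.N + s) = (q * g.N ^ h + x) * g.N + s :=
          fun x s => by ring
        rw [tensorPow_succ hs ht hu, e, e, e]
        ring
    _ = _ := by
        -- Only the order of summation differs from here on: `a b c s t u` against `a s b t c u`.
        simp only [pow_succ, Finset.sum_range_mul_eq]
        refine Finset.sum_congr rfl fun a _ => ?_
        trans ∑ b ∈ Finset.range (g.N ^ h), ∑ s ∈ Finset.range g.N,
          ∑ c ∈ Finset.range (g.N ^ h), ∑ t ∈ Finset.range g.N, ∑ u ∈ Finset.range g.N,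
            g.tensorPow (h + 1) (a * g.N + s) (b * g.N + t) (c * g.N + u) *
              (v 0 (q * (g.N ^ h * g.N) + (a * g.N + s)) *
                v 1 (q * (g.N ^ h * g.N) + (b * g.N + t)) *
                v 2 (q * (g.N ^ h * g.N) + (c * g.N + u)))
        · refine Finset.sum_congr rfl fun b _ => ?_
          rw [Finset.sum_comm]
        rw [Finset.sum_comm]
        refine Finset.sum_congr rfl fun s _ => Finset.sum_congr rfl fun b _ => ?_
        rw [Finset.sum_comm]

/-- At `k = 0` this is one copy of the full trilinear form, at `k = m` it is `R ^ m` copies of the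
product of three scalars, which is what a trial adds up. -/
theorem form_yatesIter {m k : ℕ} (hk : k ≤ m) (v : ℕ → ℕ → ZMod g.p) :
    g.form (m - k) (g.R ^ k) (fun f => g.yatesIter f m (v f) k) = g.form m 1 v := by
  induction k with
  | zero => simp [yatesIter]
  | succ k ih =>
    rw [← ih (by omega), show m - k = m - (k + 1) + 1 by omega, ← form_yatesStep,
      show m - (k + 1) = m - 1 - k by omega, pow_succ' g.R k]
    rfl

/-- The result of a trial as the value of a trilinear form. -/
theorem trialVal_eq (m u : ℕ) (D : ℕ → ℕ → ℕ) (l : ℕ → List Bool) :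
    g.trialVal m u D l = ∑ a ∈ Finset.range (g.N ^ m), ∑ b ∈ Finset.range (g.N ^ m),
      ∑ c ∈ Finset.range (g.N ^ m), g.tensorPow m a b c *
        (g.startVec m u (D 0) (l 0) a * g.startVec m u (D 1) (l 1) b *
          g.startVec m u (D 2) (l 2) c) := by
  have := form_yatesIter (g := g) (le_refl m) fun f j => (g.startVec m u (D f) (l f) j : ZMod g.p)
  simp only [form, Nat.sub_self, pow_zero, Finset.sum_range_one, mul_one, add_zero, zero_mul,
    zero_add, tensorPow, Finset.prod_range_zero, one_mul] at this
  rw [trialVal]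
  simpa [tensorPow, Finset.prod_range_succ] using this

end Gadget

/-! ### Fair coin tosses -/

open Classical in
/-- The probability of an event for `n` fair coin tosses. -/
noncomputable def coinProb : ℕ → (List Bool → Prop) → ℝ
  | 0, E => if E [] then 1 else 0
  | n + 1, E => (coinProb n (fun l => E (false :: l)) + coinProb n (fun l => E (true :: l))) / 2

namespace coinProb

theorem mono {n : ℕ} {A B : List Bool → Prop} (h : ∀ l, l.length = n → A l → B l) :
    coinProb n A ≤ coinProb n B := by
  induction n generalizing A B with
  | zero =>
    have := h [] rfl
    simp only [coinProb]
    split_ifs <;> simp_all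
  | succ n ih =>
    have h1 := ih (A := fun l => A (false :: l)) (B := fun l => B (false :: l))
      fun l hl => h _ (by simp [hl])
    have h2 := ih (A := fun l => A (true :: l)) (B := fun l => B (true :: l))
      fun l hl => h _ (by simp [hl])
    simp only [coinProb]
    linarith

theorem congr {n : ℕ} {A B : List Bool → Prop} (h : ∀ l, l.length = n → (A l ↔ B l)) :
    coinProb n A = coinProb n B :=
  le_antisymm (mono fun l hl => (h l hl).1) (mono fun l hl => (h l hl).2)

theorem const (n : ℕ) (P : Prop) [Decidable P] : coinProb n (fun _ => P) = if P then 1 else 0 := by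
  induction n with
  | zero => simp [coinProb]
  | succ n ih => simp only [coinProb, ih]; ring

theorem nonneg (n : ℕ) (A : List Bool → Prop) : 0 ≤ coinProb n A := by
  have := const n False
  rw [if_neg id] at this
  rw [← this]
  exact mono fun _ _ h => h.elim

theorem le_one (n : ℕ) (A : List Bool → Prop) : coinProb n A ≤ 1 := by
  have := const n True
  rw [if_pos trivial] at this
  rw [← this]
  exact mono fun _ _ _ => trivial

theorem eq_one {n : ℕ} {A : List Bool → Prop} (h : ∀ l, l.length = n → A l) :
    coinProb n A = 1 := by
  have := const n True
  rw [if_pos trivial] at this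
  rw [← this]
  exact congr fun l hl => ⟨fun _ => trivial, fun _ => h l hl⟩

theorem not (n : ℕ) (A : List Bool → Prop) : coinProb n (fun l => ¬ A l) = 1 - coinProb n A := by
  induction n generalizing A with
  | zero =>
    simp only [coinProb]
    split_ifs <;> simp_all
  | succ n ih =>
    simp only [coinProb]
    rw [ih fun l => A (false :: l), ih fun l => A (true :: l)]
    ring

/-- A lower bound for a two-stage experiment. -/
theorem mul_le_add {a b : ℕ} {A E : List Bool → Prop} {q : ℝ}
    (h : ∀ l, l.length = a → A l → q ≤ coinProb b fun l' => E (l ++ l')) :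
    q * coinProb a A ≤ coinProb (a + b) E := by
  induction a generalizing A E with
  | zero =>
    simp only [coinProb, Nat.zero_add]
    split_ifs with hA
    · simpa using h [] rfl hA
    · simpa using nonneg b E
  | succ a ih =>
    have h1 := ih (A := fun l => A (false :: l)) (E := fun l => E (false :: l))
      fun l hl => h (false :: l) (by simp [hl])
    have h2 := ih (A := fun l => A (true :: l)) (E := fun l => E (true :: l))
      fun l hl => h (true :: l) (by simp [hl])
    rw [show a + 1 + b = a + b + 1 by ring]
    simp only [coinProb]
    linarith

/-- Events that depend on different coin tosses are independent. -/
theorem and (a b : ℕ) (A B : List Bool → Prop) :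
    coinProb (a + b) (fun l => A (l.take a) ∧ B (l.drop a)) = coinProb a A * coinProb b B := by
  induction a generalizing A with
  | zero =>
    simp only [coinProb, Nat.zero_add, List.take_zero, List.drop_zero]
    split_ifs with hA
    · simp [hA]
    · simp [hA, const b False]
  | succ a ih =>
    rw [show a + 1 + b = a + b + 1 by ring]
    simp only [coinProb, List.take_succ_cons, List.drop_succ_cons]
    rw [ih fun l => A (false :: l), ih fun l => A (true :: l)]
    ring

/-- The probability that all independent repetitions of an experiment fail. -/
theorem forall_not_le {c : ℕ} {Q : List Bool → Prop} {q : ℝ} (hQ : ∀ l, Q l ↔ Q (l.take c))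
    (hq : q ≤ coinProb c Q) (M e : ℕ) :
    coinProb (M * c + e) (fun l => ∀ t < M, ¬ Q (l.drop (t * c))) ≤ (1 - q) ^ M := by
  induction M with
  | zero => simpa using le_one _ _
  | succ M ih =>
    have h := and c (M * c + e) (fun l => ¬ Q l) fun l => ∀ t < M, ¬ Q (l.drop (t * c))
    rw [not] at h
    have e1 : (M + 1) * c + e = c + (M * c + e) := by ring
    rw [e1, pow_succ', congr (B := fun l => ¬ Q (l.take c) ∧ ∀ t < M, ¬ Q ((l.drop c).drop (t * c))),
      h]
    · have h1 := le_one c Q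
      exact mul_le_mul (by linarith) ih (nonneg _ _) (by linarith)
    · intro l _
      simp only [List.drop_drop]
      constructor
      · intro hl
        refine ⟨(hQ _).not.1 (by simpa using hl 0 (by omega)), fun t ht => ?_⟩
        have := hl (t + 1) (by omega)
        rwa [show c + t * c = (t + 1) * c by ring]
      · rintro ⟨h0, hl⟩ t ht
        rcases t with _ | t
        · simpa using (hQ _).not.2 h0
        · rw [show (t + 1) * c = c + t * c by ring]
          exact hl t (by omega)

theorem ofBits_eq (b : ℕ) (E : ℕ → Prop) [DecidablePred E] :
    coinProb b (fun l => E (ofBits l)) = (((Finset.range (2 ^ b)).filter E).card : ℝ) / 2 ^ b := by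
  induction b generalizing E with
  | zero =>
    simp only [coinProb, ofBits, pow_zero, Finset.range_one, div_one]
    by_cases h : E 0 <;> simp [h, Finset.filter_singleton]
  | succ b ih =>
    have h1 : coinProb b (fun l => E (ofBits (false :: l))) = coinProb b fun l => E (ofBits l) := by
      simp [ofBits]
    have h2 : coinProb b (fun l => E (ofBits (true :: l))) =
        coinProb b fun l => E (2 ^ b + ofBits l) :=
      congr fun l hl => by simp [ofBits, hl]
    simp only [coinProb]
    rw [h1, h2, ih E, ih fun u => E (2 ^ b + u)]
    have h3 : ((Finset.range (2 ^ (b + 1))).filter E).card = ((Finset.range (2 ^ b)).filter E).card +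
        ((Finset.range (2 ^ b)).filter fun u => E (2 ^ b + u)).card := by
      simp only [Finset.card_filter]
      rw [pow_succ, mul_two, Finset.sum_range_add]
    rw [h3]
    push_cast
    field_simp
    ring

/-- Links the counting definition of `acceptProb` to the recursive `coinProb`, for which
conditioning on the first tosses is immediate. The outcomes are split by the first toss. -/
theorem card_div_eq (t : ℕ) (E : List Bool → Prop) :
    (Nat.card {ω : Fin t → Bool // E (List.ofFn ω)} : ℝ) / 2 ^ t = coinProb t E := by
  classical
  induction t generalizing E with
  | zero =>
    simp only [coinProb, Nat.card_eq_fintype_card, Fintype.card_subtype, List.ofFn_zero]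
    split_ifs with h <;> simp [h]
  | succ t ih =>
    have e : {ω : Fin (t + 1) → Bool // E (List.ofFn ω)} ≃
        {ω : Fin t → Bool // E (false :: List.ofFn ω)} ⊕
          {ω : Fin t → Bool // E (true :: List.ofFn ω)} :=
      { toFun := fun ω => if h : ω.1 0 = false
          then .inl ⟨fun i => ω.1 i.succ, by have := ω.2; rwa [List.ofFn_succ, h] at this⟩
          else .inr ⟨fun i => ω.1 i.succ, by
            have := ω.2; rwa [List.ofFn_succ, Bool.eq_true_of_not_eq_false h] at this⟩
        invFun := fun s => s.elim (fun ω => ⟨Fin.cons false ω.1, by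
            rw [List.ofFn_succ]; simpa using ω.2⟩)
          (fun ω => ⟨Fin.cons true ω.1, by rw [List.ofFn_succ]; simpa using ω.2⟩)
        left_inv := by
          rintro ⟨ω, hω⟩
          refine Subtype.ext (funext fun i => ?_)
          by_cases h : ω 0 = false
          · simp only [h, dite_true, Sum.elim_inl]
            exact Fin.cases (by simp [h]) (by simp) i
          · simp only [h]
            exact Fin.cases (by simpa using h) (by simp) i
        right_inv := by rintro (ω | ω) <;> simp }
    rw [Nat.card_congr e, Nat.card_sum]
    simp only [coinProb]
    rw [← ih, ← ih]
    push_cast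
    field_simp
    ring

theorem acceptProb_eq (P : RAMProg) (input : List ℕ) (t : ℕ) {E : List Bool → Prop}
    (h : ∀ ω : Fin t → Bool, RAMAccepts P input ω ↔ E (List.ofFn ω)) :
    acceptProb P input t = coinProb t E := by
  rw [← card_div_eq, acceptProb]
  simp only [h]

theorem weight_cons_self (b : Bool) (l : List Bool) : weight (b :: l) l.length = b.toNat := by
  simp [weight]

theorem weight_cons_of_lt {b : Bool} {l : List Bool} {i : ℕ} (hi : i < l.length) :
    weight (b :: l) i = weight l i := by
  have : (b :: l).length - 1 - i = (l.length - 1 - i) + 1 := by simp; omega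
  rw [weight, weight, this, List.getD_cons_succ]

/-- A nonzero affine linear form does not vanish with probability at least `1/2`. -/
theorem linear {A : Type*} [AddCommGroup A] {n i : ℕ} (c : ℕ → A) (a : A) (hi : i < n)
    (hc : c i ≠ 0) :
    1 / 2 ≤ coinProb n fun l => a + ∑ i ∈ Finset.range n, weight l i • c i ≠ 0 := by
  induction n generalizing a i with
  | zero => omega
  | succ n ih =>
    have key : ∀ b : Bool, coinProb n (fun l => a + ∑ i ∈ Finset.range (n + 1),
        weight (b :: l) i • c i ≠ 0) =
        coinProb n fun l => (a + b.toNat • c n) + ∑ i ∈ Finset.range n, weight l i • c i ≠ 0 := by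
      intro b
      refine congr fun l hl => ?_
      rw [Finset.sum_range_succ, ← hl, weight_cons_self, Finset.sum_congr rfl fun i hi => by
        rw [weight_cons_of_lt (Finset.mem_range.1 hi)]]
      rw [add_comm (∑ i ∈ _, _), add_assoc]
    simp only [coinProb]
    rw [key, key]
    -- The first toss is the coefficient of `c n`. If another `c i` is nonzero, the claim holds for
    -- both values of this toss by induction. Otherwise the form is `a` or `a + c n`, and these are
    -- not both zero.
    by_cases h : ∃ i < n, c i ≠ 0
    · obtain ⟨j, hj, hcj⟩ := h
      have h1 := ih (a + false.toNat • c n) hj hcj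
      have h2 := ih (a + true.toNat • c n) hj hcj
      linarith
    · push Not at h
      obtain rfl : i = n := by
        by_contra hne
        exact hc (h i (by omega))
      have h0 : ∀ l, ∑ j ∈ Finset.range i, weight l j • c j = 0 := fun l =>
        Finset.sum_eq_zero fun j hj => by rw [h j (Finset.mem_range.1 hj), smul_zero]
      simp only [h0, add_zero]
      have n1 := nonneg i fun _ => a + false.toNat • c i ≠ 0
      have n2 := nonneg i fun _ => a + true.toNat • c i ≠ 0
      by_cases ha : a = 0
      · have := eq_one (n := i) (A := fun _ => a + true.toNat • c i ≠ 0) fun l _ => by simpa [ha]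
        linarith
      · have := eq_one (n := i) (A := fun _ => a + false.toNat • c i ≠ 0) fun l _ => by simpa
        linarith

/-- A nonzero trilinear form does not vanish with probability at least `1/8`. -/
theorem trilinear {A : Type*} [CommRing A] {n a b c : ℕ} (W : ℕ → ℕ → ℕ → A) (ha : a < n)
    (hb : b < n) (hc : c < n) (h : W a b c ≠ 0) :
    1 / 8 ≤ coinProb (n + (n + n)) fun l => ∑ a ∈ Finset.range n, ∑ b ∈ Finset.range n,
      ∑ c ∈ Finset.range n, W a b c * (weight ((l.drop (2 * n)).take n) a *
        weight ((l.drop n).take n) b * weight (l.take n) c) ≠ 0 := by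
  have h1 := linear (W a b) 0 hc h
  -- The tosses come in the order of the third, second and first argument. Fixing them in turn
  -- leaves a nonzero bilinear form, a nonzero linear form and a nonzero value, each with
  -- conditional probability at least `1/2`.
  have h2 := mul_le_add (b := n + n) (q := 1 / 4)
    (A := fun l => 0 + ∑ c ∈ Finset.range n, weight l c • W a b c ≠ 0)
    (E := fun l => ∑ a ∈ Finset.range n, ∑ b ∈ Finset.range n,
      ∑ c ∈ Finset.range n, W a b c * (weight ((l.drop (2 * n)).take n) a *
        weight ((l.drop n).take n) b * weight (l.take n) c) ≠ 0) fun l hl hA => by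
    have h1 := linear (fun b => ∑ c ∈ Finset.range n, weight l c • W a b c) 0 hb
      (by simpa using hA)
    have h2 := mul_le_add (b := n) (q := 1 / 2)
      (A := fun l' => 0 + ∑ b ∈ Finset.range n, weight l' b •
        ∑ c ∈ Finset.range n, weight l c • W a b c ≠ 0)
      (E := fun l' => ∑ a ∈ Finset.range n, ∑ b ∈ Finset.range n,
        ∑ c ∈ Finset.range n, W a b c * (weight (((l ++ l').drop (2 * n)).take n) a *
        weight (((l ++ l').drop n).take n) b * weight ((l ++ l').take n) c) ≠ 0)
      fun l' hl' hA' => by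
      have h1 := linear (fun a => ∑ b ∈ Finset.range n, weight l' b •
        ∑ c ∈ Finset.range n, weight l c • W a b c) 0 ha (by simpa using hA')
      refine h1.trans (mono fun l'' hl'' hA'' => ?_)
      have e1 : (l ++ (l' ++ l'')).take n = l := List.take_left' hl
      have e2 : ((l ++ (l' ++ l'')).drop n).take n = l' := by
        rw [List.drop_left' hl, List.take_left' hl']
      have e3 : ((l ++ (l' ++ l'')).drop (2 * n)).take n = l'' := by
        rw [two_mul, ← List.drop_drop, List.drop_left' hl, List.drop_left' hl',
          ← hl'', List.take_length]
      rw [e1, e2, e3]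
      convert hA'' using 1
      rw [zero_add]
      refine Finset.sum_congr rfl fun a _ => ?_
      rw [Finset.smul_sum]
      refine Finset.sum_congr rfl fun b _ => ?_
      rw [Finset.smul_sum, Finset.smul_sum]
      refine Finset.sum_congr rfl fun c _ => ?_
      simp only [nsmul_eq_mul]
      ring
    linarith
  linarith

end coinProb

/-! ### Random permutations -/

/-- Every permutation of `{0, …, i - 1}` has a number in the factorial number system. -/
theorem exists_shuffle_eq {i : ℕ} {σ : Equiv.Perm ℕ} (hσ : ∀ j, i ≤ j → σ j = j) (q : ℕ) :
    ∃ u, u / i.factorial = q ∧ shuffle i u = σ := by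
  induction i generalizing σ with
  | zero =>
    refine ⟨q, by simp, ?_⟩
    ext j
    simp [shuffle, hσ j (Nat.zero_le _)]
  | succ i ih =>
    have hd : σ i < i + 1 := by
      by_contra h
      have h1 := hσ _ (not_lt.1 h)
      have := σ.injective h1
      omega
    -- Undoing the outermost transposition gives a permutation that fixes `i`. The quotient `q`
    -- stays free: this makes it possible to count the numbers of one permutation.
    obtain ⟨v, hv, hv'⟩ := ih (σ := Equiv.swap i (σ i) * σ) fun j hj => by
      rcases hj.eq_or_lt with rfl | hj
      · simp
      · rw [Equiv.Perm.mul_apply, hσ j hj, Equiv.swap_apply_of_ne_of_ne (by omega) (by omega)]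
    have h1 : (v * (i + 1) + σ i) / (i + 1) = v := by
      rw [mul_comm, Nat.mul_add_div (by omega), Nat.div_eq_of_lt hd, add_zero]
    have h2 : (v * (i + 1) + σ i) % (i + 1) = σ i := by
      rw [mul_comm, Nat.mul_add_mod, Nat.mod_eq_of_lt hd]
    refine ⟨v * (i + 1) + σ i, ?_, ?_⟩
    · rw [Nat.factorial_succ, ← Nat.div_div_eq_div_mul, h1, hv]
    · rw [shuffle, h1, h2, hv', ← mul_assoc, Equiv.swap_mul_self, one_mul]

/-- A permutation of `{0, …, x - 1}` as a permutation of the natural numbers. -/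
def extendPerm {x : ℕ} (τ : Equiv.Perm (Fin x)) : Equiv.Perm ℕ :=
  τ.extendDomain Fin.equivSubtype

theorem extendPerm_apply {x : ℕ} (τ : Equiv.Perm (Fin x)) (i : Fin x) :
    extendPerm τ i = τ i :=
  Equiv.Perm.extendDomain_apply_image τ Fin.equivSubtype i

theorem extendPerm_apply_of_le {x : ℕ} (τ : Equiv.Perm (Fin x)) {j : ℕ} (hj : x ≤ j) :
    extendPerm τ j = j :=
  Equiv.Perm.extendDomain_apply_not_subtype τ Fin.equivSubtype (not_lt.2 hj)

open Classical in
/-- Each permutation is drawn with about the same probability. -/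
theorem card_mul_le_card_shuffle (x b : ℕ) (good : Finset (Equiv.Perm (Fin x))) :
    good.card * (2 ^ b / x.factorial) ≤ ((Finset.range (2 ^ b)).filter fun u =>
      ∃ τ ∈ good, shuffle x u = extendPerm τ).card := by
  -- A permutation has a number `u` with any prescribed value of `u / x!`. The quotients below `2 ^
  -- b / x!` give that many distinct numbers below `2 ^ b`.
  choose u hu hu' using fun (τ : Equiv.Perm (Fin x)) (q : ℕ) =>
    exists_shuffle_eq (i := x) (σ := extendPerm τ) (fun j hj => extendPerm_apply_of_le τ hj) q
  rw [← Finset.card_range (2 ^ b / x.factorial), ← Finset.card_product]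
  refine Finset.card_le_card_of_injOn (fun t => u t.1 t.2) ?_ ?_
  · rintro ⟨τ, q⟩ h
    simp only [Finset.coe_product, Set.mem_prod, Finset.mem_coe, Finset.mem_range] at h
    simp only [Finset.coe_filter, Finset.mem_range, Set.mem_ofPred_eq]
    refine ⟨?_, τ, h.1, hu' τ q⟩
    have h1 : u τ q < (q + 1) * x.factorial := by
      rw [← Nat.div_lt_iff_lt_mul x.factorial_pos, hu]
      omega
    exact h1.trans_le ((Nat.mul_le_mul_right _ h.2).trans (Nat.div_mul_le_self _ _))
  · rintro ⟨τ, q⟩ - ⟨τ', q'⟩ - h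
    simp only at h
    have h1 : q = q' := by rw [← hu τ q, ← hu τ' q', h]
    have h2 : extendPerm τ = extendPerm τ' := by rw [← hu' τ q, ← hu' τ' q', h]
    refine Prod.ext (Equiv.ext fun i => Fin.ext ?_) h1
    rw [← extendPerm_apply, ← extendPerm_apply, h2]

/-- A bound for the number `(3n)! / n!^3` of all balanced tripartitions, the source of the factor
`27`. In the induction the three new factors on the left are at most `3 (n + 1)` each. -/
theorem factorial_three_mul_le (n : ℕ) :
    (3 * n).factorial ≤ 27 ^ n * n.factorial ^ 3 := by
  induction n with
  | zero => simp
  | succ n ih =>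
    rw [show 3 * (n + 1) = 3 * n + 1 + 1 + 1 by ring, Nat.factorial_succ, Nat.factorial_succ,
      Nat.factorial_succ, Nat.factorial_succ n]
    calc (3 * n + 1 + 1 + 1) * ((3 * n + 1 + 1) * ((3 * n + 1) * (3 * n).factorial))
        ≤ (3 * (n + 1)) * ((3 * (n + 1)) * ((3 * (n + 1)) * (27 ^ n * n.factorial ^ 3))) := by
          gcongr <;> omega
      _ = _ := by ring

/-! ### Balanced tripartitions -/

/-- Three sets of size `n` that partition `{0, …, 3 n - 1}`. -/
structure IsTripartition (n : ℕ) (A : Fin 3 → Finset ℕ) : Prop where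
  card : ∀ f, (A f).card = n
  union : A 0 ∪ A 1 ∪ A 2 = Finset.range (3 * n)

/-- The part of an element. -/
def part {x : ℕ} (A : Fin 3 → Finset ℕ) (y : Fin x) : Fin 3 :=
  if (y : ℕ) ∈ A 0 then 0 else if (y : ℕ) ∈ A 1 then 1 else 2

namespace IsTripartition

variable {n : ℕ} {A B : Fin 3 → Finset ℕ}

/-- Three sets of size `n` that cover `3n` elements are disjoint; inclusion and exclusion shows that
the intersections are empty. -/
theorem part_eq_iff (h : IsTripartition n A) (y : Fin (3 * n)) (f : Fin 3) :
    part A y = f ↔ (y : ℕ) ∈ A f := by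
  have h1 := Finset.card_union_add_card_inter (A 0 ∪ A 1) (A 2)
  have h2 := Finset.card_union_add_card_inter (A 0) (A 1)
  rw [h.union, Finset.card_range, h.card] at h1
  rw [h.card, h.card] at h2
  have h3 : (A 0 ∩ A 1).card = 0 := by omega
  have h4 : ((A 0 ∪ A 1) ∩ A 2).card = 0 := by omega
  rw [Finset.card_eq_zero, Finset.ext_iff] at h3 h4
  have h5 := Finset.ext_iff.1 h.union y
  have h3 := h3 y
  have h4 := h4 y
  simp only [Finset.mem_inter, Finset.mem_union, Finset.mem_range, y.2, iff_true,
    Finset.notMem_empty, iff_false] at h3 h4 h5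
  unfold part
  fin_cases f <;> simp only [Fin.zero_eta, Fin.mk_one, Fin.reduceFinMk] <;> split_ifs <;>
    simp_all

theorem lt (h : IsTripartition n A) {f : Fin 3} {y : ℕ} (hy : y ∈ A f) : y < 3 * n := by
  rw [← Finset.mem_range, ← h.union]
  fin_cases f <;> simp_all

theorem card_part (h : IsTripartition n A) (f : Fin 3) :
    Fintype.card {y : Fin (3 * n) // part A y = f} = n := by
  refine ((Fintype.card_subtype _).trans ?_).trans (h.card f)
  rw [← Finset.card_map Fin.valEmbedding]
  congr 1
  ext y
  simp only [Finset.mem_map, Finset.mem_filter, Finset.mem_univ, true_and, Fin.valEmbedding_apply,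
    h.part_eq_iff]
  constructor
  · rintro ⟨y, hy, rfl⟩
    exact hy
  · exact fun hy => ⟨⟨y, h.lt hy⟩, hy, rfl⟩

/-- The number of permutations that take one partition to another. -/
theorem le_card_perm (hA : IsTripartition n A) (hB : IsTripartition n B) :
    n.factorial ^ 3 ≤ (Finset.univ.filter fun τ : Equiv.Perm (Fin (3 * n)) =>
      ∀ y, part A (τ y) = part B y).card := by
  -- A permutation that respects the parts amounts to a bijection for each part, chosen
  -- independently.
  have h1 : Fintype.card (∀ f : Fin 3, {y : Fin (3 * n) // part B y = f} ≃
      {y : Fin (3 * n) // part A y = f}) = n.factorial ^ 3 := by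
    rw [Fintype.card_pi, Finset.prod_congr rfl fun f _ => Fintype.card_equiv
      (Fintype.equivOfCardEq ((hB.card_part f).trans (hA.card_part f).symm))]
    simp [hB.card_part]
  rw [← h1, ← Finset.card_univ]
  refine Finset.card_le_card_of_injOn Equiv.ofFiberEquiv ?_ ?_
  · intro e _
    simp only [Finset.coe_filter, Finset.mem_univ, true_and, Set.mem_ofPred_eq]
    exact fun y => Equiv.ofFiberEquiv_map e y
  · intro e _ e' _ h
    refine funext fun f => Equiv.ext ?_
    rintro ⟨y, rfl⟩
    have := Equiv.ext_iff.1 h y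
    exact Subtype.ext this

theorem image_extendPerm (hA : IsTripartition n A) (hB : IsTripartition n B)
    {τ : Equiv.Perm (Fin (3 * n))} (h : ∀ y, part A (τ y) = part B y) (f : Fin 3) :
    (B f).image (extendPerm τ) = A f := by
  refine Finset.eq_of_subset_of_card_le (fun z hz => ?_) ?_
  · obtain ⟨y, hy, rfl⟩ := Finset.mem_image.1 hz
    have := hB.lt hy
    have e := extendPerm_apply τ ⟨y, this⟩
    rw [e, ← hA.part_eq_iff, h, hB.part_eq_iff]
    exact hy
  · rw [Finset.card_image_of_injective _ (extendPerm τ).injective, hA.card, hB.card]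

end IsTripartition

/-! ### Block sets and the support of the Kronecker power -/

namespace Gadget

variable (g : Gadget)

/-- The set that is given by the digits of `i` to base `N`, one subset for each of `m` blocks. -/
def setOf : ℕ → ℕ → Finset ℕ
  | 0, _ => ∅
  | m + 1, i => setOf m (i / g.N) ∪
      ((Finset.range g.K).image (g.pos (i % g.N))).map (addLeftEmbedding (3 * g.K * m))

variable {g}

theorem setOf_subset (m i : ℕ) : g.setOf m i ⊆ Finset.range (3 * g.K * m) := by
  induction m generalizing i with
  | zero => simp [setOf]
  | succ m ih =>
    intro y hy
    simp only [setOf, Finset.mem_union, Finset.mem_map, Finset.mem_image] at hy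
    rw [Finset.mem_range, mul_add, mul_one]
    rcases hy with hy | ⟨_, ⟨t, _, rfl⟩, rfl⟩
    · have := Finset.mem_range.1 (ih _ hy)
      omega
    · have := g.pos_lt (i % g.N) t
      simp only [addLeftEmbedding_apply]
      omega

theorem disjoint_setOf_map (m i : ℕ) (s : Finset ℕ) :
    Disjoint (g.setOf m i) (s.map (addLeftEmbedding (3 * g.K * m))) := by
  refine Finset.disjoint_left.2 fun y hy hy' => ?_
  have := Finset.mem_range.1 (setOf_subset m i hy)
  simp only [Finset.mem_map, addLeftEmbedding_apply] at hy'
  obtain ⟨z, -, rfl⟩ := hy'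
  omega

theorem card_setOf (m i : ℕ) : (g.setOf m i).card = g.K * m := by
  induction m generalizing i with
  | zero => simp [setOf]
  | succ m ih =>
    rw [setOf, Finset.card_union_of_disjoint (disjoint_setOf_map _ _ _), ih, Finset.card_map,
      Finset.card_image_of_injOn (g.pos_injOn _), Finset.card_range]
    ring

theorem maskOf_succ (σ : Equiv.Perm ℕ) (m i : ℕ) :
    g.maskOf σ (m + 1) i = g.maskOf σ m (i / g.N) + g.blockVal σ m (i % g.N) := by
  rw [maskOf, Finset.sum_range_succ', maskOf]
  simp only [pow_zero, Nat.div_one]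
  congr 1
  refine Finset.sum_congr rfl fun t ht => ?_
  rw [Finset.mem_range] at ht
  rw [show m + 1 - 1 - (t + 1) = m - 1 - t by omega, pow_succ', ← Nat.div_div_eq_div_mul]

theorem maskOf_eq (σ : Equiv.Perm ℕ) (m i : ℕ) :
    g.maskOf σ m i = ∑ y ∈ (g.setOf m i).image σ, 2 ^ y := by
  rw [Finset.sum_image fun _ _ _ _ h => σ.injective h]
  induction m generalizing i with
  | zero => simp [setOf, maskOf]
  | succ m ih =>
    rw [maskOf_succ, setOf, Finset.sum_union (disjoint_setOf_map _ _ _), ih, Finset.sum_map,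
      Finset.sum_image (g.pos_injOn _), blockVal]
    rfl

theorem tensorPow_succ_eq (m a b c : ℕ) : g.tensorPow (m + 1) a b c =
    g.tensorPow m (a / g.N) (b / g.N) (c / g.N) * g.tensor (a % g.N) (b % g.N) (c % g.N) := by
  have h := g.N_pos
  rw [← tensorPow_succ (Nat.mod_lt _ h) (Nat.mod_lt _ h) (Nat.mod_lt _ h), Nat.div_add_mod',
    Nat.div_add_mod', Nat.div_add_mod']

theorem tensor_ne_zero_iff {a b c : ℕ} (ha : a < g.N) (hb : b < g.N) (hc : c < g.N) :
    g.tensor a b c ≠ 0 ↔ (Finset.range g.K).image (g.pos a) ∪ (Finset.range g.K).image (g.pos b) ∪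
      (Finset.range g.K).image (g.pos c) = Finset.range (3 * g.K) := by
  have := Fact.mk g.prime
  rw [tensor, g.rank a ha b hb c hc]
  split_ifs with h
  · exact iff_of_true one_ne_zero h
  · exact iff_of_false (by simp) h

/-- An entry of the Kronecker power is a product over the blocks. If it is nonzero, the three sets
cover each block and therefore everything. -/
theorem isTripartition_setOf {m a b c : ℕ} (h : g.tensorPow m a b c ≠ 0) :
    IsTripartition (g.K * m) fun f => g.setOf m (![a, b, c] f) := by
  refine ⟨fun f => card_setOf _ _, ?_⟩
  simp only [Matrix.cons_val_zero, Matrix.cons_val_one, Matrix.cons_val]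
  induction m generalizing a b c with
  | zero => simp [setOf]
  | succ m ih =>
    rw [tensorPow_succ_eq] at h
    have hN := g.N_pos
    have h1 := ih (left_ne_zero_of_mul h)
    have h2 := (tensor_ne_zero_iff (Nat.mod_lt _ hN) (Nat.mod_lt _ hN) (Nat.mod_lt _ hN)).1
      (right_ne_zero_of_mul h)
    simp only [setOf]
    have e : ∀ P Q R P' Q' R' : Finset ℕ,
        (P ∪ P') ∪ (Q ∪ Q') ∪ (R ∪ R') = (P ∪ Q ∪ R) ∪ (P' ∪ Q' ∪ R') := by
      intro P Q R P' Q' R'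
      ext
      simp only [Finset.mem_union]
      tauto
    rw [e, h1, ← Finset.map_union, ← Finset.map_union, h2]
    ext y
    simp only [Finset.mem_union, Finset.mem_range, Finset.mem_map, addLeftEmbedding_apply]
    constructor
    · rintro (h | ⟨z, hz, rfl⟩) <;> rw [← mul_assoc, mul_add] <;> [rw [← mul_assoc] at h; skip] <;>
        omega
    · intro h
      by_cases hy : y < 3 * (g.K * m)
      · exact .inl hy
      · rw [← mul_assoc] at hy
        refine .inr ⟨y - 3 * g.K * m, ?_, by omega⟩
        rw [← mul_assoc, mul_add] at h
        omega

/-- Intersecting with the initial segment recovers the earlier blocks, and the difference is the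
last block, which determines the last digit by `image_injOn`. -/
theorem setOf_injOn (m : ℕ) : Set.InjOn (g.setOf m) (Finset.range (g.N ^ m)) := by
  induction m with
  | zero =>
    intro a ha b hb _
    simp only [pow_zero, Finset.range_one, Finset.coe_singleton, Set.mem_singleton_iff] at ha hb
    rw [ha, hb]
  | succ m ih =>
    intro a ha b hb h
    have hN := g.N_pos
    simp only [Finset.coe_range, Set.mem_Iio, pow_succ] at ha hb
    simp only [setOf] at h
    have h1 : g.setOf m (a / g.N) = g.setOf m (b / g.N) := by
      have := congrArg (fun s => s ∩ Finset.range (3 * g.K * m)) h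
      simp only [Finset.union_inter_distrib_right] at this
      have e : ∀ s : Finset ℕ, s.map (addLeftEmbedding (3 * g.K * m)) ∩
          Finset.range (3 * g.K * m) = ∅ := fun s => by
        ext y
        simp only [Finset.mem_inter, Finset.mem_map, addLeftEmbedding_apply, Finset.mem_range,
          Finset.notMem_empty, iff_false]
        rintro ⟨⟨z, -, rfl⟩, h⟩
        omega
      rwa [e, e, Finset.union_empty, Finset.union_empty,
        Finset.inter_eq_left.2 (setOf_subset _ _), Finset.inter_eq_left.2 (setOf_subset _ _)] at this
    have h2 : ((Finset.range g.K).image (g.pos (a % g.N))).map (addLeftEmbedding (3 * g.K * m)) =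
        ((Finset.range g.K).image (g.pos (b % g.N))).map (addLeftEmbedding (3 * g.K * m)) := by
      rw [← Finset.union_sdiff_cancel_left (disjoint_setOf_map m (a / g.N) _), h, h1,
        Finset.union_sdiff_cancel_left (disjoint_setOf_map m (b / g.N) _)]
    have h3 := ih (by simpa using (Nat.div_lt_iff_lt_mul hN).2 ha)
      (by simpa using (Nat.div_lt_iff_lt_mul hN).2 hb) h1
    have h4 := g.image_injOn (by simpa using Nat.mod_lt a hN) (by simpa using Nat.mod_lt b hN)
      (Finset.map_injective _ h2)
    rw [← Nat.div_add_mod a g.N, ← Nat.div_add_mod b g.N, h3, h4]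

open Classical in
/-- The support of a Kronecker power. -/
noncomputable def support (g : Gadget) (m : ℕ) : Finset (ℕ × ℕ × ℕ) :=
  (Finset.range (g.N ^ m) ×ˢ Finset.range (g.N ^ m) ×ˢ Finset.range (g.N ^ m)).filter
    fun t => g.tensorPow m t.1 t.2.1 t.2.2 ≠ 0

theorem mem_support {m a b c : ℕ} : (a, b, c) ∈ g.support m ↔
    (a < g.N ^ m ∧ b < g.N ^ m ∧ c < g.N ^ m) ∧ g.tensorPow m a b c ≠ 0 := by
  simp [support]

/-- Appending to a triple of the support a covering triple for a new block gives a triple of the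
next support; there are at least `G` choices for each block. -/
theorem pow_le_card_support (m : ℕ) : g.G ^ m ≤ (g.support m).card := by
  have := Fact.mk g.prime
  induction m with
  | zero =>
    rw [pow_zero, Nat.one_le_iff_ne_zero, ← Nat.pos_iff_ne_zero, Finset.card_pos]
    exact ⟨(0, 0, 0), mem_support.2 ⟨by simp, by simp [tensorPow]⟩⟩
  | succ m ih =>
    have hN := g.N_pos
    refine (Nat.mul_le_mul ih g.G_le_card).trans ?_
    rw [← Finset.card_product]
    refine Finset.card_le_card_of_injOn (fun t => (t.1.1 * g.N + t.2.1,
      t.1.2.1 * g.N + t.2.2.1, t.1.2.2 * g.N + t.2.2.2)) ?_ ?_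
    · rintro ⟨⟨a, b, c⟩, a', b', c'⟩ h
      simp only [Finset.coe_product, Set.mem_prod, Finset.mem_coe, mem_support,
        Finset.mem_filter, Finset.mem_product, Finset.mem_range] at h
      obtain ⟨⟨⟨ha, hb, hc⟩, h1⟩, ⟨ha', hb', hc'⟩, h2⟩ := h
      simp only [Finset.mem_coe, mem_support, pow_succ]
      refine ⟨⟨mul_add_lt_mul ha ha', mul_add_lt_mul hb hb', mul_add_lt_mul hc hc'⟩, ?_⟩
      rw [tensorPow_succ ha' hb' hc']
      exact mul_ne_zero h1 ((tensor_ne_zero_iff ha' hb' hc').2 h2)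
    · rintro ⟨⟨a, b, c⟩, a', b', c'⟩ h ⟨⟨d, e, f⟩, d', e', f'⟩ h' hh
      simp only [Finset.coe_product, Set.mem_prod, Finset.mem_coe,
        Finset.mem_filter, Finset.mem_product, Finset.mem_range] at h h'
      simp only [Prod.mk.injEq] at hh
      obtain ⟨-, ⟨ha, hb, hc⟩, -⟩ := h
      obtain ⟨-, ⟨ha', hb', hc'⟩, -⟩ := h'
      obtain ⟨rfl, rfl⟩ := mul_add_inj_of_lt ha ha' hh.1
      obtain ⟨rfl, rfl⟩ := mul_add_inj_of_lt hb hb' hh.2.1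
      obtain ⟨rfl, rfl⟩ := mul_add_inj_of_lt hc hc' hh.2.2
      rfl

open Classical in
/-- The number of permutations that take a set of triples of the support to a tripartition. -/
theorem le_card_goodPerm {m : ℕ} {A : Fin 3 → Finset ℕ} (hA : IsTripartition (g.K * m) A) :
    g.G ^ m * (g.K * m).factorial ^ 3 ≤
      (Finset.univ.filter fun τ : Equiv.Perm (Fin (3 * (g.K * m))) => ∃ a b c,
        (a, b, c) ∈ g.support m ∧
          ∀ f, (g.setOf m (![a, b, c] f)).image (extendPerm τ) = A f).card := by
  let P : ℕ × ℕ × ℕ → Finset (Equiv.Perm (Fin (3 * (g.K * m)))) := fun t =>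
    Finset.univ.filter fun τ => ∀ f, (g.setOf m (![t.1, t.2.1, t.2.2] f)).image (extendPerm τ) = A f
  -- The permutation and the target determine the three preimages, hence by `setOf_injOn` the
  -- triple. So different triples have disjoint sets of permutations, and nothing is counted twice.
  have h1 : ((g.support m).biUnion P).card = ∑ t ∈ g.support m, (P t).card := by
    refine Finset.card_biUnion ?_
    rintro ⟨a, b, c⟩ h ⟨a', b', c'⟩ h' hne
    refine Finset.disjoint_left.2 fun τ hτ hτ' => hne ?_
    simp only [P, Finset.mem_filter, Finset.mem_univ, true_and] at hτ hτ'
    have e : ∀ f, g.setOf m (![a, b, c] f) = g.setOf m (![a', b', c'] f) := fun f =>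
      Finset.image_injective (extendPerm τ).injective ((hτ f).trans (hτ' f).symm)
    simp only [Finset.mem_coe, mem_support] at h h'
    have e0 := setOf_injOn m (by simpa using h.1.1) (by simpa using h'.1.1) (by simpa using e 0)
    have e1 := setOf_injOn m (by simpa using h.1.2.1) (by simpa using h'.1.2.1) (by simpa using e 1)
    have e2 := setOf_injOn m (by simpa using h.1.2.2) (by simpa using h'.1.2.2) (by simpa using e 2)
    rw [e0, e1, e2]
  have h2 : (g.support m).card * (g.K * m).factorial ^ 3 ≤ ∑ t ∈ g.support m, (P t).card := by
    rw [← smul_eq_mul, ← Finset.sum_const]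
    refine Finset.sum_le_sum ?_
    rintro ⟨a, b, c⟩ h
    have hB := isTripartition_setOf (mem_support.1 h).2
    refine (hA.le_card_perm hB).trans (Finset.card_le_card fun τ hτ => ?_)
    simp only [P, Finset.mem_filter, Finset.mem_univ, true_and] at hτ ⊢
    exact hA.image_extendPerm hB hτ
  refine (Nat.mul_le_mul_right _ (pow_le_card_support m)).trans (h2.trans (h1 ▸ ?_))
  refine Finset.card_le_card fun τ hτ => ?_
  simp only [P, Finset.mem_biUnion, Finset.mem_filter, Finset.mem_univ, true_and] at hτ ⊢
  obtain ⟨⟨a, b, c⟩, h, h'⟩ := hτ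
  exact ⟨a, b, c, h, h'⟩

open Classical in
/-- The probability that a random permutation takes a triple of the support to a tripartition. -/
theorem le_coinProb_shuffle {m b : ℕ} {A : Fin 3 → Finset ℕ} (hA : IsTripartition (g.K * m) A)
    (hb : (3 * (g.K * m)).factorial ≤ 2 ^ b) :
    (g.G : ℝ) ^ m / 27 ^ (g.K * m) / 2 ≤ coinProb b fun l => ∃ a b c, (a, b, c) ∈ g.support m ∧
      ∀ f, (g.setOf m (![a, b, c] f)).image (shuffle (3 * (g.K * m)) (ofBits l)) = A f := by
  rw [coinProb.ofBits_eq b fun u => ∃ a b c, (a, b, c) ∈ g.support m ∧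
      ∀ f, (g.setOf m (![a, b, c] f)).image (shuffle (3 * (g.K * m)) u) = A f]
  have h1 := card_mul_le_card_shuffle (3 * (g.K * m)) b _ |>.trans' (Nat.mul_le_mul_right _
    (le_card_goodPerm hA))
  have h2 := h1.trans (Finset.card_le_card (t := (Finset.range (2 ^ b)).filter fun u =>
      ∃ a b c, (a, b, c) ∈ g.support m ∧
      ∀ f, (g.setOf m (![a, b, c] f)).image (shuffle (3 * (g.K * m)) u) = A f) (by
    intro u hu
    simp only [Finset.mem_filter, Finset.mem_univ, true_and] at hu ⊢
    obtain ⟨hu, τ, h, hτ⟩ := hu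
    rw [hτ]
    exact ⟨hu, h⟩))
  set C := ((Finset.range (2 ^ b)).filter fun u => ∃ a b c, (a, b, c) ∈ g.support m ∧
      ∀ f, (g.setOf m (![a, b, c] f)).image (shuffle (3 * (g.K * m)) u) = A f).card
  have h3 := factorial_three_mul_le (g.K * m)
  set X := (3 * (g.K * m)).factorial with hX
  have hX0 : 0 < X := Nat.factorial_pos _
  -- The shuffles are not exactly uniform. As `2 ^ b` is at least the number of permutations,
  -- rounding down the quotient loses at most a factor of two.
  have h4 : 2 ^ b ≤ 2 * X * (2 ^ b / X) := by
    have h5 := Nat.div_add_mod (2 ^ b) X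
    have h6 := Nat.mod_lt (2 ^ b) hX0
    have h7 : 1 ≤ 2 ^ b / X := (Nat.one_le_div_iff hX0).2 hb
    nlinarith
  have h8 : g.G ^ m * 2 ^ b ≤ 2 * 27 ^ (g.K * m) * C := by
    calc g.G ^ m * 2 ^ b ≤ g.G ^ m * (2 * X * (2 ^ b / X)) := Nat.mul_le_mul_left _ h4
      _ ≤ g.G ^ m * (2 * (27 ^ (g.K * m) * (g.K * m).factorial ^ 3) * (2 ^ b / X)) := by gcongr
      _ = 2 * 27 ^ (g.K * m) * (g.G ^ m * (g.K * m).factorial ^ 3 * (2 ^ b / X)) := by ring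
      _ ≤ _ := Nat.mul_le_mul_left _ h2
  have h9 : (g.G : ℝ) ^ m * 2 ^ b ≤ 2 * 27 ^ (g.K * m) * C := by exact_mod_cast h8
  rw [div_div, div_le_div_iff₀ (by positivity) (by positivity)]
  linarith

end Gadget

/-! ### The result of a trial -/

namespace TripartitioningInstance

variable {n : ℕ} (I : TripartitioningInstance n)

/-- The families as lists of bit masks. -/
def masks (f : ℕ) : List ℕ :=
  if h : f < 3 then (I.fam ⟨f, h⟩).map bitmask else []

theorem mem_masks {f : Fin 3} {b : ℕ} : b ∈ I.masks f ↔ ∃ S ∈ I.fam f, bitmask S = b := by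
  simp [masks]

/-- A set together with the dummy elements of its family. -/
def padSet (e : ℕ) (f : Fin 3) (S : Finset (Fin (3 * n))) : Finset ℕ :=
  S.map Fin.valEmbedding ∪ Finset.Ico (3 * n + f * e) (3 * n + f * e + e)

theorem disjoint_padSet (e : ℕ) (f : Fin 3) (S : Finset (Fin (3 * n))) :
    Disjoint (S.map Fin.valEmbedding) (Finset.Ico (3 * n + f * e) (3 * n + f * e + e)) := by
  refine Finset.disjoint_left.2 fun y hy hy' => ?_
  simp only [Finset.mem_map, Fin.valEmbedding_apply] at hy
  obtain ⟨y, -, rfl⟩ := hy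
  have := y.2
  simp only [Finset.mem_Ico] at hy'
  omega

theorem card_padSet (e : ℕ) (f : Fin 3) (S : Finset (Fin (3 * n))) :
    (padSet e f S).card = S.card + e := by
  rw [padSet, Finset.card_union_of_disjoint (disjoint_padSet _ _ _), Finset.card_map,
    Nat.card_Ico]
  omega

theorem bitmask_add_padMask (e : ℕ) (f : Fin 3) (S : Finset (Fin (3 * n))) :
    bitmask S + Gadget.padMask n e f = ∑ y ∈ padSet e f S, 2 ^ y := by
  rw [padSet, Finset.sum_union (disjoint_padSet _ _ _), Finset.sum_map, bitmask, Gadget.padMask,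
    Finset.sum_Ico_eq_sum_range]
  simp only [pow_add, Fin.valEmbedding_apply, Nat.add_sub_cancel_left, ← Finset.mul_sum]
  rw [Nat.geomSum_eq le_rfl]
  simp [mul_comm]

/-- The dummy elements of the three families are consecutive intervals that fill up the new part of
the universe. -/
theorem isTripartition_padSet {e : ℕ} {S : Fin 3 → Finset (Fin (3 * n))}
    (hS : ∀ f, S f ∈ I.fam f) (h : S 0 ∪ S 1 ∪ S 2 = Finset.univ) :
    IsTripartition (n + e) fun f => padSet e f (S f) := by
  refine ⟨fun f => by rw [card_padSet, I.card_eq f _ (hS f)], ?_⟩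
  ext y
  simp only [padSet, Finset.mem_union, Finset.mem_Ico, Finset.mem_range, Finset.mem_map,
    Fin.valEmbedding_apply, Fin.val_zero, Fin.val_one, Fin.val_two]
  constructor
  · rintro ((⟨⟨z, -, rfl⟩⟩ | hy | ⟨z, -, rfl⟩ | hy) | ⟨z, -, rfl⟩ | hy) <;> omega
  · intro hy
    by_cases hn : y < 3 * n
    · have := Finset.mem_univ (⟨y, hn⟩ : Fin (3 * n))
      rw [← h] at this
      simp only [Finset.mem_union] at this
      rcases this with (h | h) | h
      · exact .inl (.inl (.inl ⟨_, h, rfl⟩))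
      · exact .inl (.inr (.inl ⟨_, h, rfl⟩))
      · exact .inr (.inl ⟨_, h, rfl⟩)
    · omega

/-- All dummy elements are at least `3 * n`, so the original elements can only be covered by the
original sets. -/
theorem union_eq_univ_of_padSet {e : ℕ} {S : Fin 3 → Finset (Fin (3 * n))}
    (h : padSet e 0 (S 0) ∪ padSet e 1 (S 1) ∪ padSet e 2 (S 2) = Finset.range (3 * (n + e))) :
    S 0 ∪ S 1 ∪ S 2 = Finset.univ := by
  have key : ∀ (f : Fin 3) (y : Fin (3 * n)), (y : ℕ) ∈ padSet e f (S f) → y ∈ S f := by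
    intro f y hy
    have := y.2
    simp only [padSet, Finset.mem_union, Finset.mem_map, Fin.valEmbedding_apply,
      Finset.mem_Ico] at hy
    rcases hy with ⟨z, hz, hz'⟩ | hy
    · exact Fin.ext hz' ▸ hz
    · omega
  refine Finset.eq_univ_of_forall fun y => ?_
  have := y.2
  have hy : (y : ℕ) ∈ Finset.range (3 * (n + e)) := Finset.mem_range.2 (by omega)
  rw [← h] at hy
  simp only [Finset.mem_union] at hy ⊢
  exact hy.imp (Or.imp (key _ _) (key _ _)) (key _ _)

end TripartitioningInstance

namespace Gadget

open TripartitioningInstance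

variable {g : Gadget} {n : ℕ} (I : TripartitioningInstance n)

theorem image_shuffle_range (x u : ℕ) : (Finset.range x).image (shuffle x u) = Finset.range x := by
  refine Finset.eq_of_subset_of_card_le (fun y hy => ?_) ?_
  · obtain ⟨z, hz, rfl⟩ := Finset.mem_image.1 hy
    exact Finset.mem_range.2 (shuffle_lt u (Finset.mem_range.1 hz))
  · rw [Finset.card_image_of_injective _ (shuffle x u).injective]

/-- A nonzero result certifies a solution. -/
theorem hasTripartition_of_trialOf_ne_zero {m : ℕ} (hm : n ≤ g.K * m) {l : List Bool}
    (h : g.trialOf m (tableOf n (g.K * m - n) I.masks) l ≠ 0) : I.HasTripartition := by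
  have := Fact.mk g.prime
  rw [trialOf, trialVal_eq] at h
  obtain ⟨a, -, h⟩ := Finset.exists_ne_zero_of_sum_ne_zero h
  obtain ⟨b, -, h⟩ := Finset.exists_ne_zero_of_sum_ne_zero h
  obtain ⟨c, -, h⟩ := Finset.exists_ne_zero_of_sum_ne_zero h
  set u := ofBits (l.take (3 * g.K * m * (3 * g.K * m)))
  have hT := isTripartition_setOf (left_ne_zero_of_mul h)
  have key : ∀ (f : Fin 3) (l : List Bool) (i : ℕ),
      (g.startVec m u (tableOf n (g.K * m - n) I.masks f) l i : ZMod g.p) ≠ 0 →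
      ∃ S ∈ I.fam f, (g.setOf m i).image (shuffle (3 * g.K * m) u) = padSet (g.K * m - n) f S := by
    intro f l i hi
    have h1 : tableOf n (g.K * m - n) I.masks f (g.maskOf (shuffle (3 * g.K * m) u) m i) ≠ 0 := by
      intro h0
      simp [startVec, h0] at hi
    rw [tableOf, ite_ne_right_iff] at h1
    obtain ⟨⟨b, hb, hb'⟩, -⟩ := h1
    obtain ⟨S, hS, rfl⟩ := I.mem_masks.1 hb
    -- Finite sets with the same bit mask are equal, so a hit in the table is a set of the family.
    refine ⟨S, hS, Finset.geomSum_injective (le_refl 2) ?_⟩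
    rw [bitmask_add_padMask, maskOf_eq] at hb'
    exact hb'
  have h := right_ne_zero_of_mul h
  obtain ⟨S₀, hS₀, e₀⟩ := key 0 _ _ (left_ne_zero_of_mul (left_ne_zero_of_mul h))
  obtain ⟨S₁, hS₁, e₁⟩ := key 1 _ _ (right_ne_zero_of_mul (left_ne_zero_of_mul h))
  obtain ⟨S₂, hS₂, e₂⟩ := key 2 _ _ (right_ne_zero_of_mul h)
  refine ⟨S₀, hS₀, S₁, hS₁, S₂, hS₂, ?_⟩
  refine union_eq_univ_of_padSet (e := g.K * m - n) (S := ![S₀, S₁, S₂]) ?_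
  simp only [Matrix.cons_val_zero, Matrix.cons_val_one, Matrix.cons_val]
  have hU := hT.union
  simp only [Matrix.cons_val_zero, Matrix.cons_val_one, Matrix.cons_val] at hU
  rw [← e₀, ← e₁, ← e₂, ← Finset.image_union, ← Finset.image_union, hU, ← mul_assoc,
    image_shuffle_range, Nat.add_sub_cancel' hm, mul_assoc]

theorem factorial_le_two_pow_sq (x : ℕ) : x.factorial ≤ 2 ^ (x * x) := by
  rw [pow_mul]
  exact (Nat.factorial_le_pow x).trans (Nat.pow_le_pow_left Nat.lt_two_pow_self.le x)

/-- A trial finds a solution with the probability on which the number of trials is based. -/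
theorem le_coinProb_trialOf {m : ℕ} (hm : n ≤ g.K * m) (hI : I.HasTripartition) :
    (g.G : ℝ) ^ m / 27 ^ (g.K * m) / 16 ≤ coinProb (g.trialCoins m) fun l =>
      g.trialOf m (tableOf n (g.K * m - n) I.masks) l ≠ 0 := by
  have := Fact.mk g.prime
  obtain ⟨S₀, hS₀, S₁, hS₁, S₂, hS₂, hU⟩ := hI
  let S : Fin 3 → Finset (Fin (3 * n)) := ![S₀, S₁, S₂]
  have hS : ∀ f, S f ∈ I.fam f := by
    intro f
    fin_cases f <;> assumption
  have hA := I.isTripartition_padSet (e := g.K * m - n) hS hU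
  rw [Nat.add_sub_cancel' hm] at hA
  have hD : ∀ f : Fin 3, tableOf n (g.K * m - n) I.masks f
      (∑ y ∈ padSet (g.K * m - n) f (S f), 2 ^ y) = 1 := by
    intro f
    rw [tableOf, if_pos ⟨_, I.mem_masks.2 ⟨_, hS f, rfl⟩, (bitmask_add_padMask _ _ _).symm⟩]
  have h1 := le_coinProb_shuffle (g := g) (b := 3 * g.K * m * (3 * g.K * m)) hA (by
    rw [← mul_assoc]
    exact factorial_le_two_pow_sq _)
  have h2 := coinProb.mul_le_add (a := 3 * g.K * m * (3 * g.K * m)) (b := 3 * g.N ^ m) (q := 1 / 8)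
    (A := fun l => ∃ a b c, (a, b, c) ∈ g.support m ∧
      ∀ f, (g.setOf m (![a, b, c] f)).image (shuffle (3 * (g.K * m)) (ofBits l)) =
        padSet (g.K * m - n) f (S f))
    (E := fun l => g.trialOf m (tableOf n (g.K * m - n) I.masks) l ≠ 0) fun l hl h => by
    obtain ⟨a, b, c, habc, h⟩ := h
    obtain ⟨⟨ha, hb, hc⟩, hT⟩ := mem_support.1 habc
    have hmask : ∀ f : Fin 3, tableOf n (g.K * m - n) I.masks f
        (g.maskOf (shuffle (3 * g.K * m) (ofBits l)) m (![a, b, c] f)) = 1 := by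
      intro f
      rw [maskOf_eq, mul_assoc, h, hD]
    let d : Fin 3 → ℕ → ZMod g.p := fun f i => (tableOf n (g.K * m - n) I.masks f
      (g.maskOf (shuffle (3 * g.K * m) (ofBits l)) m i) : ℕ)
    -- For a permutation that carries the triple `a, b, c` to the solution, the coefficient at this
    -- triple is nonzero: all three table entries are `1`.
    have h3 := coinProb.trilinear (fun a b c => g.tensorPow m a b c * (d 0 a * d 1 b * d 2 c))
      ha hb hc (by
        have h0 := hmask 0
        have h1 := hmask 1
        have h2 := hmask 2
        simp only [Matrix.cons_val_zero, Matrix.cons_val_one, Matrix.cons_val] at h0 h1 h2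
        simp only [d, h0, h1, h2]
        simpa using hT)
    rw [show 3 * g.N ^ m = g.N ^ m + (g.N ^ m + g.N ^ m) by ring]
    refine h3.trans (coinProb.mono fun l' _ hl' => ?_)
    rw [trialOf, trialVal_eq, List.take_left' hl]
    convert hl' using 1
    refine Finset.sum_congr rfl fun a _ => Finset.sum_congr rfl fun b _ =>
      Finset.sum_congr rfl fun c _ => ?_
    have e : ∀ j, (l ++ l').drop (3 * g.K * m * (3 * g.K * m) + j) = l'.drop j := fun j => by
      rw [← List.drop_drop, List.drop_left' hl]
    simp only [e, startVec, d]
    push_cast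
    simp only [Fin.val_zero, Fin.val_one, Fin.val_two, zero_mul, List.drop_zero, one_mul]
    ring
  rw [trialCoins]
  refine le_trans ?_ h2
  linarith

theorem trialOf_take (m : ℕ) (D : ℕ → ℕ → ℕ) (l : List Bool) :
    g.trialOf m D l = g.trialOf m D (l.take (g.trialCoins m)) := by
  have e0 : (l.take (g.trialCoins m)).take (3 * g.K * m * (3 * g.K * m)) =
      l.take (3 * g.K * m * (3 * g.K * m)) := by
    rw [List.take_take, min_eq_left]
    rw [trialCoins]
    omega
  have e1 : ∀ f, ((l.take (g.trialCoins m)).drop (3 * g.K * m * (3 * g.K * m) +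
      (2 - f) * g.N ^ m)).take (g.N ^ m) = (l.drop (3 * g.K * m * (3 * g.K * m) +
      (2 - f) * g.N ^ m)).take (g.N ^ m) := by
    intro f
    rw [List.drop_take, List.take_take, min_eq_left]
    have : (2 - f) * g.N ^ m ≤ 2 * g.N ^ m := Nat.mul_le_mul_right _ (by omega)
    rw [trialCoins]
    omega
  rw [trialOf, trialOf, e0]
  simp only [e1]

/-- The number of trials. -/
def numTrials (g : Gadget) (m : ℕ) : ℕ := 32 * ((27 ^ g.K) ^ m / g.G ^ m + 1)

/-- Some trial finds a solution with probability at least `2/3`. -/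
theorem le_coinProb_exists {m t : ℕ} (hm : n ≤ g.K * m) (hI : I.HasTripartition)
    (ht : g.numTrials m * g.trialCoins m ≤ t) :
    2 / 3 ≤ coinProb t fun l => ∃ i < g.numTrials m,
      g.trialOf m (tableOf n (g.K * m - n) I.masks) (l.drop (i * g.trialCoins m)) ≠ 0 := by
  obtain ⟨e, rfl⟩ := Nat.exists_eq_add_of_le ht
  have h1 := le_coinProb_trialOf (g := g) I hm hI
  have h2 := coinProb.forall_not_le (fun l => by rw [trialOf_take]) h1 (g.numTrials m) e
  set q := (g.G : ℝ) ^ m / 27 ^ (g.K * m) / 16 with hq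
  have hq1 : q ≤ 1 := h1.trans (coinProb.le_one _ _)
  have hG : (0 : ℝ) < (g.G : ℝ) ^ m := pow_pos (by exact_mod_cast g.G_pos) _
  -- The constant `32` in the number of trials is twice the `16` in `q`, which is the `8` of the
  -- random weights times the `2` of the rounding.
  have h3 : 2 ≤ q * g.numTrials m := by
    have h4 : ((27 : ℝ) ^ g.K) ^ m ≤ g.G ^ m * ((27 ^ g.K) ^ m / g.G ^ m + 1 : ℕ) := by
      exact_mod_cast (Nat.lt_mul_div_succ _ (pow_pos g.G_pos m)).le
    rw [hq, numTrials]
    rw [← pow_mul] at h4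
    push_cast at h4 ⊢
    rw [div_div, div_mul_eq_mul_div, le_div_iff₀ (by positivity)]
    linarith
  -- All trials fail with probability at most `exp (-2)`, and `exp 2 ≥ 2 + 1`.
  have h5 : (1 - q) ^ g.numTrials m ≤ 1 / 3 := by
    calc (1 - q) ^ g.numTrials m ≤ Real.exp (-q) ^ g.numTrials m :=
          pow_le_pow_left₀ (by linarith) (by linarith [Real.add_one_le_exp (-q)]) _
      _ = Real.exp (-(q * g.numTrials m)) := by rw [← Real.exp_nat_mul]; ring_nf
      _ ≤ Real.exp (-2) := Real.exp_le_exp.2 (by linarith)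
      _ ≤ 1 / 3 := by
        rw [Real.exp_neg, one_div]
        refine inv_anti₀ (by norm_num) ?_
        linarith [Real.add_one_le_exp (2 : ℝ)]
  have h6 := coinProb.not (g.numTrials m * g.trialCoins m + e) fun l => ∃ i < g.numTrials m,
      g.trialOf m (tableOf n (g.K * m - n) I.masks) (l.drop (i * g.trialCoins m)) ≠ 0
  rw [coinProb.congr fun l _ => by push Not; rfl] at h6
  rw [coinProb.congr fun l _ => by push Not; rfl] at h2
  linarith

end Gadget

/-! ### Rank decompositions over a prime field -/

section ChangeOfField

/-- Nonzero primes are maximal. If `x` is in the Jacobson radical of zero, `x * x + 1` is a unit, so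
it is `1` or `-1`, which leaves `x = 0`. -/
theorem Int.isJacobsonRing : IsJacobsonRing ℤ := by
  rw [isJacobsonRing_iff_prime_eq]
  intro P hP
  by_cases h : P = ⊥
  · subst h
    refine le_antisymm (fun x hx => ?_) Ideal.le_jacobson
    have := Int.isUnit_iff.1 (Ideal.mem_jacobson_bot.1 hx x)
    rw [Ideal.mem_bot]
    rcases this with h | h <;> nlinarith
  · have := Ring.DimensionLEOne.maximalOfPrime h hP
    exact Ideal.jacobson_eq_self_of_isMaximal

/-- A field that is finitely generated as a ring has prime characteristic and is finite-dimensional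
over its prime field. -/
theorem exists_finiteDimensional_of_finiteType (S : Type*) [Field S] [Algebra.FiniteType ℤ S] :
    ∃ p : ℕ, p.Prime ∧ ∃ _ : Algebra (ZMod p) S, Module.Finite (ZMod p) S := by
  have := Int.isJacobsonRing
  have hfin : Module.Finite ℤ S := finite_of_finite_type_of_isJacobsonRing ℤ S
  obtain ⟨p, hp⟩ := CharP.exists S
  rcases CharP.char_is_prime_or_zero S p with h | rfl
  · let := ZMod.algebra S p
    exact ⟨p, h, ZMod.algebra S p, Module.Finite.of_restrictScalars_finite ℤ (ZMod p) S⟩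
  · have := CharP.charP_to_charZero S
    -- In characteristic zero the integers would embed into a field that is integral over them, and
    -- would be a field themselves.
    exact absurd (isField_of_isIntegral_of_isField (R := ℤ) (S := S)
      (RingHom.injective_int _) (Field.toIsField S)) Int.not_isField

theorem HasRankDecomposition.of_fintype {F ι κ : Type*} [Field F] [Fintype κ] {T : Tensor F ι}
    (a b c : κ → ι → F) (h : ∀ i j k, T i j k = ∑ l, a l i * b l j * c l k) :
    HasRankDecomposition T (Fintype.card κ) := by
  let e := (Fintype.equivFin κ).symm
  refine ⟨fun l => a (e l), fun l => b (e l), fun l => c (e l), fun i j k => ?_⟩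
  rw [h, ← Equiv.sum_comp e]

/-- A tensor with integer coefficients has over some finite field a rank decomposition of the same
length as over the given field. -/
theorem exists_hasRankDecomposition_map {F : Type*} {ι : Type} [Field F] [Finite ι]
    (T : Tensor ℤ ι) {r : ℕ} (h : HasRankDecomposition (fun i j k => (T i j k : F)) r) :
    ∃ (S : Type) (_ : Field S) (_ : Algebra.FiniteType ℤ S),
      HasRankDecomposition (fun i j k => (T i j k : S)) r := by
  obtain ⟨a, b, c, h⟩ := h
  beta_reduce at h
  let v : Fin 3 × Fin r × ι → F := fun x => ![a, b, c] x.1 x.2.1 x.2.2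
  let φ : MvPolynomial (Fin 3 × Fin r × ι) ℤ →ₐ[ℤ] F := MvPolynomial.aeval v
  -- The equations of the decomposition, with indeterminates for its coefficients, lie in the kernel
  -- of the evaluation in `F`. They continue to hold modulo any maximal ideal above this proper
  -- ideal, and the residue field is generated by the images of the indeterminates.
  obtain ⟨M, hM, hle⟩ := Ideal.exists_le_maximal (RingHom.ker φ) (RingHom.ker_ne_top φ)
  let X : Fin 3 → Fin r → ι → MvPolynomial (Fin 3 × Fin r × ι) ℤ :=
    fun f l i => MvPolynomial.X (f, l, i)
  refine ⟨MvPolynomial (Fin 3 × Fin r × ι) ℤ ⧸ M, Ideal.Quotient.field M, ?_,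
    fun l i => Ideal.Quotient.mk M (X 0 l i), fun l i => Ideal.Quotient.mk M (X 1 l i),
    fun l i => Ideal.Quotient.mk M (X 2 l i), fun i j k => ?_⟩
  · exact inferInstanceAs (Algebra.FiniteType ℤ (MvPolynomial (Fin 3 × Fin r × ι) ℤ ⧸ M))
  · have h1 : (T i j k : MvPolynomial (Fin 3 × Fin r × ι) ℤ) -
        ∑ l, X 0 l i * X 1 l j * X 2 l k ∈ RingHom.ker φ := by
      rw [RingHom.mem_ker, map_sub, map_intCast, h, map_sum, sub_eq_zero]
      refine Finset.sum_congr rfl fun l _ => ?_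
      simp [φ, X, v]
    have h2 := Ideal.Quotient.eq.2 (hle h1)
    rw [map_sum] at h2
    simpa using h2

/-- Restriction of scalars. -/
theorem HasRankDecomposition.restrictScalars {ι S : Type*} (F : Type*) [Field F] [Field S]
    [Algebra F S] [Module.Finite F S] {T : Tensor ℤ ι} {r : ℕ}
    (h : HasRankDecomposition (fun i j k => (T i j k : S)) r) :
    HasRankDecomposition (fun i j k => (T i j k : F)) (r * Module.finrank F S ^ 3) := by
  obtain ⟨a, b, c, h⟩ := h
  beta_reduce at h
  let e := Module.finBasis F S
  -- An `F`-linear retraction of `S` onto `F`. It fixes the integer entries of `T`, so it can be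
  -- applied to the decomposition over `S`.
  obtain ⟨L, hL⟩ := (Algebra.linearMap F S).exists_leftInverse_of_injective
    (LinearMap.ker_eq_bot.2 (algebraMap F S).injective)
  have hcard : r * Module.finrank F S ^ 3 = Fintype.card (Fin r × Fin (Module.finrank F S) ×
      Fin (Module.finrank F S) × Fin (Module.finrank F S)) := by
    simp only [Fintype.card_prod, Fintype.card_fin]
    ring
  -- Expanding the three factors in a basis replaces each product over `S` by one product over `F`
  -- for every triple of basis vectors.
  have hmul : ∀ x y z : S, L (x * y * z) = ∑ u, ∑ v, ∑ w,
      e.repr x u * L (e u * e v * e w) * e.repr y v * e.repr z w := by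
    intro x y z
    conv_lhs => rw [← e.sum_repr x, ← e.sum_repr y, ← e.sum_repr z]
    rw [Finset.sum_mul_sum, Finset.sum_mul, map_sum]
    refine Finset.sum_congr rfl fun u _ => ?_
    rw [Finset.sum_mul, map_sum]
    refine Finset.sum_congr rfl fun v _ => ?_
    rw [Finset.mul_sum, map_sum]
    refine Finset.sum_congr rfl fun w _ => ?_
    rw [smul_mul_smul_comm, smul_mul_smul_comm, map_smul, smul_eq_mul]
    ring
  rw [hcard]
  refine .of_fintype (fun l i => e.repr (a l.1 i) l.2.1 * L (e l.2.1 * e l.2.2.1 * e l.2.2.2))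
    (fun l i => e.repr (b l.1 i) l.2.2.1) (fun l i => e.repr (c l.1 i) l.2.2.2) fun i j k => ?_
  have h1 : L (T i j k : S) = T i j k := by
    have := LinearMap.congr_fun hL (T i j k : F)
    simpa using this
  rw [← h1, h, map_sum, Fintype.sum_prod_type]
  refine Finset.sum_congr rfl fun l _ => ?_
  rw [hmul]
  simp only [Fintype.sum_prod_type]

end ChangeOfField

/-! ### Asymptotic rank over a prime field -/

section KroneckerPow

variable {F ι : Type*} [Field F] [Fintype ι]

theorem hasRankDecomposition_tensorRank (T : Tensor F ι) :
    HasRankDecomposition T (tensorRank T) :=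
  Nat.sInf_mem (exists_hasRankDecomposition T)

theorem tensorRank_kroneckerPow_mul (T : Tensor F ι) (r s : ℕ) :
    tensorRank (kroneckerPow T (r * s)) ≤ tensorRank (kroneckerPow T r) ^ s := by
  induction s with
  | zero =>
    rw [pow_zero]
    refine Nat.sInf_le ⟨fun _ _ => 1, fun _ _ => 1, fun _ _ => 1, fun i j k => ?_⟩
    simp [kroneckerPow]
  | succ s ih =>
    rw [mul_add, mul_one, pow_succ]
    exact (tensorRank_kroneckerPow_add T _ _).trans (Nat.mul_le_mul_right _ ih)

end KroneckerPow

theorem kroneckerPow_tripartitionTensor (F : Type*) [Field F] (k r : ℕ)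
    (S T U : Fin r → {S : Finset (Fin (3 * k)) // S.card = k}) :
    kroneckerPow (tripartitionTensor F k) r S T U =
      if ∀ i, (S i).1 ∪ (T i).1 ∪ (U i).1 = Finset.univ then 1 else 0 := by
  rw [kroneckerPow]
  simp only [tripartitionTensor]
  rw [Finset.prod_boole]
  simp

/-- Upper bounds for the rank over prime fields. -/
theorem exists_hasRankDecomposition_zmod (F : Type*) [Field F] (k : ℕ) {ρ : ℝ}
    (hρ : asymptoticRank (tripartitionTensor F k) < ρ) :
    ∃ p r R : ℕ, p.Prime ∧ 1 ≤ r ∧ (R : ℝ) ≤ ρ ^ r ∧ ∀ _ : Fact p.Prime,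
      HasRankDecomposition (kroneckerPow (tripartitionTensor (ZMod p) k) r) R := by
  obtain ⟨ρ', h1, h2⟩ := exists_between hρ
  have h0 : 0 ≤ asymptoticRank (tripartitionTensor F k) :=
    ge_of_tendsto' (tendsto_asymptoticRank _) fun r => by positivity
  obtain ⟨r, hr, hr1⟩ := (((tendsto_asymptoticRank (tripartitionTensor F k)).eventually_lt_const
    h1).and (eventually_ge_atTop 1)).exists
  set R₀ := tensorRank (kroneckerPow (tripartitionTensor F k) r)
  have hR₀ : (R₀ : ℝ) ≤ ρ' ^ r := by
    have := pow_le_pow_left₀ (by positivity) hr.le r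
    rwa [one_div, Real.rpow_inv_natCast_pow (by positivity) (by omega)] at this
  let T (s : ℕ) : Tensor ℤ (Fin s → {S : Finset (Fin (3 * k)) // S.card = k}) := fun S T U =>
    if ∀ i, (S i).1 ∪ (T i).1 ∪ (U i).1 = Finset.univ then 1 else 0
  have hT : ∀ (E : Type _) [Field E] (s : ℕ), (fun i j k => (T s i j k : E)) =
      kroneckerPow (tripartitionTensor E k) s := by
    intro E _ s
    funext i j l
    rw [kroneckerPow_tripartitionTensor]
    simp [T]
  -- The same statement for fields in `Type`: the universe of `E` in `hT` is fixed by its use for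
  -- `F`.
  have hT' : ∀ (E : Type) [Field E] (s : ℕ), (fun i j k => (T s i j k : E)) =
      kroneckerPow (tripartitionTensor E k) s := by
    intro E _ s
    funext i j l
    rw [kroneckerPow_tripartitionTensor]
    simp [T]
  obtain ⟨S, _, _, hS⟩ := exists_hasRankDecomposition_map (F := F) (T r)
    (by rw [hT]; exact hasRankDecomposition_tensorRank _)
  obtain ⟨p, hp, _, _⟩ := exists_finiteDimensional_of_finiteType S
  have := Fact.mk hp
  set d := Module.finrank (ZMod p) S
  have hpow : ∀ s, HasRankDecomposition (kroneckerPow (tripartitionTensor (ZMod p) k) (r * s))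
      (tensorRank (kroneckerPow (tripartitionTensor S k) (r * s)) * d ^ 3) := by
    intro s
    rw [← hT']
    refine HasRankDecomposition.restrictScalars (ZMod p) (S := S) ?_
    rw [hT']
    exact hasRankDecomposition_tensorRank _
  have hle : ∀ s, tensorRank (kroneckerPow (tripartitionTensor S k) (r * s)) ≤ R₀ ^ s := by
    intro s
    refine (tensorRank_kroneckerPow_mul _ r s).trans (Nat.pow_le_pow_left (Nat.sInf_le ?_) s)
    rw [← hT']
    exact hS
  have hρ' : 0 < ρ' := h0.trans_lt h1
  have hρ0 : 0 < ρ := hρ'.trans h2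
  -- The factor `d ^ 3` from the restriction of scalars does not depend on `s`, so for a high power
  -- it is outweighed by the gap between `ρ'` and `ρ`.
  have hlim : Tendsto (fun s : ℕ => ((ρ' / ρ) ^ r) ^ s * (d : ℝ) ^ 3) atTop (𝓝 (0 * (d : ℝ) ^ 3)) :=
    (tendsto_pow_atTop_nhds_zero_of_lt_one (by positivity) (pow_lt_one₀ (by positivity)
      ((div_lt_one (hρ'.trans h2)).2 h2) (by omega))).mul_const _
  rw [zero_mul] at hlim
  obtain ⟨s, hs, hs1⟩ := ((hlim.eventually_lt_const zero_lt_one).and (eventually_ge_atTop 1)).exists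
  refine ⟨p, r * s, tensorRank (kroneckerPow (tripartitionTensor S k) (r * s)) * d ^ 3, hp,
    Nat.mul_pos hr1 hs1, ?_, fun _ => hpow s⟩
  calc ((tensorRank (kroneckerPow (tripartitionTensor S k) (r * s)) * d ^ 3 : ℕ) : ℝ)
      ≤ ((R₀ ^ s * d ^ 3 : ℕ) : ℝ) := by exact_mod_cast Nat.mul_le_mul_right _ (hle s)
    _ ≤ (ρ' ^ r) ^ s * d ^ 3 := by
      push_cast
      gcongr
    _ = ρ ^ (r * s) * (((ρ' / ρ) ^ r) ^ s * d ^ 3) := by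
      rw [← pow_mul, ← pow_mul, div_pow]
      field_simp
    _ ≤ ρ ^ (r * s) * 1 := by gcongr
    _ = _ := mul_one _

/-! ### The data of the algorithm -/

theorem Finset.exists_enum {s : Finset ℕ} {K : ℕ} (hK : 1 ≤ K) (hs : s.card = K) :
    ∃ f : ℕ → ℕ, (∀ i, f i ∈ s) ∧ Set.InjOn f (Finset.range K) ∧
      (Finset.range K).image f = s := by
  let f : ℕ → ℕ := fun i => s.orderEmbOfFin hs (if h : i < K then ⟨i, h⟩ else ⟨0, hK⟩)
  have hf : ∀ i, f i ∈ s := fun i => s.orderEmbOfFin_mem hs _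
  have hinj : Set.InjOn f (Finset.range K) := by
    intro i hi j hj h
    rw [Finset.coe_range, Set.mem_Iio] at hi hj
    have := (s.orderEmbOfFin hs).injective h
    simpa [hi, hj] using this
  refine ⟨f, hf, hinj, Finset.eq_of_subset_of_card_le ?_ ?_⟩
  · intro y hy
    obtain ⟨i, -, rfl⟩ := Finset.mem_image.1 hy
    exact hf i
  · rw [Finset.card_image_of_injOn hinj, hs, Finset.card_range]

/-- The number of tripartitions. -/
theorem card_tripartition (k : ℕ) : (3 * k).choose k * (2 * k).choose k ≤
    Fintype.card {t : Fin 3 → {S : Finset (Fin (3 * k)) // S.card = k} //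
      (t 0).1 ∪ (t 1).1 ∪ (t 2).1 = Finset.univ} := by
  -- The first set is arbitrary, the second lies in its complement, and the third is what remains.
  let P : Finset (Σ _ : Finset (Fin (3 * k)), Finset (Fin (3 * k))) :=
    (Finset.univ.powersetCard k).sigma fun S => Sᶜ.powersetCard k
  have hP : P.card = (3 * k).choose k * (2 * k).choose k := by
    rw [Finset.card_sigma, Finset.sum_congr rfl (g := fun _ => (2 * k).choose k),
      Finset.sum_const, Finset.card_powersetCard, Finset.card_univ, Fintype.card_fin, smul_eq_mul]
    intro S hS
    rw [Finset.mem_powersetCard] at hS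
    rw [Finset.card_powersetCard, Finset.card_compl, Fintype.card_fin, hS.2]
    congr 1
    omega
  have hmem : ∀ t : P, t.1.1.card = k ∧ t.1.2.card = k ∧ (t.1.1 ∪ t.1.2)ᶜ.card = k := by
    rintro ⟨⟨S, T⟩, h⟩
    simp only [P, Finset.mem_sigma, Finset.mem_powersetCard, Finset.subset_univ, true_and] at h
    obtain ⟨h1, h2, h3⟩ := h
    refine ⟨h1, h3, ?_⟩
    rw [Finset.card_compl, Finset.card_union_of_disjoint
      (Finset.disjoint_left.2 fun y hy hy' => Finset.mem_compl.1 (h2 hy') hy), Fintype.card_fin]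
    simp only [h1, h3]
    omega
  rw [← hP, ← Fintype.card_coe]
  refine Fintype.card_le_of_injective (fun t => ⟨![⟨t.1.1, (hmem t).1⟩, ⟨t.1.2, (hmem t).2.1⟩,
    ⟨(t.1.1 ∪ t.1.2)ᶜ, (hmem t).2.2⟩], ?_⟩) ?_
  · simp only [Matrix.cons_val_zero, Matrix.cons_val_one, Matrix.cons_val]
    exact Finset.union_compl _
  · rintro ⟨⟨S, T⟩, h⟩ ⟨⟨S', T'⟩, h'⟩ e
    have e := Subtype.ext_iff.1 e
    have e0 := Subtype.ext_iff.1 (congrFun e 0)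
    have e1 := Subtype.ext_iff.1 (congrFun e 1)
    simp only [Matrix.cons_val_zero, Matrix.cons_val_one] at e0 e1
    subst e0 e1
    rfl

/-! ### From a rank decomposition to the data of the algorithm -/

section Blocks

variable {k r : ℕ}

/-- `r` subsets of `[3 * k]` as a subset of `[3 * k * r]`. -/
def blockSet (S : Fin r → {S : Finset (Fin (3 * k)) // S.card = k}) : Finset ℕ :=
  (Finset.univ.filter fun z : Fin r × Fin (3 * k) => z.2 ∈ (S z.1).1).map
    (finProdFinEquiv.toEmbedding.trans Fin.valEmbedding)

theorem blockSet_subset (S : Fin r → {S : Finset (Fin (3 * k)) // S.card = k}) :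
    blockSet S ⊆ Finset.range (3 * (k * r)) := by
  intro y hy
  simp only [blockSet, Finset.mem_map] at hy
  obtain ⟨z, -, rfl⟩ := hy
  have := (finProdFinEquiv z).2
  rw [Finset.mem_range, show 3 * (k * r) = r * (3 * k) by ring]
  exact this

theorem card_blockSet (S : Fin r → {S : Finset (Fin (3 * k)) // S.card = k}) :
    (blockSet S).card = k * r := by
  rw [blockSet, Finset.card_map, Finset.card_filter, Fintype.sum_prod_type]
  simp only [← Finset.card_filter, Finset.filter_mem_eq_inter, Finset.univ_inter, (S _).2]
  simp [mul_comm]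

theorem blockSet_injective :
    Function.Injective (blockSet : (Fin r → {S : Finset (Fin (3 * k)) // S.card = k}) → _) := by
  intro S T h
  have h := Finset.map_injective _ h
  refine funext fun i => Subtype.ext (Finset.ext fun y => ?_)
  have := Finset.ext_iff.1 h (i, y)
  simpa using this

theorem blockSet_union (S T U : Fin r → {S : Finset (Fin (3 * k)) // S.card = k}) :
    blockSet S ∪ blockSet T ∪ blockSet U = Finset.range (3 * (k * r)) ↔
      ∀ i, (S i).1 ∪ (T i).1 ∪ (U i).1 = Finset.univ := by
  have h1 : Finset.range (3 * (k * r)) = (Finset.univ : Finset (Fin r × Fin (3 * k))).map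
      (finProdFinEquiv.toEmbedding.trans Fin.valEmbedding) := by
    refine (Finset.eq_of_subset_of_card_le (fun y hy => ?_) ?_).symm
    · obtain ⟨z, -, rfl⟩ := Finset.mem_map.1 hy
      have := (finProdFinEquiv z).2
      rw [Finset.mem_range, show 3 * (k * r) = r * (3 * k) by ring]
      exact this
    · rw [Finset.card_map, Finset.card_univ, Fintype.card_prod, Fintype.card_fin,
        Fintype.card_fin, Finset.card_range]
      exact le_of_eq (by ring)
  rw [h1, blockSet, blockSet, blockSet, ← Finset.map_union, ← Finset.map_union,
    (Finset.map_injective _).eq_iff]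
  simp only [Finset.ext_iff, Finset.mem_union, Finset.mem_filter, Finset.mem_univ, true_and,
    iff_true, Prod.forall]

/-- The tensor of tripartitions is concise. -/
theorem le_of_hasRankDecomposition {F : Type*} [Field F] {R : ℕ}
    (h : HasRankDecomposition (kroneckerPow (tripartitionTensor F k) r) R) :
    Fintype.card (Fin r → {S : Finset (Fin (3 * k)) // S.card = k}) ≤ R := by
  obtain ⟨a, b, c, h⟩ := h
  -- The first factors of the decomposition, read as one vector of length `R` for each `S`, are
  -- independent: a relation between them would be a relation between the slices of the tensor.
  have hli : LinearIndependent F fun (S : Fin r → {S : Finset (Fin (3 * k)) // S.card = k}) l =>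
      a l S := by
    rw [Fintype.linearIndependent_iff]
    intro x hx S
    -- Halving the complement of `S i` gives `T` and `U` which only `S i` completes to a cover. At
    -- these `T, U` the slice of `S` is `1` and all others vanish.
    have hex : ∀ i, ∃ T U : {S : Finset (Fin (3 * k)) // S.card = k},
        ∀ S' : {S : Finset (Fin (3 * k)) // S.card = k},
          S'.1 ∪ T.1 ∪ U.1 = Finset.univ ↔ S' = S i := by
      intro i
      have h1 : (S i).1ᶜ.card = 2 * k := by
        rw [Finset.card_compl, Fintype.card_fin, (S i).2]
        omega
      obtain ⟨T, hT, hTc⟩ := Finset.exists_subset_card_eq (show k ≤ (S i).1ᶜ.card by omega)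
      have h2 : ((S i).1ᶜ \ T).card = k := by
        rw [Finset.card_sdiff_of_subset hT]
        omega
      refine ⟨⟨T, hTc⟩, ⟨_, h2⟩, fun S' => ?_⟩
      have h3 : T ∪ ((S i).1ᶜ \ T) = (S i).1ᶜ := Finset.union_sdiff_of_subset hT
      rw [Finset.union_assoc]
      simp only [h3]
      constructor
      · intro h
        refine Subtype.ext (Finset.eq_of_subset_of_card_le (fun y hy => ?_) ?_).symm
        · have := Finset.mem_univ y
          rw [← h, Finset.mem_union, Finset.mem_compl] at this
          exact this.resolve_right (not_not.2 hy)
        · rw [S'.2, (S i).2]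
      · rintro rfl
        exact Finset.union_compl _
    choose T U hTU using hex
    have h1 : ∑ S', x S' * kroneckerPow (tripartitionTensor F k) r S' T U = 0 := by
      simp only [h, Finset.mul_sum]
      rw [Finset.sum_comm]
      refine Finset.sum_eq_zero fun l _ => ?_
      have := congrFun hx l
      simp only [Finset.sum_apply, Pi.smul_apply, smul_eq_mul, Pi.zero_apply] at this
      calc ∑ S', x S' * (a l S' * b l T * c l U) = (∑ S', x S' * a l S') * (b l T * c l U) := by
            rw [Finset.sum_mul]
            exact Finset.sum_congr rfl fun _ _ => by ring
        _ = 0 := by rw [this, zero_mul]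
    have h2 : ∀ S', kroneckerPow (tripartitionTensor F k) r S' T U = if S' = S then 1 else 0 := by
      intro S'
      rw [kroneckerPow_tripartitionTensor]
      simp only [hTU, ← funext_iff]
    simpa [h2] using h1
  simpa using hli.fintype_card_le_finrank

theorem exists_gadget_of_hasRankDecomposition (hk : 1 ≤ k) (hr : 1 ≤ r) {p R : ℕ} [Fact p.Prime]
    (h : HasRankDecomposition (kroneckerPow (tripartitionTensor (ZMod p) k) r) R) :
    ∃ g : Gadget, g.K = k * r ∧ g.R = R ∧ g.G = ((3 * k).choose k * (2 * k).choose k) ^ r := by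
  have hNR := le_of_hasRankDecomposition h
  obtain ⟨a, b, c, h⟩ := h
  have hcard : Fintype.card (Fin r → {S : Finset (Fin (3 * k)) // S.card = k}) =
      ((3 * k).choose k) ^ r := by
    simp [Fintype.card_finset_len]
  set N := Fintype.card (Fin r → {S : Finset (Fin (3 * k)) // S.card = k}) with hN
  have hN1 : 1 ≤ N := by
    rw [hcard]
    exact Nat.one_le_pow _ _ (Nat.choose_pos (by omega))
  let e := (Fintype.equivFin (Fin r → {S : Finset (Fin (3 * k)) // S.card = k})).symm
  -- The reduction modulo `N` makes the enumeration total: the fields of `Gadget` require some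
  -- bounds for all indices.
  let s : ℕ → (Fin r → {S : Finset (Fin (3 * k)) // S.card = k}) := fun i =>
    e ⟨i % N, Nat.mod_lt _ hN1⟩
  have hK : 1 ≤ k * r := Nat.mul_pos hk hr
  choose pos hpos hinj himage using fun i => Finset.exists_enum hK (card_blockSet (s i))
  have hs : ∀ S, ∃ i < N, s i = S := by
    intro S
    exact ⟨e.symm S, (e.symm S).2, (congrArg e (Fin.ext (Nat.mod_eq_of_lt (e.symm S).2))).trans
      (e.apply_symm_apply S)⟩
  let coef : ℕ → ℕ → ℕ → ℕ := fun f l i => if hl : l < R then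
    ((if f = 0 then a else if f = 1 then b else c) ⟨l, hl⟩ (s i)).val else 0
  refine ⟨⟨k * r, N, R, ((3 * k).choose k * (2 * k).choose k) ^ r, p, pos, coef, Fact.out, hK,
    hN1, ?_, hNR, ?_, hinj, ?_, ?_, ?_, ?_, ?_⟩, rfl, rfl, rfl⟩
  · exact Nat.one_le_pow _ _ (Nat.mul_pos (Nat.choose_pos (by omega)) (Nat.choose_pos (by omega)))
  · exact fun i j => Finset.mem_range.1 (blockSet_subset _ (hpos i j))
  · intro i hi j hj hij
    simp only [himage] at hij
    rw [Finset.coe_range, Set.mem_Iio] at hi hj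
    have := Fin.ext_iff.1 (e.injective (blockSet_injective hij))
    simpa [Nat.mod_eq_of_lt hi, Nat.mod_eq_of_lt hj] using this
  · intro f l i
    by_cases hl : l < R
    · rw [show coef f l i = _ from dif_pos hl]
      exact ZMod.val_lt _
    · rw [show coef f l i = 0 from dif_neg hl]
      exact (Fact.out : p.Prime).pos
  · intro i _ j _ l _
    rw [himage, himage, himage]
    simp only [blockSet_union]
    rw [← kroneckerPow_tripartitionTensor, h, Finset.sum_range]
    refine Finset.sum_congr rfl fun x _ => ?_
    simp [coef]
  · simp only [himage, blockSet_union]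
    have h1 : Fintype.card (Fin r → {t : Fin 3 → {S : Finset (Fin (3 * k)) // S.card = k} //
        (t 0).1 ∪ (t 1).1 ∪ (t 2).1 = Finset.univ}) ≥
          ((3 * k).choose k * (2 * k).choose k) ^ r := by
      rw [Fintype.card_pi, Finset.prod_const, Finset.card_univ, Fintype.card_fin]
      exact Nat.pow_le_pow_left (card_tripartition k) r
    refine h1.trans ?_
    choose j hj hj' using hs
    rw [← Finset.card_univ]
    refine Finset.card_le_card_of_injOn (fun t => (j fun i => (t i).1 0, j fun i => (t i).1 1,
      j fun i => (t i).1 2)) ?_ ?_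
    · intro t _
      simp only [Finset.coe_filter, Finset.mem_product, Finset.mem_range, Set.mem_ofPred_eq, hj,
        hj', and_self, true_and]
      exact fun i => (t i).2
    · intro t _ t' _ htt
      simp only [Prod.mk.injEq] at htt
      have e0 := congrArg s htt.1
      have e1 := congrArg s htt.2.1
      have e2 := congrArg s htt.2.2
      simp only [hj', funext_iff] at e0 e1 e2
      refine funext fun i => Subtype.ext (funext fun f => ?_)
      fin_cases f
      · exact e0 i
      · exact e1 i
      · exact e2 i
  -- Here `binom(2k,k) ≤ 4^k`: once the first set is fixed, there are at most `4^K` ways to complete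
  -- it.
  · rw [hcard, mul_pow, pow_mul]
    refine Nat.mul_le_mul_left _ (Nat.pow_le_pow_left ?_ r)
    refine (Nat.choose_le_two_pow _ _).trans (le_of_eq ?_)
    rw [pow_mul]
    norm_num

end Blocks

/-- Data for the algorithm that come close to the asymptotic rank. -/
theorem exists_gadget (F : Type*) [Field F] {k : ℕ} (hk : 1 ≤ k) {ρ : ℝ}
    (hρ : asymptoticRank (tripartitionTensor F k) < ρ) :
    ∃ (g : Gadget) (r : ℕ), 1 ≤ r ∧ g.K = k * r ∧ (g.R : ℝ) ≤ ρ ^ r ∧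
      g.G = ((3 * k).choose k * (2 * k).choose k) ^ r := by
  obtain ⟨p, r, R, hp, hr, hR, h⟩ := exists_hasRankDecomposition_zmod F k hρ
  have := Fact.mk hp
  obtain ⟨g, hg, rfl, hg'⟩ := exists_gadget_of_hasRankDecomposition hk hr (h this)
  exact ⟨g, r, hr, hg, hR, hg'⟩

/-! ### The running time -/

namespace Gadget

open TripartitioningInstance

variable (g : Gadget)

/-- The number of blocks for a universe of size `3 * n`. -/
def numBlocks (n : ℕ) : ℕ := (n + (g.K - 1)) / g.K

/-- A bound for the sizes of the loops that are not exponentially long. -/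
def scale (m : ℕ) : ℕ := (g.K + g.N + g.R + g.G + g.p + 27 ^ g.K) * (m + 1)

/-- The bit length of the numbers. -/
def wordLength (m : ℕ) : ℕ := 10 * g.scale m * g.scale m

/-- Bounds for the lengths of the loops. -/
def loopBound (n m : ℕ) : Var → ℕ
  | .loopPow => 3 * g.K * m
  | .loopInput => (3 * n).choose n
  | .loopTrial => g.numTrials m
  | .loopBit => 3 * g.K * m * (3 * g.K * m)
  | .loopPos => 3 * g.K * m
  | .loopBlock => m
  | .loopIdx => g.N ^ m
  | .loopGood => g.N
  | .loopElt => g.K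
  | .loopOut => g.R ^ m
  | .fam => 3
  | _ => 0

variable {g} {n m : ℕ}

theorem le_mul_numBlocks (n : ℕ) : n ≤ g.K * g.numBlocks n := by
  have h1 := Nat.div_add_mod (n + (g.K - 1)) g.K
  have h2 := Nat.mod_lt (n + (g.K - 1)) g.K_pos
  rw [numBlocks]
  omega

theorem mul_numBlocks_le (n : ℕ) : g.K * g.numBlocks n ≤ n + g.K := by
  have h1 := Nat.div_add_mod (n + (g.K - 1)) g.K
  rw [numBlocks]
  omega

theorem le_scale (m : ℕ) : g.K ≤ g.scale m ∧ g.N ≤ g.scale m ∧ g.R ≤ g.scale m ∧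
    g.G ≤ g.scale m ∧ g.p ≤ g.scale m ∧ 27 ^ g.K ≤ g.scale m ∧ m ≤ g.scale m ∧
    g.K * m ≤ g.scale m ∧ 27 ≤ g.scale m := by
  have hK := g.K_pos
  have h27 : 27 ≤ 27 ^ g.K := Nat.le_self_pow (by omega) 27
  have h1 : g.K + g.N + g.R + g.G + g.p + 27 ^ g.K ≤ g.scale m :=
    Nat.le_mul_of_pos_right _ (by omega)
  have h2 : g.K * m ≤ g.scale m := Nat.mul_le_mul (by omega) (by omega)
  have h3 : m ≤ g.K * m := Nat.le_mul_of_pos_left _ hK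
  omega

/-- A base of size at most `D` is below `2 ^ D`, and `scale m` is `D * (m + 1)`. So each
exponentially large quantity is bounded by one and the same power of two. -/
theorem pow_le_two_pow_scale {b : ℕ} (hb : b ≤ g.K + g.N + g.R + g.G + g.p + 27 ^ g.K) (m : ℕ) :
    b ^ m ≤ 2 ^ g.scale m := by
  rw [scale, pow_mul]
  refine (Nat.pow_le_pow_left (hb.trans Nat.lt_two_pow_self.le) m).trans ?_
  exact Nat.pow_le_pow_right (Nat.pow_pos two_pos) (by omega)

theorem R_pow_le (m : ℕ) : g.R ^ m ≤ 2 ^ g.scale m :=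
  pow_le_two_pow_scale (by generalize 27 ^ g.K = y; omega) m

theorem N_pow_le (m : ℕ) : g.N ^ m ≤ g.R ^ m := Nat.pow_le_pow_left g.N_le_R m

theorem G_pow_le (m : ℕ) : g.G ^ m ≤ 2 ^ g.scale m :=
  pow_le_two_pow_scale (by generalize 27 ^ g.K = y; omega) m

theorem total_le (m : ℕ) : (27 ^ g.K) ^ m ≤ 2 ^ g.scale m :=
  pow_le_two_pow_scale (by generalize 27 ^ g.K = y; omega) m

theorem numTrials_le (m : ℕ) : g.numTrials m ≤ 64 * 2 ^ g.scale m := by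
  have h1 := Nat.div_le_self ((27 ^ g.K) ^ m) (g.G ^ m)
  have h2 := g.total_le m
  have h3 : 1 ≤ 2 ^ g.scale m := Nat.one_le_two_pow
  rw [numTrials]
  omega

theorem two_pow_scale_pow_lt (m : ℕ) : (2 ^ g.scale m) ^ 6 < 2 ^ g.wordLength m := by
  rw [← pow_mul, wordLength]
  refine Nat.pow_lt_pow_right (by omega) ?_
  obtain ⟨-, -, -, -, -, -, -, -, h⟩ := g.le_scale m
  nlinarith

theorem le_two_pow_scale (m : ℕ) : 2 ^ 27 ≤ 2 ^ g.scale m := by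
  obtain ⟨-, -, -, -, -, -, -, -, h⟩ := g.le_scale m
  exact Nat.pow_le_pow_right (by omega) h

/-- The constant is absorbed by a sixth factor `2 ^ scale`, as `scale ≥ 27`; and six factors fit,
since `6 * scale < 10 * scale ^ 2`. -/
theorem mul_lt_two_pow_wordLength {c i x : ℕ} (m : ℕ) (hi : i ≤ 5) (hc : c < 2 ^ 27)
    (hx : x ≤ c * (2 ^ g.scale m) ^ i) : x < 2 ^ g.wordLength m := by
  have h1 := g.le_two_pow_scale m
  have h2 : (2 ^ g.scale m) ^ i ≤ (2 ^ g.scale m) ^ 5 := Nat.pow_le_pow_right (by omega) hi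
  have h3 : 0 < (2 ^ g.scale m) ^ 5 := by positivity
  calc x ≤ c * (2 ^ g.scale m) ^ 5 := hx.trans (Nat.mul_le_mul_left _ h2)
    _ ≤ 2 ^ g.scale m * (2 ^ g.scale m) ^ 5 := Nat.mul_le_mul_right _ (by omega)
    _ = (2 ^ g.scale m) ^ 6 := by ring
    _ < _ := g.two_pow_scale_pow_lt m

theorem two_pow_mul_le (m : ℕ) : 2 ^ (3 * g.K * m) ≤ (2 ^ g.scale m) ^ 3 := by
  rw [← pow_mul]
  obtain ⟨-, -, -, -, -, -, -, h, -⟩ := g.le_scale m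
  refine Nat.pow_le_pow_right (by omega) ?_
  rw [mul_assoc, mul_comm (g.scale m)]
  omega

/-- The word length is quadratic because of the seed, which has `(3Km)^2 ≤ 9 * scale ^ 2` bits. All
other numbers have only linearly many bits in `scale`. -/
theorem fits {L : ℕ} (hL : L ≤ 4 + 3 * 2 ^ (3 * g.K * m)) :
    g.Fits m L (g.numTrials m) (g.wordLength m) (g.loopBound n m) := by
  obtain ⟨hK, hN, hR, hG, hp, h27, hm, hKm, h1⟩ := g.le_scale m
  have hE : g.scale m < 2 ^ g.scale m := Nat.lt_two_pow_self
  have hX := g.two_pow_mul_le m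
  have hZ := g.le_two_pow_scale m
  have hR' := g.R_pow_le m
  have hM := g.numTrials_le m
  set Z := 2 ^ g.scale m with hZdef
  have e1 : Z ≤ Z ^ 5 := Nat.le_self_pow (by omega) Z
  have e3 : Z ^ 3 ≤ Z ^ 5 := Nat.pow_le_pow_right (by omega) (by omega)
  have e2 : Z ^ 2 ≤ Z ^ 5 := Nat.pow_le_pow_right (by omega) (by omega)
  have hsq : ∀ a b, a ≤ g.scale m → b ≤ g.scale m → a * b ≤ Z ^ 2 := fun a b ha hb => by
    rw [sq]
    exact Nat.mul_le_mul (by omega) (by omega)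
  have fit : ∀ x, x ≤ 10000 * Z ^ 5 → x < 2 ^ g.wordLength m := fun x hx =>
    g.mul_lt_two_pow_wordLength m (le_refl 5) (by norm_num) hx
  refine ⟨?_, fit _ ?_, fit _ ?_, fit _ ?_, fit _ ?_, fit _ ?_, fit _ ?_, fit _ ?_, fit _ ?_,
    fit _ ?_, fit _ ?_, le_rfl, le_rfl, le_rfl, le_rfl, le_rfl, le_rfl, le_rfl, le_rfl⟩
  · have := Nat.mul_le_mul hKm hKm
    rw [wordLength, mul_assoc 3]
    nlinarith
  · have : m * g.K * 2 ^ (3 * g.K * m) ≤ Z ^ 5 := by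
      calc _ ≤ Z ^ 2 * Z ^ 3 := Nat.mul_le_mul (hsq _ _ hm hK) hX
        _ = _ := by ring
    omega
  · rw [mul_assoc 3]
    omega
  · have := hsq _ _ hm hN
    omega
  · calc g.K * 2 ^ (3 * g.K * m) ≤ Z ^ 2 * Z ^ 3 := Nat.mul_le_mul (by nlinarith) hX
      _ = Z ^ 5 := by ring
      _ ≤ _ := by omega
  · omega
  · have := hsq _ _ hR hN
    rw [mul_assoc 3]
    omega
  · have := hsq _ _ hN hK
    omega
  · have := hsq _ _ hp hp
    omega
  · calc g.numTrials m * g.p ≤ (64 * Z) * Z := Nat.mul_le_mul hM (by omega)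
      _ = 64 * Z ^ 2 := by ring
      _ ≤ _ := by omega
  · omega

theorem fitsSetup {L : ℕ} (hn : n ≤ g.K * m) (hL : L ≤ 4 + 3 * 2 ^ (3 * g.K * m)) :
    g.FitsSetup n m L (g.wordLength m) (g.loopBound n m) := by
  obtain ⟨hK, hN, hR, hG, hp, h27, hm, hKm, h1⟩ := g.le_scale m
  have hE : g.scale m < 2 ^ g.scale m := Nat.lt_two_pow_self
  have hX := g.two_pow_mul_le m
  have hZ := g.le_two_pow_scale m
  have hG' := g.G_pow_le m
  have hT := g.total_le m
  have hM := g.numTrials_le m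
  set Z := 2 ^ g.scale m with hZdef
  have e1 : Z ≤ Z ^ 5 := Nat.le_self_pow (by omega) Z
  have e3 : Z ^ 3 ≤ Z ^ 5 := Nat.pow_le_pow_right (by omega) (by omega)
  have fit : ∀ x, x ≤ 10000 * Z ^ 5 → x < 2 ^ g.wordLength m := fun x hx =>
    g.mul_lt_two_pow_wordLength m (le_refl 5) (by norm_num) hx
  refine ⟨fit _ ?_, fit _ ?_, fit _ ?_, fit _ ?_, fit _ ?_, fit _ ?_, fit _ ?_, le_rfl⟩
  · rw [mul_assoc 3]
    rw [mul_assoc 3] at hL hX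
    omega
  · omega
  · omega
  · omega
  · omega
  · omega
  · have : 32 * ((27 ^ g.K) ^ m / g.G ^ m + 1) = g.numTrials m := rfl
    omega

theorem cost_writeTable (β : Var → ℕ) (a : Arr) (t : ℕ → ℕ) (i : ℕ) :
    (writeTable a t i).cost β = 3 + 7 * i := by
  induction i with
  | zero => rfl
  | succ i ih =>
    simp only [writeTable, Cmd.cost, ih, Expr.cost_lit]
    ring

/-- The number of steps of a trial. -/
theorem cost_trial_le (hm : 1 ≤ g.R ^ m) :
    g.trial.cost (g.loopBound n m) ≤ 1200 * (g.scale m ^ 3 * g.R ^ m) := by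
  obtain ⟨hK, hN, -, -, -, -, hm', hKm, h1⟩ := g.le_scale m
  have hI := g.N_pow_le m
  set E := g.scale m
  set r := g.R ^ m
  have h2 : g.trial.cost (g.loopBound n m) ≤ 40 + 9 * (E * E) * 15 + 3 * E * 75 + E * 7 +
      E * E * 24 + E * E * E * 32 + E * E * r * 3 * 48 + E * r * 3 * 38 + E * 3 * 27 +
      E * 3 * r * 30 + r * 32 + r * 3 * 29 + 3 * 18 + 3 * r * 41 := by
    have e1 : 3 * g.K * m * (3 * g.K * m) ≤ 9 * (E * E) := by
      have := Nat.mul_le_mul hKm hKm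
      rw [mul_assoc 3]
      nlinarith
    have e2 : 3 * g.K * m ≤ 3 * E := by
      rw [mul_assoc 3]
      omega
    refine le_trans (le_of_eq ?_) (show 40 + 3 * g.K * m * (3 * g.K * m) * 15 + 3 * g.K * m * 75 +
      m * 7 + m * g.N * 24 + m * g.N * g.K * 32 + m * g.N * r * 3 * 48 + m * r * 3 * 38 +
      m * 3 * 27 + m * 3 * g.N ^ m * 30 + r * 32 + r * 3 * 29 + 3 * 18 + 3 * g.N ^ m * 41 ≤ _ by
        gcongr)
    simp only [trial, drawSeed, initPerm, permute, blockMasks, fill, computeMask, yates, yatesRound,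
      accumulate, Cmd.cost, Expr.cost_lit, Expr.cost_var, Expr.cost_get, Expr.cost_add,
      Expr.cost_mul, Expr.cost_div, Expr.cost_mod, loopBound]
    ring
  refine h2.trans ?_
  -- Both variables are at least one. After shifting them by one, the difference of the two
  -- polynomials has nonnegative coefficients only.
  obtain ⟨x, hx⟩ : ∃ x, E = x + 1 := ⟨E - 1, by omega⟩
  obtain ⟨y, hy⟩ : ∃ y, r = y + 1 := ⟨r - 1, by omega⟩
  rw [hx, hy]
  zify
  rw [← sub_nonneg]
  ring_nf
  positivity

/-- The number of steps of the algorithm. -/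
theorem cost_algorithm_le : g.algorithm.cost (g.loopBound n m) ≤
    2000 * (g.scale m ^ 3 * (g.numTrials m * g.R ^ m + (3 * n).choose n)) := by
  obtain ⟨hK, hN, hR, -, -, -, hm', hKm, h1⟩ := g.le_scale m
  have hR0 : 1 ≤ g.R ^ m := Nat.one_le_pow _ _ (g.N_pos.trans g.N_le_R)
  have ht := g.cost_trial_le (n := n) hR0
  have hB : 1 ≤ (3 * n).choose n := Nat.choose_pos (by omega)
  set E := g.scale m
  set r := g.R ^ m
  set M := g.numTrials m with hM
  set B := (3 * n).choose n with hB'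
  have h2 : g.algorithm.cost (g.loopBound n m) ≤ 182 + 3 * E * 66 + 3 * B * 33 + 7 * (E * E) +
      7 * (3 * E * E) + M * (1200 * (E ^ 3 * r) + 5 * r) + 6 := by
    have e2 : 3 * g.K * m ≤ 3 * E := by
      rw [mul_assoc 3]
      omega
    refine le_trans (le_of_eq ?_) (show 182 + 3 * g.K * m * 66 + 3 * B * 33 + 7 * (g.N * g.K) +
      7 * (3 * g.R * g.N) + M * (g.trial.cost (g.loopBound n m) + 5 * 1) + 6 ≤ _ by gcongr)
    simp only [algorithm, params, power, readInput, cost_writeTable, Cmd.cost, Expr.cost_lit,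
      Expr.cost_var, Expr.cost_cell, Expr.cost_add, Expr.cost_sub, Expr.cost_mul, Expr.cost_div]
    simp only [loopBound]
    ring
  refine h2.trans ?_
  obtain ⟨x, hx⟩ : ∃ x, E = x + 1 := ⟨E - 1, by omega⟩
  obtain ⟨y, hy⟩ : ∃ y, r = y + 1 := ⟨r - 1, by omega⟩
  obtain ⟨z, hz⟩ : ∃ z, B = z + 1 := ⟨B - 1, by omega⟩
  rw [hx, hy, hz]
  zify
  rw [← sub_nonneg]
  ring_nf
  positivity

/-- A bound for the running time. -/
def timeBound (g : Gadget) (n m : ℕ) : ℕ :=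
  g.algorithm.cost (g.loopBound n m) * (g.wordLength m + 1) ^ 2 +
    g.numTrials m * g.trialCoins m

/-- The exponent `7`: three factors `scale` from the number of steps, and four from the square of
the quadratic word length. -/
theorem timeBound_le : g.timeBound n m ≤
    1000000 * (g.scale m ^ 7 * (g.numTrials m * g.R ^ m + (3 * n).choose n)) := by
  have h1 := g.cost_algorithm_le (n := n) (m := m)
  obtain ⟨hK, hN, hR, -, -, -, hm', hKm, h27⟩ := g.le_scale m
  have hR0 : 1 ≤ g.R ^ m := Nat.one_le_pow _ _ (g.N_pos.trans g.N_le_R)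
  have h2 : g.trialCoins m ≤ 12 * (g.scale m ^ 7 * g.R ^ m) := by
    have e1 : 3 * g.K * m * (3 * g.K * m) ≤ 9 * g.scale m ^ 2 := by
      have := Nat.mul_le_mul hKm hKm
      rw [mul_assoc 3]
      nlinarith
    have e2 : g.scale m ^ 2 ≤ g.scale m ^ 7 := Nat.pow_le_pow_right (by omega) (by omega)
    have e3 : g.scale m ^ 7 * 1 ≤ g.scale m ^ 7 * g.R ^ m := Nat.mul_le_mul_left _ hR0
    have e4 : 1 * g.R ^ m ≤ g.scale m ^ 7 * g.R ^ m :=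
      Nat.mul_le_mul_right _ (Nat.one_le_pow _ _ (by omega))
    have := g.N_pow_le m
    rw [trialCoins]
    omega
  have h3 : (g.wordLength m + 1) ^ 2 ≤ 121 * g.scale m ^ 4 := by
    calc (g.wordLength m + 1) ^ 2 ≤ (11 * g.scale m ^ 2) ^ 2 := by
          refine Nat.pow_le_pow_left ?_ 2
          rw [wordLength]
          nlinarith
      _ = _ := by ring
  set E := g.scale m
  set r := g.R ^ m
  set M := g.numTrials m with hM
  set B := (3 * n).choose n with hB'
  calc g.timeBound n m ≤ 2000 * (E ^ 3 * (M * r + B)) * (121 * E ^ 4) + M * (12 * (E ^ 7 * r)) := by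
        rw [timeBound]
        gcongr
    _ ≤ 242000 * (E ^ 7 * (M * r + B)) + 12 * (E ^ 7 * (M * r + B)) := by
        refine Nat.add_le_add (le_of_eq (by ring)) ?_
        calc M * (12 * (E ^ 7 * r)) = 12 * (E ^ 7 * (M * r)) := by ring
          _ ≤ _ := by gcongr; omega
    _ ≤ _ := by
        generalize E ^ 7 * (M * r + B) = x
        omega

end Gadget

/-! ### Correctness of the algorithm -/

namespace TripartitioningInstance

variable {n : ℕ} (I : TripartitioningInstance n)

theorem bitmask_lt (S : Finset (Fin (3 * n))) : bitmask S < 2 ^ (3 * n) := by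
  have h : bitmask S = ∑ i ∈ S.map Fin.valEmbedding, 2 ^ i := by
    rw [Finset.sum_map]
    rfl
  rw [h]
  refine Nat.geomSum_lt le_rfl fun i hi => ?_
  obtain ⟨j, -, rfl⟩ := Finset.mem_map.1 hi
  exact j.2

theorem length_fam_le (f : Fin 3) : (I.fam f).length ≤ (3 * n).choose n := by
  rw [← List.toFinset_card_of_nodup (I.nodup f)]
  have : (Finset.powersetCard n (Finset.univ : Finset (Fin (3 * n)))).card = (3 * n).choose n := by
    rw [Finset.card_powersetCard, Finset.card_univ, Fintype.card_fin]
  rw [← this]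
  refine Finset.card_le_card fun S hS => ?_
  rw [Finset.mem_powersetCard]
  exact ⟨Finset.subset_univ _, I.card_eq f S (List.mem_toFinset.1 hS)⟩

theorem encode_eq : I.encode = n :: (I.masks 0).length :: (I.masks 1).length ::
    (I.masks 2).length :: (I.masks 0 ++ (I.masks 1 ++ I.masks 2)) := by
  simp [encode, masks]

theorem length_masks_le {f : ℕ} (hf : f < 3) : (I.masks f).length ≤ (3 * n).choose n := by
  rw [masks, dif_pos hf, List.length_map]
  exact I.length_fam_le _

theorem isInput_encode : Gadget.IsInput n I.encode.length I.masks fun a => I.encode.getD a 0 := by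
  refine ⟨by simp [encode_eq], fun f hf => ?_, ?_, fun f hf i hi => ?_, fun i hi => ?_,
    fun f hf b hb => ?_⟩
  · interval_cases f <;> simp [encode_eq]
  · rw [encode_eq]
    simp only [List.length_cons, List.length_append]
    ring
  · rw [encode_eq]
    have e : ∀ j, 4 + j = j + 1 + 1 + 1 + 1 := fun j => by ring
    rw [add_assoc, e]
    simp only [List.getD_cons_succ]
    interval_cases f
    · rw [Finset.sum_range_zero, zero_add, List.getD_append _ _ _ _ hi]
    · rw [Finset.sum_range_one, List.getD_append_right _ _ _ _ (by omega),
        Nat.add_sub_cancel_left, List.getD_append _ _ _ _ hi]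
    · rw [Finset.sum_range_succ, Finset.sum_range_one, List.getD_append_right _ _ _ _ (by omega),
        List.getD_append_right _ _ _ _ (by omega)]
      congr 1
      omega
  · exact List.getD_eq_default _ _ hi
  · obtain ⟨S, -, rfl⟩ := (I.mem_masks (f := ⟨f, hf⟩)).1 hb
    exact bitmask_lt S

end TripartitioningInstance

namespace Gadget

variable (g : Gadget)

/-- The program of the algorithm. -/
def program : RAMProg := g.algorithm.compile 0

variable {g} {n : ℕ}

theorem exec_program (I : TripartitioningInstance n) {t : ℕ}
    (ht : g.timeBound n (g.numBlocks n) ≤ t) (ω : Fin t → Bool) :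
    ∃ s' τ, RAMExec g.program (RAMState.start I.encode ω) s' τ ∧ τ ≤ t ∧
      (s'.reg 0 ≠ 0 ↔ ∃ i < g.numTrials (g.numBlocks n), g.trialOf (g.numBlocks n)
        (tableOf n (g.K * g.numBlocks n - n) I.masks)
        ((List.ofFn ω).drop (i * g.trialCoins (g.numBlocks n))) ≠ 0) := by
  have hn := g.le_mul_numBlocks n
  have hI := I.isInput_encode
  set m := g.numBlocks n with hm
  let s : Store := ⟨fun _ => 0, fun a => I.encode.getD a 0, List.ofFn ω⟩
  have hchoose : (3 * n).choose n ≤ 2 ^ (3 * g.K * m) :=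
    (Nat.choose_le_two_pow _ _).trans (Nat.pow_le_pow_right two_pos (by rw [mul_assoc]; omega))
  have hlen : I.encode.length ≤ 4 + 3 * 2 ^ (3 * g.K * m) := by
    rw [hI.len]
    have h0 := I.length_masks_le (f := 0) (by omega)
    have h1 := I.length_masks_le (f := 1) (by omega)
    have h2 := I.length_masks_le (f := 2) (by omega)
    omega
  have hfs := g.fitsSetup hn hlen
  have hcoins : g.numTrials m * g.trialCoins m ≤ s.coins.length := by
    rw [List.length_ofFn]
    exact (Nat.le_add_left _ _).trans ht
  have hbdd : s.Bdd (g.wordLength m) := by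
    refine ⟨fun _ => Nat.two_pow_pos _, fun c => ?_⟩
    have hdim := hfs.dim
    have hlt : 2 ^ (3 * n) ≤ 2 ^ g.wordLength m := by
      refine le_trans (Nat.pow_le_pow_right two_pos (show 3 * n ≤ 3 * g.K * m by
        rw [mul_assoc]; omega)) ?_
      have := hfs.table
      omega
    show I.encode.getD c 0 < _
    by_cases hc : c < I.encode.length
    · have hmem : I.encode.getD c 0 ∈ I.encode := by
        rw [List.getD_eq_getElem _ _ hc]
        exact List.getElem_mem hc
      have hL := hI.len
      generalize I.encode.getD c 0 = x at hmem
      rw [I.encode_eq] at hmem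
      simp only [List.mem_cons, List.mem_append] at hmem
      rcases hmem with rfl | rfl | rfl | rfl | h | h | h
      · omega
      · omega
      · omega
      · omega
      · exact (hI.lt 0 (by omega) _ h).trans_le hlt
      · exact (hI.lt 1 (by omega) _ h).trans_le hlt
      · exact (hI.lt 2 (by omega) _ h).trans_le hlt
    · rw [List.getD_eq_default _ _ (by omega)]
      exact Nat.two_pow_pos _
  obtain ⟨σ', s', ⟨τ, hτ, hexec⟩, hrep, -, -, h⟩ := runs_algorithm (g := g) (s := s) rfl rfl
    (g.fits hlen) hfs hI (fun f hf => I.length_masks_le hf) le_rfl hcoins rfl hbdd 0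
    (RAMState.start I.encode ω) ⟨fun _ => rfl, rfl, rfl⟩
  refine ⟨σ', τ, hexec, hτ.trans ((Nat.le_add_right _ _).trans ht), ?_⟩
  have hres := hrep.var .res
  -- `res` is the first variable, so it occupies register `0`, where the machine expects the answer.
  rw [show 2 * Var.res.idx = 0 from rfl] at hres
  rw [hres]
  exact h

theorem decidesWithin (g : Gadget) (I : TripartitioningInstance n) :
    DecidesWithin g.program I.encode I.HasTripartition (g.timeBound n (g.numBlocks n)) := by
  have hn := g.le_mul_numBlocks n
  have hprob := coinProb.acceptProb_eq g.program I.encode (g.timeBound n (g.numBlocks n))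
    (E := fun l => ∃ i < g.numTrials (g.numBlocks n), g.trialOf (g.numBlocks n)
        (tableOf n (g.K * g.numBlocks n - n) I.masks)
        (l.drop (i * g.trialCoins (g.numBlocks n))) ≠ 0) fun ω => by
    obtain ⟨s', τ, h1, -, h2⟩ := exec_program I le_rfl ω
    rw [← h2]
    constructor
    · rintro ⟨s'', τ', h3, h4⟩
      rwa [h1.unique h3]
    · exact fun h => ⟨s', τ, h1, h⟩
  refine ⟨fun ω => ?_, fun hno => ?_, fun hyes => ?_⟩
  · obtain ⟨s', τ, h1, h2, -⟩ := exec_program I le_rfl ω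
    exact ⟨s', τ, h1, h2⟩
  · rw [hprob, coinProb.congr (B := fun _ => False), coinProb.const, if_neg id]
    intro l _
    refine iff_of_false ?_ id
    rintro ⟨i, -, hi⟩
    exact hno (hasTripartition_of_trialOf_ne_zero I hn hi)
  · rw [hprob]
    exact le_coinProb_exists I hn hyes (Nat.le_add_left _ _)

end Gadget

/-! ### Asymptotics -/

/-- A single term of the binomial expansion of `(1 + 2) ^ (3 * n)`. -/
theorem choose_three_mul_mul_le (n : ℕ) : (3 * n).choose n * 4 ^ n ≤ 27 ^ n := by
  have h := add_pow (1 : ℕ) 2 (3 * n)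
  simp only [Nat.cast_id] at h
  have h1 := Finset.single_le_sum (f := fun i => 1 ^ i * 2 ^ (3 * n - i) * (3 * n).choose i)
    (fun _ _ => Nat.zero_le _) (Finset.mem_range.2 (show n < 3 * n + 1 by omega))
  rw [← h] at h1
  norm_num [pow_mul] at h1
  rw [show 3 * n - n = 2 * n by omega, pow_mul, mul_comm] at h1
  exact h1

theorem choose_mul_choose_le (k : ℕ) : (3 * k).choose k * (2 * k).choose k ≤ 27 ^ k := by
  refine (Nat.mul_le_mul_left _ ?_).trans (choose_three_mul_mul_le k)
  refine (Nat.choose_le_two_pow _ _).trans (le_of_eq ?_)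
  rw [pow_mul]
  norm_num

namespace Gadget

variable {g : Gadget} {n m : ℕ}

/-- The growth rate of the running time per block. -/
noncomputable def rate (g : Gadget) : ℝ := 27 ^ g.K * g.R / g.G

/-- From `G ≤ N * 4 ^ K` and conciseness `N ≤ R`. This makes the time for reading the input harmless
and shows that the rate is at least one. -/
theorem le_rate (g : Gadget) : (27 / 4 : ℝ) ^ g.K ≤ g.rate := by
  have hG : (0 : ℝ) < g.G := by exact_mod_cast g.G_pos
  have h1 : (g.G : ℝ) ≤ g.R * 4 ^ g.K := by
    exact_mod_cast g.G_le.trans (Nat.mul_le_mul_right _ g.N_le_R)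
  rw [rate, div_pow, div_le_div_iff₀ (by positivity) hG, mul_assoc]
  gcongr

theorem one_le_rate (g : Gadget) : 1 ≤ g.rate :=
  (one_le_pow₀ (by norm_num)).trans g.le_rate

theorem choose_le_rate_pow (hn : n ≤ g.K * m) : ((3 * n).choose n : ℝ) ≤ g.rate ^ m := by
  have h : ((3 * n).choose n : ℝ) * 4 ^ n ≤ 27 ^ n := by exact_mod_cast choose_three_mul_mul_le n
  calc ((3 * n).choose n : ℝ) ≤ (27 / 4) ^ n := by
        rw [div_pow, le_div_iff₀ (by positivity)]
        exact h
    _ ≤ (27 / 4) ^ (g.K * m) := pow_le_pow_right₀ (by norm_num) hn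
    _ ≤ g.rate ^ m := by
        rw [pow_mul]
        exact pow_le_pow_left₀ (by positivity) g.le_rate m

/-- As `G ≤ 27 ^ K`, the quotient in the number of trials is at least one, so the added `1` at most
doubles it. -/
theorem numTrials_mul_le (hG : g.G ≤ 27 ^ g.K) (m : ℕ) :
    (g.numTrials m * g.R ^ m : ℝ) ≤ 64 * g.rate ^ m := by
  have hG0 : (0 : ℝ) < g.G := by exact_mod_cast g.G_pos
  have h1 : ((((27 ^ g.K) ^ m / g.G ^ m : ℕ) : ℕ) : ℝ) ≤ (27 ^ g.K) ^ m / g.G ^ m := by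
    have := @Nat.cast_div_le ℝ _ _ _ ((27 ^ g.K) ^ m) (g.G ^ m)
    exact_mod_cast this
  have h2 : (1 : ℝ) ≤ (27 ^ g.K) ^ m / g.G ^ m := by
    rw [← div_pow]
    refine one_le_pow₀ ((one_le_div hG0).2 (by exact_mod_cast hG))
  have h3 : (g.numTrials m : ℝ) ≤ 64 * ((27 ^ g.K) ^ m / g.G ^ m) := by
    rw [numTrials]
    push_cast
    linarith
  calc (g.numTrials m * g.R ^ m : ℝ) ≤ 64 * ((27 ^ g.K) ^ m / g.G ^ m) * g.R ^ m := by gcongr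
    _ = 64 * g.rate ^ m := by
        rw [rate, div_pow, mul_pow]
        ring

theorem timeBound_le_rate_pow (hG : g.G ≤ 27 ^ g.K) (hn : n ≤ g.K * m) :
    (g.timeBound n m : ℝ) ≤ 65000000 * (g.scale m : ℝ) ^ 7 * g.rate ^ m := by
  have h1 : (g.timeBound n m : ℝ) ≤
      1000000 * (g.scale m ^ 7 * (g.numTrials m * g.R ^ m + (3 * n).choose n)) := by
    exact_mod_cast g.timeBound_le
  have h2 := numTrials_mul_le hG m
  have h3 := choose_le_rate_pow hn
  calc (g.timeBound n m : ℝ) ≤ 1000000 * (g.scale m ^ 7 * (64 * g.rate ^ m + g.rate ^ m)) :=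
        h1.trans (by gcongr)
    _ = _ := by ring

end Gadget

/-- A polynomial factor does not matter for the growth rate. -/
theorem eventually_pow_mul_rpow_le {a b k : ℝ} (ha : 0 < a) (hab : a < b) (hk : 0 < k) (C : ℝ)
    (d : ℕ) : ∀ᶠ n : ℕ in atTop,
      C * ((n + 2 : ℕ) : ℝ) ^ d * a ^ ((n : ℝ) / k) ≤ b ^ ((n : ℝ) / k) := by
  have hb : 0 < b := ha.trans hab
  set q := (b / a) ^ (1 / k) with hq
  have hq1 : 1 < q := Real.one_lt_rpow ((one_lt_div ha).2 hab) (by positivity)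
  -- The shift by two matches the base `n + 2` of the polynomial factor; `q ^ 2` compensates for it
  -- in the denominator.
  have hlim := ((tendsto_pow_const_div_const_pow_of_one_lt d hq1).comp
    (tendsto_add_atTop_nat 2)).const_mul (C * q ^ 2)
  rw [mul_zero] at hlim
  filter_upwards [hlim.eventually_le_const zero_lt_one] with n hn
  have hqn : q ^ n * a ^ ((n : ℝ) / k) = b ^ ((n : ℝ) / k) := by
    rw [hq, ← Real.rpow_natCast, ← Real.rpow_mul (by positivity), one_div_mul_eq_div,
      Real.div_rpow hb.le ha.le, div_mul_cancel₀]
    exact (Real.rpow_pos_of_pos ha _).ne'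
  rw [← hqn]
  refine mul_le_mul_of_nonneg_right ?_ (by positivity)
  have hq0 : 0 < q := by linarith
  rw [Function.comp_apply, pow_add] at hn
  have e : C * q ^ 2 * (((n + 2 : ℕ) : ℝ) ^ d / (q ^ n * q ^ 2)) =
      C * ((n + 2 : ℕ) : ℝ) ^ d / q ^ n := by
    field_simp
  rw [e, div_le_one (by positivity)] at hn
  exact hn

theorem theorem1 (F : Type*) [Field F] (k : ℕ) (hk : 1 ≤ k) (ε : ℝ) (hε : 0 < ε) :
    ∃ (P : RAMProg) (time : ℕ → ℕ),
      (∀ (n : ℕ) (I : TripartitioningInstance n),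
        DecidesWithin P I.encode I.HasTripartition (time n)) ∧
      ∀ᶠ n : ℕ in atTop,
        (time n : ℝ) ≤
          ((asymptoticRank (tripartitionTensor F k) + ε) * 27 ^ k /
            (((3 * k).choose k : ℝ) * ((2 * k).choose k : ℝ))) ^ ((n : ℝ) / (k : ℝ)) := by
  -- Half of `ε` pays for the passage from the asymptotic rank to a fixed power, the other half for
  -- the polynomial factor.
  obtain ⟨g, r, hr, hK, hR, hG⟩ := exists_gadget F hk
    (ρ := asymptoticRank (tripartitionTensor F k) + ε / 2) (by linarith)
  refine ⟨g.program, fun n => g.timeBound n (g.numBlocks n), fun n I => g.decidesWithin I, ?_⟩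
  set ρ := asymptoticRank (tripartitionTensor F k)
  have hc1 : (0 : ℝ) < (3 * k).choose k := by exact_mod_cast Nat.choose_pos (by omega)
  have hc2 : (0 : ℝ) < (2 * k).choose k := by exact_mod_cast Nat.choose_pos (by omega)
  set c := ((3 * k).choose k : ℝ) * ((2 * k).choose k : ℝ) with hc
  have hc0 : 0 < c := mul_pos hc1 hc2
  have hGle : g.G ≤ 27 ^ g.K := by
    rw [hG, hK, pow_mul]
    exact Nat.pow_le_pow_left (choose_mul_choose_le k) r
  have hG' : (g.G : ℝ) = c ^ r := by
    rw [hG, hc]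
    push_cast
    rfl
  set a := (ρ + ε / 2) * 27 ^ k / c with ha
  have hρ : 0 ≤ ρ := ge_of_tendsto' (tendsto_asymptoticRank _) fun r => by positivity
  have ha0 : 0 < a := by positivity
  have hab : a < (ρ + ε) * 27 ^ k / c := by
    rw [ha]
    gcongr
    linarith
  have hrate : g.rate ≤ a ^ r := by
    rw [Gadget.rate, hG', hK, ha, div_pow, mul_pow, pow_mul, mul_comm]
    gcongr
    rw [mul_pow]
    gcongr
  -- Needed because of the rounding: the exponent `r * m` may exceed `n / k` by up to `r`, and only
  -- for a base of at least one does a larger exponent give an upper bound.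
  have ha1 : 1 ≤ a := by
    by_contra! h
    exact absurd (g.one_le_rate.trans hrate) (not_le.2 (pow_lt_one₀ ha0.le h (by omega)))
  have hk0 : (0 : ℝ) < k := by exact_mod_cast hk
  set D := g.K + g.N + g.R + g.G + g.p + 27 ^ g.K with hD
  filter_upwards [eventually_pow_mul_rpow_le ha0 hab hk0 (65000000 * (D : ℝ) ^ 7 * a ^ r) 7]
    with n hn
  refine le_trans ?_ hn
  have hKm := g.mul_numBlocks_le n
  have hm : g.numBlocks n + 1 ≤ n + 2 := by
    by_contra! h
    have h1 := Nat.mul_le_mul_left g.K (show n + 2 ≤ g.numBlocks n by omega)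
    have h2 := Nat.le_mul_of_pos_left n g.K_pos
    have h3 := g.K_pos
    rw [mul_add] at h1
    omega
  set m := g.numBlocks n
  have hscale : (g.scale m : ℝ) ≤ D * (n + 2 : ℕ) := by
    rw [Gadget.scale]
    exact_mod_cast Nat.mul_le_mul_left _ hm
  have hpow : g.rate ^ m ≤ a ^ r * a ^ ((n : ℝ) / k) := by
    have h1 : (r * m : ℝ) ≤ r + n / k := by
      rw [← sub_le_iff_le_add', le_div_iff₀ hk0]
      have : (k * r * m : ℝ) ≤ n + k * r := by
        rw [hK] at hKm
        exact_mod_cast hKm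
      linarith
    calc g.rate ^ m ≤ (a ^ r) ^ m :=
          pow_le_pow_left₀ (zero_le_one.trans g.one_le_rate) hrate m
      _ = a ^ (r * m : ℝ) := by
          rw [← pow_mul, ← Real.rpow_natCast]
          push_cast
          rfl
      _ ≤ a ^ ((r : ℝ) + n / k) := Real.rpow_le_rpow_of_exponent_le ha1 h1
      _ = _ := by rw [Real.rpow_add ha0, Real.rpow_natCast]
  have hrate0 : 0 ≤ g.rate ^ m := pow_nonneg (zero_le_one.trans g.one_le_rate) _
  calc (g.timeBound n m : ℝ) ≤ 65000000 * (g.scale m : ℝ) ^ 7 * g.rate ^ m :=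
        Gadget.timeBound_le_rate_pow hGle (g.le_mul_numBlocks n)
    _ ≤ 65000000 * (D * (n + 2 : ℕ)) ^ 7 * (a ^ r * a ^ ((n : ℝ) / k)) := by gcongr
    _ = _ := by ring
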